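/- Identify $\mathbb{R}^2$ with $\mathbb{C}$, let $D^2$ be the open unit disc, $\nabla=(\partial_1,\partial_2)$ and $\nabla^\perp=(-\partial_2,\partial_1)$; divergences are taken in the sense of distributions on $D^2$. For $\sigma>0$ let $C^{\sigma}(D^2)=C^{\lfloor\sigma\rfloor,\sigma-\lfloor\sigma\rfloor}(D^2)$ (bounded derivatives up to order $\lfloor\sigma\rfloor$, the one of top order Hölder continuous with exponent $\sigma-\lfloor\sigma\rfloor$), and let $W^{1,(2,\infty)}_{\mathrm{loc}}(D^2)$ be the space of functions whose weak gradient lies locally in the weak Lebesgue space $L^{2,\infty}$. For every $p<2$ and every integer $j\ge 1$ there exist infinitely many distinct points $p_k\in D^2$ ($k\in\mathbb{N}$), isolated in $D^2$ (that is, without accumulation point in $D^2$) and converging to a point $q\in\partial D^2$, a map $g:\overline{D^2}\to\mathbb{S}^1$ that is continuous on $\overline{D^2}\smallsetminus(\{p_k\}_{k}\cup\{q\})$ and belongs to $W^{1,p}(D^2)\cap W^{1,(2,\infty)}_{\mathrm{loc}}(D^2)$, and a map $u\in C^{\sqrt{j^2+j}}(D^2,\mathbb{C})\cap C^0(\overline{D^2},\mathbb{C})$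 such that $$\operatorname{div}(i\bar g\nabla g)=0,\qquad \operatorname{div}(i\bar g\nabla^\perp g)=2\pi\sum_{k}\delta_{p_k},\qquad \operatorname{div}(g\nabla u)=0\qquad\text{in } D^2.$$ Moreover $u$ is smooth on $D^2\smallsetminus\{p_k\}_k$, the zeros of $\nabla u$ in $D^2$ are isolated in $D^2$, and the trace $\theta\mapsto u(e^{i\theta})$ of $u$ on $\partial D^2$ is smooth. -/

import Mathlib

open Set Filter Topology MeasureTheory TopologicalSpace
open scoped ENNReal ContDiff Distributions ComplexConjugate

/-- The open unit disc; the plane `ℝ²` is identified with `ℂ`, so that the coordinate directions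
are `1` and `Complex.I`. -/
def unitDisc : Opens ℂ := ⟨Metric.ball 0 1, Metric.isOpen_ball⟩

/-- The classical gradient `(∂₁ f, ∂₂ f)` of a complex valued function on the plane. -/
noncomputable def grad (f : ℂ → ℂ) (z : ℂ) : ℂ × ℂ :=
  (fderiv ℝ f z 1, fderiv ℝ f z Complex.I)

/-- The rotation `(a, b) ↦ (-b, a)`; it takes `∇ f` to `∇^⊥ f = (-∂₂ f, ∂₁ f)`. -/
def perp (a : ℂ × ℂ) : ℂ × ℂ := (-a.2, a.1)

/-- The (bilinear) dot product on `ℂ²`. -/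
def dot (a b : ℂ × ℂ) : ℂ := a.1 * b.1 + a.2 * b.2

/-- `div X = T` in the sense of distributions on `U`: the vector field `X` is locally integrable
on `U` and `-∫ X · ∇ψ = T ψ` for all test functions `ψ ∈ C_c^∞(U, ℂ)`. -/
def HasDistribDiv (U : Opens ℂ) (X : ℂ → ℂ × ℂ) (T : (ℂ → ℂ) → ℂ) : Prop :=
  LocallyIntegrableOn X U volume ∧
    ∀ ψ : 𝓓(U, ℂ), -∫ z in (U : Set ℂ), dot (X z) (grad ψ z) = T ψ

/-- `F = (F₁, F₂)` is the weak (distributional) gradient of `f` on `U`, with `f` and `F` locally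
integrable on `U`. -/
def HasWeakGrad (U : Opens ℂ) (f : ℂ → ℂ) (F : ℂ → ℂ × ℂ) : Prop :=
  LocallyIntegrableOn f U volume ∧ LocallyIntegrableOn F U volume ∧
    ∀ ψ : 𝓓(U, ℂ),
      (∫ z in (U : Set ℂ), f z * (grad ψ z).1 = -∫ z in (U : Set ℂ), (F z).1 * ψ z) ∧
      (∫ z in (U : Set ℂ), f z * (grad ψ z).2 = -∫ z in (U : Set ℂ), (F z).2 * ψ z)

/-- `f ∈ W^{1,p}(U)`, with weak gradient `F`. -/
def MemW1p (U : Opens ℂ) (p : ℝ≥0∞) (f : ℂ → ℂ) (F : ℂ → ℂ × ℂ) : Prop :=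
  HasWeakGrad U f F ∧ MemLp f p (volume.restrict U) ∧ MemLp F p (volume.restrict U)

/-- `F ∈ L^{2,∞}_loc(U)` (weak `L²`, locally): on every compact `K ⊆ U` the distribution function
of `|F|` is bounded by `C / t²`. -/
def MemWeakL2Loc (U : Opens ℂ) (F : ℂ → ℂ × ℂ) : Prop :=
  AEStronglyMeasurable F (volume.restrict U) ∧
    ∀ K : Set ℂ, IsCompact K → K ⊆ U →
      ∃ C : ℝ, ∀ t : ℝ, 0 < t → volume {z ∈ K | t < ‖F z‖} ≤ ENNReal.ofReal (C / t ^ 2)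

/-- `f ∈ W^{1,(2,∞)}_loc(U)`: the weak gradient `F` of `f` lies in `L^{2,∞}_loc(U)`. -/
def MemW1WeakL2Loc (U : Opens ℂ) (f : ℂ → ℂ) (F : ℂ → ℂ × ℂ) : Prop :=
  HasWeakGrad U f F ∧ MemWeakL2Loc U F

/-- `f ∈ C^σ(U) = C^{k,α}(U)` with `k = ⌊σ⌋` and `α = σ - ⌊σ⌋`: `f` is `C^k` on `U`, its derivatives
up to order `k` are bounded on `U`, and the one of order `k` is `α`-Hölder on `U`. -/
def MemHolderClass (U : Opens ℂ) (σ : ℝ) (f : ℂ → ℂ) : Prop :=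
  ContDiffOn ℝ (⌊σ⌋₊ : ℕ) f U ∧
    (∀ m : ℕ, m ≤ ⌊σ⌋₊ → ∃ C : ℝ, ∀ z ∈ U, ‖iteratedFDeriv ℝ m f z‖ ≤ C) ∧
    ∃ C : ℝ, ∀ z ∈ U, ∀ w ∈ U,
      ‖iteratedFDeriv ℝ ⌊σ⌋₊ f z - iteratedFDeriv ℝ ⌊σ⌋₊ f w‖ ≤ C * ‖z - w‖ ^ (σ - ⌊σ⌋₊)

/-- The points of `S` are isolated in `U`: `S` has no accumulation point in `U`. -/
def IsolatedIn (U : Opens ℂ) (S : Set ℂ) : Prop :=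
  ∀ z ∈ U, ∀ᶠ w in 𝓝[≠] z, w ∉ S

/-! Let F be holomorphic, and away from its zeros put g = F/|F| and u = F^j |F|^α. In Wirtinger
notation div(g∇u) = 2(∂̄(g ∂u) + ∂(g ∂̄u)). Each derivative lowers one exponent of F or of its
conjugate, so the sum is (2jα + α² - j) times an explicit product containing |F'|². It vanishes
exactly when (j+α)² = j² + j, whatever F is (`div_vortex_mul_grad_flatSolution`). Here 0 < α < 1,
and u has degree j+α in F. This makes u of class C^{j,α} across the zeros (`isHolderOn_homTerm`) and
g∇u continuous there, so the zeros add nothing to the distributional divergence.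

With h = F'/F one has i ḡ ∇g = -(Im h, Re h) and i ḡ ∇^⊥g = (Re h, -Im h). At simple zeros p_k, ∂̄h
= π ∑ δ_{p_k} (`setIntegral_flatLogDeriv_mul_dbar`), and the two equations for g are the
combinations of this identity with its conjugate.

It remains to find F with infinitely many simple zeros tending to one boundary point and with good
control there. Put L = -log(1 - z), which maps the disc into the half strip Re L > -log 2, |Im L| <
π/2, and F = exp(-L²) sin(πL). In the disc the zeros are L = 0, 1, 2, ..., that is p_k = 1 - e^{-k}.
Since L' = e^L, differentiation only produces factors e^{cL} and L^m, and the Gaussian beats them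
all (`exists_norm_flatMonomial_le`); hence all derivatives of F are bounded and F is flat at 1.

The logarithmic derivative is F'/F = e^L (π cot πL - 2L). Comparing Re L with the nearest integer
bounds it by C/|z - p| for one centre p at distance O(e^{-n}) from z, plus 2|L|/|1-z|
(`exists_norm_flatLogDeriv_le`). Summing over the centres gives L^p for p < 2; on a compact set only
finitely many centres matter, which gives weak L². The weak gradient of g comes from the continuous
regularizations F|F|^(ε-1).

On the unit circle near 1 one has |Im L| ≥ 1, so cot πL stays bounded. Every θ-derivative of the
trace of u is therefore u times a function of at most polynomial growth in 1/|1-z|, and the flatness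
of u absorbs this factor (`hasDerivAt_trace_mul`). -/

/-! ### Wirtinger calculus -/

/-- `f` is real differentiable at `z`, with Wirtinger derivatives `∂f = a` and `∂̄f = b`. -/
def HasWirtingerAt (f : ℂ → ℂ) (a b z : ℂ) : Prop :=
  HasFDerivAt f (a • (1 : ℂ →L[ℝ] ℂ) + b • (Complex.conjCLE : ℂ →L[ℝ] ℂ)) z

namespace HasWirtingerAt

variable {f g φ : ℂ → ℂ} {a b a₁ b₁ c z : ℂ}

theorem fderiv_one (h : HasWirtingerAt f a b z) : fderiv ℝ f z 1 = a + b := by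
  rw [HasFDerivAt.fderiv h]; simp

theorem fderiv_I (h : HasWirtingerAt f a b z) :
    fderiv ℝ f z Complex.I = Complex.I * (a - b) := by
  rw [HasFDerivAt.fderiv h]; simp; ring

theorem differentiableAt (h : HasWirtingerAt f a b z) : DifferentiableAt ℝ f z :=
  HasFDerivAt.differentiableAt h

theorem of_hasDerivAt (h : HasDerivAt f a z) : HasWirtingerAt f a 0 z := by
  have := h.hasFDerivAt.restrictScalars ℝ
  refine HasFDerivAt.congr_fderiv this ?_
  ext; simp [mul_comm]

theorem conjugate (h : HasWirtingerAt f a b z) :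
    HasWirtingerAt (fun w => conj (f w)) (conj b) (conj a) z := by
  have := (Complex.conjCLE : ℂ →L[ℝ] ℂ).hasFDerivAt.comp z h
  refine HasFDerivAt.congr_fderiv this ?_
  ext; simp; ring

theorem mul (h : HasWirtingerAt f a b z) (h₁ : HasWirtingerAt g a₁ b₁ z) :
    HasWirtingerAt (fun w => f w * g w) (a * g z + f z * a₁) (b * g z + f z * b₁) z := by
  have := HasFDerivAt.fun_mul h h₁
  refine HasFDerivAt.congr_fderiv this ?_
  ext; simp; ring

theorem comp_hasDerivAt (h : HasWirtingerAt f a b z) (hφ : HasDerivAt φ c (f z)) :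
    HasWirtingerAt (fun w => φ (f w)) (c * a) (c * b) z := by
  have := (hφ.hasFDerivAt.restrictScalars ℝ).comp z h
  refine HasFDerivAt.congr_fderiv this ?_
  ext; simp; ring

theorem const_mul (h : HasWirtingerAt f a b z) (c : ℂ) :
    HasWirtingerAt (fun w => c * f w) (c * a) (c * b) z := by
  have := HasFDerivAt.const_mul h c
  refine HasFDerivAt.congr_fderiv this ?_
  ext; simp; ring

theorem congr (h : HasWirtingerAt f a b z) (ha : a = a₁) (hb : b = b₁) :
    HasWirtingerAt f a₁ b₁ z := ha ▸ hb ▸ h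

theorem congr_of_eventuallyEq (h : HasWirtingerAt f a b z) (hg : g =ᶠ[𝓝 z] f) :
    HasWirtingerAt g a b z := HasFDerivAt.congr_of_eventuallyEq h hg

end HasWirtingerAt

theorem DifferentiableAt.hasWirtingerAt {f : ℂ → ℂ} {z : ℂ} (hf : DifferentiableAt ℝ f z) :
    HasWirtingerAt f ((fderiv ℝ f z 1 - Complex.I * fderiv ℝ f z Complex.I) / 2)
      ((fderiv ℝ f z 1 + Complex.I * fderiv ℝ f z Complex.I) / 2) z := by
  refine hf.hasFDerivAt.congr_fderiv ?_
  ext w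
  have h1 : fderiv ℝ f z w = w.re * fderiv ℝ f z 1 + w.im * fderiv ℝ f z Complex.I := by
    conv_lhs => rw [show w = w.re • (1 : ℂ) + w.im • Complex.I by simp]
    rw [map_add, map_smul, map_smul]; simp
  have h2 : conj w = w.re - w.im * Complex.I := by apply Complex.ext <;> simp
  have h3 : w = w.re + w.im * Complex.I := (Complex.re_add_im w).symm
  have := Complex.I_mul_I
  rw [h1]
  simp only [add_apply, smul_apply,
    one_apply_eq_self, ContinuousLinearEquiv.coe_coe, Complex.conjCLE_apply, smul_eq_mul,
    h2]
  linear_combination (w.im * fderiv ℝ f z Complex.I) * this -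
    (fderiv ℝ f z 1 - Complex.I * fderiv ℝ f z Complex.I) / 2 * h3

/-! ### The divergence theorem and the Cauchy–Pompeiu formula -/

/-- The divergence theorem for a compactly supported continuous field that is differentiable off
a countable set. -/
theorem integral_div_eq_zero {X Y : ℂ → ℂ} {X' Y' : ℂ → ℂ →L[ℝ] ℂ} {S : Set ℂ}
    (hS : S.Countable) (hX : Continuous X) (hY : Continuous Y)
    (cX : HasCompactSupport X) (cY : HasCompactSupport Y)
    (dX : ∀ z, z ∉ S → HasFDerivAt X (X' z) z) (dY : ∀ z, z ∉ S → HasFDerivAt Y (Y' z) z)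
    (hi : Integrable fun z => X' z 1 + Y' z Complex.I) :
    ∫ z, (X' z 1 + Y' z Complex.I) = 0 := by
  obtain ⟨R, hR0, hR⟩ : ∃ R > 0, tsupport X ∪ tsupport Y ⊆ Metric.ball 0 R :=
    (cX.isCompact.union cY.isCompact).isBounded.subset_ball_lt 0 0
  have hX0 : ∀ z : ℂ, R ≤ ‖z‖ → z ∉ tsupport X := fun z hz h => by
    have := hR (Or.inl h); simp at this; linarith
  have hY0 : ∀ z : ℂ, R ≤ ‖z‖ → z ∉ tsupport Y := fun z hz h => by
    have := hR (Or.inr h); simp at this; linarith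
  let e : ℝ × ℝ →L[ℝ] ℂ := (Complex.equivRealProdCLM.symm : ℝ × ℝ →L[ℝ] ℂ)
  have he : ∀ p, e p = Complex.measurableEquivRealProd.symm p := fun p => rfl
  have hn1 : ∀ p : ℝ × ℝ, |p.1| ≤ ‖e p‖ := fun p => Complex.abs_re_le_norm (e p)
  have hn2 : ∀ p : ℝ × ℝ, |p.2| ≤ ‖e p‖ := fun p => Complex.abs_im_le_norm (e p)
  have e1 : e (1, 0) = 1 := by apply Complex.ext <;> simp [e]
  have e2 : e (0, 1) = Complex.I := by apply Complex.ext <;> simp [e]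
  have hmp := Complex.volume_preserving_equiv_real_prod.symm
  rw [← hmp.integral_comp Complex.measurableEquivRealProd.symm.measurableEmbedding]
  have hInt := (hmp.integrable_comp_emb
    Complex.measurableEquivRealProd.symm.measurableEmbedding).2 hi
  have hS' : (e ⁻¹' S).Countable := hS.preimage Complex.equivRealProdCLM.symm.injective
  have hle : ((-R, -R) : ℝ × ℝ) ≤ (R, R) := ⟨by simp; linarith, by simp; linarith⟩
  -- The square contains both supports, so all four boundary integrals vanish.
  have key := integral_divergence_prod_Icc_of_hasFDerivAt_off_countable_of_le
    (fun p => X (e p)) (fun p => Y (e p)) (fun p => (X' (e p)).comp e) (fun p => (Y' (e p)).comp e)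
    (-R, -R) (R, R) hle (e ⁻¹' S) hS' (hX.comp e.continuous).continuousOn
    (hY.comp e.continuous).continuousOn
    (fun p hp => (dX _ hp.2).comp p e.hasFDerivAt) (fun p hp => (dY _ hp.2).comp p e.hasFDerivAt)
    (by simp only [ContinuousLinearMap.comp_apply, e1, e2]; exact hInt.integrableOn)
  simp only [ContinuousLinearMap.comp_apply, e1, e2] at key
  have hb1 : ∀ x : ℝ, Y (e (x, R)) = 0 := fun x =>
    image_eq_zero_of_notMem_tsupport (hY0 _ ((le_abs_self R).trans (hn2 (x, R))))
  have hb2 : ∀ x : ℝ, Y (e (x, -R)) = 0 := fun x =>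
    image_eq_zero_of_notMem_tsupport (hY0 _ (by
      have := hn2 (x, -R); simp only [abs_neg] at this; exact (le_abs_self R).trans this))
  have hb3 : ∀ x : ℝ, X (e (R, x)) = 0 := fun x =>
    image_eq_zero_of_notMem_tsupport (hX0 _ ((le_abs_self R).trans (hn1 (R, x))))
  have hb4 : ∀ x : ℝ, X (e (-R, x)) = 0 := fun x =>
    image_eq_zero_of_notMem_tsupport (hX0 _ (by
      have := hn1 (-R, x); simp only [abs_neg] at this; exact (le_abs_self R).trans this))
  simp only [hb1, hb2, hb3, hb4] at key
  simp only [intervalIntegral.integral_zero, sub_zero, add_zero] at key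
  rw [← key]
  symm
  refine setIntegral_eq_integral_of_ae_compl_eq_zero ?_
  filter_upwards [hS'.ae_notMem volume] with p hpS hp
  have hpR : R ≤ ‖e p‖ := by
    by_contra hlt
    push Not at hlt
    refine hp ⟨⟨?_, ?_⟩, ⟨?_, ?_⟩⟩
    · exact (abs_le.1 ((hn1 p).trans hlt.le)).1
    · exact (abs_le.1 ((hn2 p).trans hlt.le)).1
    · exact (abs_le.1 ((hn1 p).trans hlt.le)).2
    · exact (abs_le.1 ((hn2 p).trans hlt.le)).2
  have zero : ∀ {V : ℂ → ℂ} {V' : ℂ →L[ℝ] ℂ}, e p ∉ tsupport V → HasFDerivAt V V' (e p) →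
      V' = 0 := fun hv hd => hd.unique
    ((hasFDerivAt_const (0 : ℂ) (e p)).congr_of_eventuallyEq (notMem_tsupport_iff_eventuallyEq.1 hv))
  rw [zero (hX0 _ hpR) (dX _ hpS), zero (hY0 _ hpR) (dY _ hpS)]
  simp

theorem integrableOn_norm_rpow_neg {s : ℝ} (hs : s < 2) (R : ℝ) :
    IntegrableOn (fun z : ℂ => ‖z‖ ^ (-s)) (Metric.ball 0 R) := by
  rw [integrableOn_fun_norm_addHaar volume (f := fun y => y ^ (-s))]
  simp only [Complex.finrank_real_complex]
  rcases le_or_gt R 0 with hR | hR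
  · simp [Ioo_eq_empty_of_le hR]
  have : IntegrableOn (fun y : ℝ => y ^ (1 - s)) (Ioo 0 R) :=
    (intervalIntegral.integrableOn_Ioo_rpow_iff hR).2 (by linarith)
  refine this.congr_fun (fun y hy => ?_) measurableSet_Ioo
  simp only [smul_eq_mul]
  rw [sub_eq_add_neg, Real.rpow_add hy.1]; simp

theorem integrable_div_sub {φ : ℂ → ℂ} (hφ : Continuous φ) (cφ : HasCompactSupport φ) (p : ℂ) :
    Integrable fun z => ‖z - p‖⁻¹ * ‖φ z‖ := by
  obtain ⟨C, hC⟩ := hφ.bounded_above_of_compact_support cφ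
  obtain ⟨R, hR⟩ := cφ.isCompact.isBounded.subset_ball p
  have h1 : IntegrableOn (fun z : ℂ => ‖z - p‖⁻¹) (Metric.ball p R) := by
    have := (integrableOn_norm_rpow_neg (s := 1) (by norm_num) R)
    have hmp := measurePreserving_sub_right (volume : Measure ℂ) p
    rw [← hmp.integrableOn_comp_preimage (MeasurableEquiv.subRight p).measurableEmbedding] at this
    have hpre : (fun z : ℂ => z - p) ⁻¹' Metric.ball 0 R = Metric.ball p R := by
      ext z; simp [dist_eq_norm]
    rw [hpre] at this
    refine this.congr_fun (fun z _ => ?_) Metric.isOpen_ball.measurableSet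
    simp [Real.rpow_neg_one]
  have h2 : IntegrableOn (fun z : ℂ => ‖z - p‖⁻¹ * ‖φ z‖) (Metric.ball p R) :=
    h1.mul_bdd (c := C) hφ.norm.aestronglyMeasurable (Eventually.of_forall fun z => by simpa using hC z)
  refine (integrableOn_iff_integrable_of_support_subset fun z hz => ?_).1 h2
  refine hR (subset_tsupport _ ?_)
  intro h0
  exact hz (by simp [h0])

/-- This density is the profile of the approximate identity in the Cauchy–Pompeiu formula. In polar
coordinates r(1+r²)^{-2} is the derivative of -(1/2)(1+r²)^{-1}. -/
theorem integral_one_add_sq_inv_sq :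
    ∫ z : ℂ, Real.pi⁻¹ * ((1 + ‖z‖ ^ 2) ^ 2)⁻¹ = 1 := by
  rw [integral_const_mul, integral_fun_norm_addHaar volume (fun r : ℝ => ((1 + r ^ 2) ^ 2)⁻¹)]
  have hd : ∀ x : ℝ, HasDerivAt (fun r : ℝ => -(1 / 2) * (1 + r ^ 2)⁻¹)
      (x * ((1 + x ^ 2) ^ 2)⁻¹) x := fun x => by
    have hne : 1 + x ^ 2 ≠ 0 := by positivity
    have := (((hasDerivAt_pow 2 x).const_add 1).inv hne).const_mul (-(1 / 2 : ℝ))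
    refine this.congr_deriv ?_
    field_simp
    norm_num
  have ht : Tendsto (fun r : ℝ => -(1 / 2) * (1 + r ^ 2)⁻¹) atTop (𝓝 0) := by
    have : Tendsto (fun r : ℝ => 1 + r ^ 2) atTop atTop :=
      tendsto_atTop_add_const_left _ _ (tendsto_pow_atTop two_ne_zero)
    simpa using this.inv_tendsto_atTop.const_mul (-(1 / 2 : ℝ))
  have := integral_Ioi_of_hasDerivAt_of_nonneg' (a := 0) (fun x _ => hd x)
    (fun x hx => mul_nonneg (le_of_lt hx) (by positivity)) ht
  simp only [Complex.finrank_real_complex, smul_eq_mul]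
  norm_num at this ⊢
  rw [this]
  simp [Measure.real, Complex.volume_ball]
  field_simp


/-- The smooth kernels c² w̄/(1 + c²|w|²), with w = z - p, are bounded by 1/|w|, which is locally
integrable in the plane, and tend to 1/w off w = 0. Dominated convergence applies. -/
theorem tendsto_regularized_inv_integral {φ : ℂ → ℂ} (hφ : Continuous φ)
    (cφ : HasCompactSupport φ) (p : ℂ) :
    Tendsto (fun c : ℝ => ∫ z, (c ^ 2 * conj (z - p) * (1 + c ^ 2 * ((z - p) * conj (z - p)))⁻¹) * φ z)
      atTop (𝓝 (∫ z, (z - p)⁻¹ * φ z)) := by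
  have hden : ∀ (c : ℝ) (z : ℂ), (1 + c ^ 2 * ((z - p) * conj (z - p)) : ℂ)
      = ((1 + c ^ 2 * ‖z - p‖ ^ 2 : ℝ) : ℂ) := fun c z => by
    rw [Complex.mul_conj, Complex.normSq_eq_norm_sq]; push_cast; ring
  have hne : ∀ (c : ℝ) (z : ℂ), (1 + c ^ 2 * ((z - p) * conj (z - p)) : ℂ) ≠ 0 := fun c z => by
    rw [hden]; norm_cast; positivity
  refine tendsto_integral_filter_of_dominated_convergence (fun z => ‖z - p‖⁻¹ * ‖φ z‖) ?_ ?_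
    (integrable_div_sub hφ cφ p) ?_
  · refine Eventually.of_forall fun c => Continuous.aestronglyMeasurable ?_
    refine Continuous.mul (Continuous.mul (by fun_prop) (Continuous.inv₀ (by fun_prop) (hne c))) hφ
  · refine Eventually.of_forall fun c => Eventually.of_forall fun z => ?_
    rw [norm_mul]
    gcongr
    rcases eq_or_ne z p with rfl | hzp
    · simp
    have hpos : 0 < ‖z - p‖ := norm_pos_iff.2 (sub_ne_zero.2 hzp)
    rw [hden, norm_mul, norm_inv, Complex.norm_real, norm_mul, RCLike.norm_conj, norm_pow,
      Complex.norm_real, Real.norm_of_nonneg (by positivity : (0 : ℝ) ≤ 1 + c ^ 2 * ‖z - p‖ ^ 2),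
      Real.norm_eq_abs, sq_abs]
    rw [← div_eq_mul_inv, div_le_iff₀ (by positivity)]
    field_simp
    nlinarith
  · filter_upwards [(countable_singleton p).ae_notMem volume] with z hz
    refine Tendsto.mul_const _ ?_
    have hzp : z - p ≠ 0 := sub_ne_zero.2 hz
    have hcz : conj (z - p) ≠ 0 := (map_ne_zero _).2 hzp
    have h1 : Tendsto (fun c : ℝ => (((c ^ 2 : ℝ) : ℂ))⁻¹) atTop (𝓝 0) := by
      have h0 : Tendsto (fun c : ℝ => (c ^ 2)⁻¹) atTop (𝓝 0) :=
        (tendsto_pow_atTop two_ne_zero).inv_tendsto_atTop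
      have := (Complex.continuous_ofReal.tendsto 0).comp h0
      simpa [Function.comp_def] using this
    have h2 := ((h1.add_const ((z - p) * conj (z - p))).inv₀
      (by rw [zero_add]; exact mul_ne_zero hzp hcz)).const_mul (conj (z - p))
    have h3 : conj (z - p) * (0 + (z - p) * conj (z - p))⁻¹ = (z - p)⁻¹ := by
      rw [zero_add]; field_simp
    rw [h3] at h2
    refine h2.congr' ?_
    filter_upwards [eventually_gt_atTop 0] with c hc
    have hc' : (c : ℂ) ≠ 0 := by exact_mod_cast hc.ne'
    have : (((c ^ 2 : ℝ) : ℂ))⁻¹ + (z - p) * conj (z - p)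
        = ((c : ℂ) ^ 2)⁻¹ * (1 + c ^ 2 * ((z - p) * conj (z - p))) := by
      push_cast; field_simp
    rw [this, mul_inv, inv_inv]; ring

/-- The Cauchy–Pompeiu formula for compactly supported functions. -/
theorem integral_inv_sub_mul_dbar {ψ : ℂ → ℂ} (hψ : ContDiff ℝ 1 ψ) (cψ : HasCompactSupport ψ)
    (p : ℂ) :
    ∫ z, (z - p)⁻¹ * (fderiv ℝ ψ z 1 + Complex.I * fderiv ℝ ψ z Complex.I)
      = -(2 * Real.pi) * ψ p := by
  have hd : Continuous (fderiv ℝ ψ) := hψ.continuous_fderiv one_ne_zero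
  have hφ : Continuous fun z => fderiv ℝ ψ z 1 + Complex.I * fderiv ℝ ψ z Complex.I := by fun_prop
  have cφ : HasCompactSupport fun z => fderiv ℝ ψ z 1 + Complex.I * fderiv ℝ ψ z Complex.I := by
    refine (cψ.fderiv ℝ).mono fun z hz h0 => hz ?_
    simp [h0]
  refine tendsto_nhds_unique (tendsto_regularized_inv_integral hφ cφ p) ?_
  have hden : ∀ (c : ℝ) (z : ℂ), (1 + c ^ 2 * ((z - p) * conj (z - p)) : ℂ)
      = ((1 + c ^ 2 * ‖z - p‖ ^ 2 : ℝ) : ℂ) := fun c z => by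
    rw [Complex.mul_conj, Complex.normSq_eq_norm_sq]; push_cast; ring
  have hne : ∀ (c : ℝ) (z : ℂ), (1 + c ^ 2 * ((z - p) * conj (z - p)) : ℂ) ≠ 0 := fun c z => by
    rw [hden]; norm_cast; positivity
  -- The ∂̄-derivative of the regularized kernel is π times the rescaled density c² φ(c(p - z)),
  -- which concentrates at p as c → ∞.
  have hpeak := tendsto_integral_comp_smul_smul_of_integrable' (μ := (volume : Measure ℂ))
    (φ := fun z : ℂ => Real.pi⁻¹ * ((1 + ‖z‖ ^ 2) ^ 2)⁻¹) (fun z => by positivity)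
    integral_one_add_sq_inv_sq ?_ (hψ.continuous.integrable_of_hasCompactSupport cψ)
    (hψ.continuous.continuousAt (x := p))
  · refine (hpeak.const_mul (-(2 * Real.pi) : ℂ)).congr fun c => ?_
    set K : ℂ → ℂ := fun z => c ^ 2 * conj (z - p) * (1 + c ^ 2 * ((z - p) * conj (z - p)))⁻¹ with hK
    have hKc : Continuous K :=
      Continuous.mul (by fun_prop) (Continuous.inv₀ (by fun_prop) (hne c))
    have hKd : ∀ z, HasWirtingerAt K (-(c ^ 2 * conj (z - p)) ^ 2
        * ((1 + c ^ 2 * ((z - p) * conj (z - p))) ^ 2)⁻¹)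
        (c ^ 2 * ((1 + c ^ 2 * ((z - p) * conj (z - p))) ^ 2)⁻¹) z := fun z => by
      have h1 : HasWirtingerAt (fun z => z - p) 1 0 z :=
        .of_hasDerivAt ((hasDerivAt_id z).sub_const p)
      have h2 := (h1.mul h1.conjugate).comp_hasDerivAt
        (φ := fun w => (1 + c ^ 2 * w)⁻¹)
        ((((hasDerivAt_id ((z - p) * conj (z - p))).const_mul ((c : ℂ) ^ 2)).const_add 1).inv
          (hne c z))
      have h3 := (h1.conjugate.comp_hasDerivAt
        ((hasDerivAt_id (conj (z - p))).const_mul ((c : ℂ) ^ 2))).mul h2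
      refine h3.congr ?_ ?_
      · simp; field_simp [hne c z]
      · have := hne c z
        simp at this ⊢
        field_simp
        ring
    have hψd : ∀ z, DifferentiableAt ℝ ψ z := fun z => (hψ.differentiable one_ne_zero) z
    have hXd := fun z => ((hKd z).mul (hψd z).hasWirtingerAt)
    have hYd := fun z => (hXd z).const_mul Complex.I
    -- The field (Kψ, iKψ) has divergence 2∂̄(Kψ); the two summands are K · 2∂̄ψ and ψ · 2∂̄K.
    have hsum : ∀ z, fderiv ℝ (fun w => K w * ψ w) z 1
        + fderiv ℝ (fun w => Complex.I * (K w * ψ w)) z Complex.I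
        = K z * (fderiv ℝ ψ z 1 + Complex.I * fderiv ℝ ψ z Complex.I)
        + 2 * Real.pi * ((c ^ 2 * (Real.pi⁻¹ * ((1 + ‖c • (p - z)‖ ^ 2) ^ 2)⁻¹) : ℝ) • ψ z) :=
      fun z => by
      have e1 := (hXd z).fderiv_one
      have e2 := (hYd z).fderiv_I
      have e3 : ∀ a b : ℂ, a + b + Complex.I * (Complex.I * a - Complex.I * b) = 2 * b :=
        fun a b => by linear_combination (a - b) * Complex.I_mul_I
      rw [e1, e2, e3, hden]
      have hpi : (Real.pi : ℂ) ≠ 0 := by exact_mod_cast Real.pi_ne_zero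
      have hn : ‖c • (p - z)‖ ^ 2 = c ^ 2 * ‖z - p‖ ^ 2 := by
        rw [norm_smul, mul_pow, norm_sub_rev, Real.norm_eq_abs, sq_abs]
      rw [hn, Complex.real_smul]
      generalize K z = k
      generalize fderiv ℝ ψ z Complex.I = d
      generalize 1 + c ^ 2 * ‖z - p‖ ^ 2 = m
      push_cast
      field_simp
      ring
    have i1 : Integrable fun z => K z * (fderiv ℝ ψ z 1 + Complex.I * fderiv ℝ ψ z Complex.I) :=
      (hKc.mul hφ).integrable_of_hasCompactSupport cφ.mul_left
    have i2 : Integrable fun z => 2 * (Real.pi : ℂ) *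
        ((c ^ 2 * (Real.pi⁻¹ * ((1 + ‖c • (p - z)‖ ^ 2) ^ 2)⁻¹) : ℝ) • ψ z) := by
      have hc : Continuous fun z : ℂ =>
          (c ^ 2 * (Real.pi⁻¹ * ((1 + ‖c • (p - z)‖ ^ 2) ^ 2)⁻¹) : ℝ) • ψ z := by
        have h0 : Continuous fun z : ℂ => (1 + ‖c • (p - z)‖ ^ 2) ^ 2 := by fun_prop
        have h1 := h0.inv₀ fun z => by positivity
        exact (continuous_const.mul (continuous_const.mul h1)).smul hψ.continuous
      exact (hc.integrable_of_hasCompactSupport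
        (cψ.mono fun z hz h0 => hz (by simp only [h0, smul_zero]))).const_mul _
    have key := integral_div_eq_zero (X := fun w => K w * ψ w)
      (Y := fun w => Complex.I * (K w * ψ w)) countable_empty
      (hKc.mul hψ.continuous) (continuous_const.mul (hKc.mul hψ.continuous)) cψ.mul_left
      (cψ.mul_left.mul_left) (fun z _ => (hXd z).differentiableAt.hasFDerivAt)
      (fun z _ => (hYd z).differentiableAt.hasFDerivAt) ((i1.add i2).congr (Eventually.of_forall fun z => (hsum z).symm))
    rw [integral_congr_ae (Eventually.of_forall hsum), integral_add i1 i2, integral_const_mul] at key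
    simp only [Complex.finrank_real_complex]
    linear_combination -key
  -- The remaining hypothesis on the profile: |z|² φ(z) → 0 at infinity.
  · simp only [Complex.finrank_real_complex]
    have h0 : Tendsto (fun z : ℂ => (1 + ‖z‖ ^ 2)⁻¹) (Bornology.cobounded ℂ) (𝓝 0) :=
      (tendsto_atTop_add_const_left _ 1
        ((tendsto_pow_atTop two_ne_zero).comp tendsto_norm_cobounded_atTop)).inv_tendsto_atTop
    have h1 := h0.const_mul Real.pi⁻¹
    rw [mul_zero] at h1
    refine squeeze_zero (fun z => by positivity) (fun z => ?_) h1
    have hp := Real.pi_pos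
    rw [mul_left_comm]
    gcongr
    rw [← div_eq_mul_inv, div_le_iff₀ (by positivity)]
    field_simp
    nlinarith [sq_nonneg ‖z‖]

/-! ### Hölder classes on plane domains -/

/-- The Hölder class `C^{n,α}(U)` of maps from the plane to a normed space. -/
def IsHolderOn {E : Type*} [NormedAddCommGroup E] [NormedSpace ℝ E] (U : Set ℂ) (n : ℕ) (α : ℝ)
    (f : ℂ → E) : Prop :=
  ContDiffOn ℝ n f U ∧ (∀ m : ℕ, m ≤ n → ∃ C : ℝ, ∀ z ∈ U, ‖iteratedFDeriv ℝ m f z‖ ≤ C) ∧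
    ∃ C : ℝ, ∀ z ∈ U, ∀ w ∈ U,
      ‖iteratedFDeriv ℝ n f z - iteratedFDeriv ℝ n f w‖ ≤ C * ‖z - w‖ ^ α

namespace IsHolderOn

variable {E G : Type*} [NormedAddCommGroup E] [NormedSpace ℝ E] [NormedAddCommGroup G]
  [NormedSpace ℝ G] {U : Set ℂ} {n : ℕ} {α : ℝ} {f g : ℂ → E}

theorem congr (hf : IsHolderOn U n α f) (hU : IsOpen U) (h : EqOn g f U) :
    IsHolderOn U n α g := by
  have key : ∀ m : ℕ, ∀ z ∈ U, iteratedFDeriv ℝ m g z = iteratedFDeriv ℝ m f z := fun m z hz =>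
    (Filter.EventuallyEq.iteratedFDeriv ℝ (h.eventuallyEq_of_mem (hU.mem_nhds hz)) m).eq_of_nhds
  obtain ⟨h1, h2, C, hC⟩ := hf
  refine ⟨h1.congr h, fun m hm => ?_, C, fun z hz w hw => ?_⟩
  · obtain ⟨D, hD⟩ := h2 m hm
    exact ⟨D, fun z hz => by rw [key m z hz]; exact hD z hz⟩
  · rw [key n z hz, key n w hw]; exact hC z hz w hw

theorem add (hf : IsHolderOn U n α f) (hg : IsHolderOn U n α g) (hU : IsOpen U) :
    IsHolderOn U n α (fun z => f z + g z) := by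
  obtain ⟨h1, h2, C, hC⟩ := hf
  obtain ⟨k1, k2, D, hD⟩ := hg
  have key : ∀ m : ℕ, m ≤ n → ∀ z ∈ U, iteratedFDeriv ℝ m (fun z => f z + g z) z
      = iteratedFDeriv ℝ m f z + iteratedFDeriv ℝ m g z := fun m hm z hz =>
    fun_iteratedFDeriv_add_apply
      ((h1.contDiffAt (hU.mem_nhds hz)).of_le (by exact_mod_cast hm))
      ((k1.contDiffAt (hU.mem_nhds hz)).of_le (by exact_mod_cast hm))
  refine ⟨h1.add k1, fun m hm => ?_, C + D, fun z hz w hw => ?_⟩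
  · obtain ⟨A, hA⟩ := h2 m hm
    obtain ⟨B, hB⟩ := k2 m hm
    exact ⟨A + B, fun z hz => by
      rw [key m hm z hz]; exact (norm_add_le _ _).trans (add_le_add (hA z hz) (hB z hz))⟩
  · rw [key n le_rfl z hz, key n le_rfl w hw, add_sub_add_comm, add_mul]
    exact (norm_add_le _ _).trans (add_le_add (hC z hz w hw) (hD z hz w hw))

theorem clm_comp (hf : IsHolderOn U n α f) (hU : IsOpen U) (L : E →L[ℝ] G) :
    IsHolderOn U n α (fun z => L (f z)) := by
  obtain ⟨h1, h2, C, hC⟩ := hf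
  have key : ∀ m : ℕ, m ≤ n → ∀ z ∈ U, iteratedFDeriv ℝ m (fun z => L (f z)) z
      = L.compContinuousMultilinearMap (iteratedFDeriv ℝ m f z) := fun m hm z hz =>
    L.iteratedFDeriv_comp_left (h1.contDiffAt (hU.mem_nhds hz)) (by exact_mod_cast hm)
  refine ⟨L.contDiff.comp_contDiffOn h1, fun m hm => ?_, ‖L‖ * C, fun z hz w hw => ?_⟩
  · obtain ⟨A, hA⟩ := h2 m hm
    refine ⟨‖L‖ * A, fun z hz => ?_⟩
    rw [key m hm z hz]
    exact (L.norm_compContinuousMultilinearMap_le _).trans (by gcongr; exact hA z hz)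
  · rw [key n le_rfl z hz, key n le_rfl w hw]
    have : L.compContinuousMultilinearMap (iteratedFDeriv ℝ n f z)
        - L.compContinuousMultilinearMap (iteratedFDeriv ℝ n f w)
        = L.compContinuousMultilinearMap (iteratedFDeriv ℝ n f z - iteratedFDeriv ℝ n f w) := by
      ext; simp
    rw [this, mul_assoc]
    exact (L.norm_compContinuousMultilinearMap_le _).trans (by gcongr; exact hC z hz w hw)

theorem of_norm_le (h0 : 0 < α) {B C : ℝ} (hB : ∀ z ∈ U, ‖f z‖ ≤ B)
    (hC : ∀ z ∈ U, ∀ w ∈ U, ‖f z - f w‖ ≤ C * ‖z - w‖ ^ α) : IsHolderOn U 0 α f := by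
  refine ⟨?_, fun m hm => ⟨B, fun z hz => ?_⟩, C, fun z hz w hw => ?_⟩
  · simp only [Nat.cast_zero, contDiffOn_zero]
    intro w hw
    rw [ContinuousWithinAt, tendsto_iff_norm_sub_tendsto_zero]
    have : Tendsto (fun z => C * ‖z - w‖ ^ α) (𝓝[U] w) (𝓝 0) := by
      have h : Continuous fun z => C * ‖z - w‖ ^ α :=
        continuous_const.mul ((by fun_prop : Continuous fun z => ‖z - w‖).rpow_const
          fun _ => Or.inr h0.le)
      simpa [Real.zero_rpow h0.ne'] using (h.tendsto w).mono_left nhdsWithin_le_nhds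
    refine squeeze_zero' (Eventually.of_forall fun _ => norm_nonneg _) ?_ this
    filter_upwards [self_mem_nhdsWithin] with z hz using hC z hz w hw
  · obtain rfl : m = 0 := Nat.le_zero.1 hm
    simpa using hB z hz
  · rw [iteratedFDeriv_zero_eq_comp]
    simp only [Function.comp_apply, ← map_sub, LinearIsometryEquiv.norm_map]
    exact hC z hz w hw

/-- The derivative of order n+1 of f is, up to a linear isometry, the derivative of order n of its
differential. This permits induction on the order of the class. -/
theorem succ_of_hasFDerivAt (hU : IsOpen U) {f' : ℂ → ℂ →L[ℝ] E} {B : ℝ}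
    (hB : ∀ z ∈ U, ‖f z‖ ≤ B) (hd : ∀ z ∈ U, HasFDerivAt f (f' z) z)
    (hf' : IsHolderOn U n α f') : IsHolderOn U (n + 1) α f := by
  have hfd : IsHolderOn U n α (fderiv ℝ f) := hf'.congr hU fun z hz => (hd z hz).fderiv
  obtain ⟨h1, h2, C, hC⟩ := hfd
  refine ⟨?_, fun m hm => ?_, C, fun z hz w hw => ?_⟩
  · rw [Nat.cast_add, Nat.cast_one, contDiffOn_succ_iff_fderiv_of_isOpen hU]
    exact ⟨fun z hz => (hd z hz).differentiableAt.differentiableWithinAt, by simp, h1⟩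
  · rcases m with _ | m
    · exact ⟨B, fun z hz => by simpa using hB z hz⟩
    · obtain ⟨A, hA⟩ := h2 m (by omega)
      refine ⟨A, fun z hz => ?_⟩
      rw [iteratedFDeriv_succ_eq_comp_right, Function.comp_apply, LinearIsometryEquiv.norm_map]
      exact hA z hz
  · simp only [iteratedFDeriv_succ_eq_comp_right, Function.comp_apply]
    rw [← dist_eq_norm, LinearIsometryEquiv.dist_map, dist_eq_norm]
    exact hC z hz w hw

end IsHolderOn

/-! ### Hölder estimates for homogeneous functions -/

/-- Interpolation between a bound and a Lipschitz bound: d ≤ d^α for d ≤ 1, while 1 ≤ d^α for d ≥ 1.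
-/
theorem le_mul_rpow_of_le_of_le {x M K d α : ℝ} (h0 : 0 < α) (h1 : α ≤ 1) (hd : 0 ≤ d)
    (hM : 0 ≤ M) (hK : 0 ≤ K) (hxM : x ≤ M) (hxK : x ≤ K * d) : x ≤ (M + K) * d ^ α := by
  rcases le_total d 1 with h | h
  · have : d ≤ d ^ α := by
      simpa using Real.rpow_le_rpow_of_exponent_ge_of_imp hd h h1 (fun _ h => absurd h one_ne_zero)
    nlinarith [mul_nonneg hM (Real.rpow_nonneg hd α), mul_le_mul_of_nonneg_left this hK]
  · have : 1 ≤ d ^ α := Real.one_le_rpow h h0.le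
    nlinarith [mul_le_mul_of_nonneg_left this hM, mul_nonneg hK (Real.rpow_nonneg hd α)]

theorem abs_rpow_sub_rpow_le {x y α : ℝ} (hx : 0 ≤ x) (hy : 0 ≤ y) (h0 : 0 < α) (h1 : α ≤ 1) :
    |x ^ α - y ^ α| ≤ |x - y| ^ α := by
  wlog h : y ≤ x generalizing x y
  · rw [abs_sub_comm, abs_sub_comm x]
    exact this hy hx (le_of_not_ge h)
  have h2 := Real.rpow_le_rpow hy h h0.le
  rw [abs_of_nonneg (by linarith), abs_of_nonneg (by linarith)]
  have := Real.rpow_add_le_add_rpow (sub_nonneg.2 h) hy h0.le h1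
  rw [sub_add_cancel] at this
  linarith

theorem norm_pow_sub_pow_le_of_norm_eq_one {x y : ℂ} (hx : ‖x‖ = 1) (hy : ‖y‖ = 1) (n : ℕ) :
    ‖x ^ n - y ^ n‖ ≤ n * ‖x - y‖ := by
  induction n with
  | zero => simp
  | succ n ih =>
    have : x ^ (n + 1) - y ^ (n + 1) = x ^ n * (x - y) + (x ^ n - y ^ n) * y := by ring
    rw [this]
    refine (norm_add_le _ _).trans ?_
    rw [norm_mul, norm_mul, norm_pow, hx, hy, one_pow, one_mul, mul_one]
    push_cast
    linarith

theorem norm_zpow_sub_zpow_le_of_norm_eq_one {x y : ℂ} (hx : ‖x‖ = 1) (hy : ‖y‖ = 1) (m : ℤ) :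
    ‖x ^ m - y ^ m‖ ≤ |(m : ℝ)| * ‖x - y‖ := by
  obtain ⟨n, rfl | rfl⟩ := m.eq_nat_or_neg
  · simpa using norm_pow_sub_pow_le_of_norm_eq_one hx hy n
  · have hx0 : x ≠ 0 := norm_ne_zero_iff.1 (by simp [hx])
    have hy0 : y ≠ 0 := norm_ne_zero_iff.1 (by simp [hy])
    have e : x⁻¹ - y⁻¹ = (y - x) * (x⁻¹ * y⁻¹) := by field_simp
    have := norm_pow_sub_pow_le_of_norm_eq_one (x := x⁻¹) (y := y⁻¹) (by simp [hx]) (by simp [hy]) n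
    rw [e, norm_mul, norm_mul, norm_inv, norm_inv, hx, hy, norm_sub_rev y x] at this
    simpa using this

/-- The model `|w|^α (w / \bar w)^m` of degree `α` is Hölder continuous with exponent `α`. -/
theorem exists_holder_homogeneous {α : ℝ} (h0 : 0 < α) (h1 : α ≤ 1) (m : ℤ) :
    ∃ C : ℝ, 0 ≤ C ∧ ∀ w v : ℂ, ‖w ^ m * conj (w ^ (-m)) * ((‖w‖ ^ α : ℝ) : ℂ)
      - v ^ m * conj (v ^ (-m)) * ((‖v‖ ^ α : ℝ) : ℂ)‖ ≤ C * ‖w - v‖ ^ α := by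
  have hn : ∀ w : ℂ, w ≠ 0 → ‖w ^ m * conj (w ^ (-m))‖ = 1 := fun w hw => by
    rw [norm_mul, RCLike.norm_conj, ← norm_mul, ← zpow_add₀ hw]; simp
  refine ⟨1 + (2 + |(m : ℝ)| * 4), by positivity, fun w v => ?_⟩
  rcases eq_or_ne w 0 with rfl | hw
  · rcases eq_or_ne v 0 with rfl | hv
    · simp; positivity
    · rw [norm_zero, Real.zero_rpow h0.ne', Complex.ofReal_zero, mul_zero, zero_sub, norm_neg,
        norm_mul, hn v hv, zero_sub, norm_neg, Complex.norm_real,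
        Real.norm_of_nonneg (by positivity)]
      have : 0 ≤ (2 + |(m : ℝ)| * 4) * ‖v‖ ^ α := by positivity
      linarith
  rcases eq_or_ne v 0 with rfl | hv
  · rw [norm_zero, Real.zero_rpow h0.ne', Complex.ofReal_zero, mul_zero, sub_zero,
      norm_mul, hn w hw, sub_zero, Complex.norm_real, Real.norm_of_nonneg (by positivity)]
    have : 0 ≤ (2 + |(m : ℝ)| * 4) * ‖w‖ ^ α := by positivity
    linarith
  have hvp : 0 < ‖v‖ := norm_pos_iff.2 hv
  have hq : ∀ w : ℂ, w ≠ 0 → ‖w / conj w‖ = 1 := fun w hw => by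
    rw [norm_div, RCLike.norm_conj, div_self (norm_ne_zero_iff.2 hw)]
  have hs : ∀ w : ℂ, w ^ m * conj (w ^ (-m)) = (w / conj w) ^ m := fun w => by
    rw [div_zpow, map_zpow₀, zpow_neg, div_eq_mul_inv]
  have hlip : ‖(w / conj w) ^ m - (v / conj v) ^ m‖ ≤ |(m : ℝ)| * 4 * (‖w - v‖ / ‖v‖) := by
    refine (norm_zpow_sub_zpow_le_of_norm_eq_one (hq w hw) (hq v hv) m).trans ?_
    rw [mul_assoc]
    gcongr
    have hcw : conj w ≠ 0 := (map_ne_zero _).2 hw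
    have hcv : conj v ≠ 0 := (map_ne_zero _).2 hv
    have : w / conj w - v / conj v = (w / conj w) * (conj (v - w) / conj v) + (w - v) / conj v := by
      rw [map_sub]; field_simp; ring
    rw [this]
    refine (norm_add_le _ _).trans ?_
    rw [norm_mul, hq w hw, norm_div, norm_div, RCLike.norm_conj, RCLike.norm_conj, norm_sub_rev v w]
    have : 0 ≤ ‖w - v‖ / ‖v‖ := by positivity
    linarith
  have hbd : ‖(w / conj w) ^ m - (v / conj v) ^ m‖ ≤ 2 := by
    refine (norm_sub_le _ _).trans ?_
    rw [norm_zpow, norm_zpow, hq w hw, hq v hv]; norm_num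
  -- The angular factor is bounded by 2 and Lipschitz in d = |w - v|/|v|. Interpolating gives d^α,
  -- and the factor |v|^α in the model cancels the denominator.
  have key := le_mul_rpow_of_le_of_le h0 h1 (by positivity : 0 ≤ ‖w - v‖ / ‖v‖) zero_le_two
    (by positivity) hbd hlip
  rw [Real.div_rpow (norm_nonneg _) hvp.le, mul_div_assoc', le_div_iff₀ (by positivity)] at key
  rw [hs, hs]
  have e : (w / conj w) ^ m * ((‖w‖ ^ α : ℝ) : ℂ) - (v / conj v) ^ m * ((‖v‖ ^ α : ℝ) : ℂ)
      = (w / conj w) ^ m * ((‖w‖ ^ α - ‖v‖ ^ α : ℝ) : ℂ)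
        + ((w / conj w) ^ m - (v / conj v) ^ m) * ((‖v‖ ^ α : ℝ) : ℂ) := by push_cast; ring
  rw [e]
  refine (norm_add_le _ _).trans ?_
  rw [norm_mul, norm_mul, norm_zpow, hq w hw, one_zpow, one_mul, Complex.norm_real,
    Complex.norm_real, Real.norm_of_nonneg (by positivity : 0 ≤ ‖v‖ ^ α), Real.norm_eq_abs, add_mul,
    one_mul]
  refine add_le_add ((abs_rpow_sub_rpow_le (norm_nonneg _) (norm_nonneg _) h0 h1).trans ?_) key
  exact Real.rpow_le_rpow (abs_nonneg _) (abs_norm_sub_norm_le _ _) h0.le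

/-! ### Products of powers of F, its conjugate and its modulus -/

/-- The product `a F^m \overline{b F^n} |F|^β`. -/
noncomputable def homTerm (F a b : ℂ → ℂ) (m n : ℤ) (β : ℝ) (z : ℂ) : ℂ :=
  a z * F z ^ m * conj (b z * F z ^ n) * ((‖F z‖ ^ β : ℝ) : ℂ)

section homTerm

variable {F F' a a' b b' : ℂ → ℂ} {m n : ℤ} {β : ℝ} {z : ℂ}

theorem homTerm_eq_zero (hF : F z = 0) (hβ : β ≠ 0) : homTerm F a b m n β z = 0 := by
  simp [homTerm, hF, Real.zero_rpow hβ]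

theorem norm_homTerm (hF : F z ≠ 0) :
    ‖homTerm F a b m n β z‖ = ‖a z‖ * ‖b z‖ * ‖F z‖ ^ (m + n + β) := by
  have h : 0 < ‖F z‖ := norm_pos_iff.2 hF
  rw [homTerm, norm_mul, norm_mul, norm_mul, RCLike.norm_conj, norm_mul, norm_zpow, norm_zpow,
    Complex.norm_real, Real.norm_of_nonneg (by positivity), Real.rpow_add h, Real.rpow_add h,
    Real.rpow_intCast, Real.rpow_intCast]
  ring

theorem norm_homTerm_le (h : F z ≠ 0 ∨ β ≠ 0) :
    ‖homTerm F a b m n β z‖ ≤ ‖a z‖ * ‖b z‖ * ‖F z‖ ^ (m + n + β) := by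
  rcases eq_or_ne (F z) 0 with h0 | h0
  · rw [homTerm_eq_zero h0 (h.resolve_left (not_not.2 h0)), norm_zero]; positivity
  · exact (norm_homTerm h0).le

/-- Write |F|^β = (F F̄)^{β/2}; off the zeros F F̄ is a positive real, so the complex power is
differentiable there. -/
theorem hasWirtingerAt_norm_rpow {c : ℂ} (hF : HasDerivAt F c z) (h0 : F z ≠ 0) (β : ℝ) :
    HasWirtingerAt (fun w => ((‖F w‖ ^ β : ℝ) : ℂ)) (β / 2 * (c / F z) * ((‖F z‖ ^ β : ℝ) : ℂ))
      (β / 2 * conj (c / F z) * ((‖F z‖ ^ β : ℝ) : ℂ)) z := by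
  have hW := HasWirtingerAt.of_hasDerivAt hF
  have hq : ∀ w, F w * conj (F w) = ((‖F w‖ ^ 2 : ℝ) : ℂ) := fun w => by
    rw [Complex.mul_conj, Complex.normSq_eq_norm_sq]
  have e : ∀ w, ((‖F w‖ ^ β : ℝ) : ℂ) = (F w * conj (F w)) ^ ((β / 2 : ℝ) : ℂ) := fun w => by
    rw [hq, ← Complex.ofReal_cpow (by positivity), ← Real.rpow_natCast, ← Real.rpow_mul
      (norm_nonneg _)]
    congr 2
    push_cast
    ring
  have hpos : 0 < ‖F z‖ ^ 2 := by have := norm_pos_iff.2 h0; positivity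
  have hsl : F z * conj (F z) ∈ Complex.slitPlane := by
    rw [hq]; exact Complex.ofReal_mem_slitPlane.2 hpos
  have hne : F z * conj (F z) ≠ 0 := mul_ne_zero h0 ((map_ne_zero _).2 h0)
  have hd := HasDerivAt.cpow_const (hasDerivAt_id (F z * conj (F z))) hsl (c := ((β / 2 : ℝ) : ℂ))
  have := (hW.mul hW.conjugate).comp_hasDerivAt hd
  have hc := (map_ne_zero (starRingEnd ℂ)).2 h0
  simp only [e]
  refine this.congr ?_ ?_
  · simp only [id, mul_one, map_zero, mul_zero, add_zero]
    rw [Complex.cpow_sub _ _ hne, Complex.cpow_one]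
    push_cast
    field_simp
  · simp only [id, mul_one, zero_mul, zero_add, map_div₀]
    rw [Complex.cpow_sub _ _ hne, Complex.cpow_one]
    push_cast
    field_simp

/-- The family is closed under ∂ and ∂̄: each lowers one integer exponent by one and changes one
coefficient. Both the Hölder induction and the equation for u rest on this. -/
theorem hasWirtingerAt_homTerm (hF : HasDerivAt F (F' z) z) (ha : HasDerivAt a (a' z) z)
    (hb : HasDerivAt b (b' z) z) (h0 : F z ≠ 0) :
    HasWirtingerAt (homTerm F a b m n β)
      (homTerm F (fun w => a' w * F w + (m + β / 2) * a w * F' w) b (m - 1) n β z)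
      (homTerm F a (fun w => b' w * F w + (n + β / 2) * b w * F' w) m (n - 1) β z) z := by
  have hz : ∀ k : ℤ, HasDerivAt (fun w => F w ^ k) (k * F z ^ (k - 1) * F' z) z := fun k =>
    (hasDerivAt_zpow k _ (Or.inl h0)).comp z hF
  have h1 := HasWirtingerAt.of_hasDerivAt (ha.mul (hz m))
  have h2 := HasWirtingerAt.of_hasDerivAt (hb.mul (hz n))
  have := (h1.mul h2.conjugate).mul (hasWirtingerAt_norm_rpow hF h0 β)
  have hc : conj (F z) ≠ 0 := (map_ne_zero _).2 h0
  refine HasWirtingerAt.congr this ?_ ?_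
  · simp only [homTerm, map_zero, mul_zero, add_zero, zpow_sub_one₀ h0, Pi.mul_apply]
    field_simp
    ring
  · simp only [homTerm, zero_mul, zero_add, zpow_sub_one₀ h0, map_mul, map_add, map_div₀,
      Complex.conj_ofReal, map_inv₀, map_intCast, Pi.mul_apply, map_ofNat]
    field_simp
    ring

/-- At a zero of F the product is O(|F|^{m+n+β}) with F(w) = O(|w - z|); a degree above 1 makes it
o(|w - z|). -/
theorem hasWirtingerAt_homTerm_of_zero {c : ℂ} (hF : HasDerivAt F c z) (ha : ContinuousAt a z)
    (hb : ContinuousAt b z) (h0 : F z = 0) (hβ : 0 < β) (hd : 1 < m + n + β) :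
    HasWirtingerAt (homTerm F a b m n β) 0 0 z := by
  have hzero : (0 : ℂ) • (1 : ℂ →L[ℝ] ℂ) + (0 : ℂ) • (Complex.conjCLE : ℂ →L[ℝ] ℂ) = 0 := by
    ext; simp
  rw [HasWirtingerAt, hzero, hasFDerivAt_iff_isLittleO]
  simp only [homTerm_eq_zero h0 hβ.ne', sub_zero, zero_apply]
  have hO : F =O[𝓝 z] fun w => w - z := by
    have := hF.hasFDerivAt.isBigO_sub
    simpa [h0] using this
  have ht : Tendsto (fun w => ‖a w‖ * ‖b w‖ * ‖F w‖ ^ (m + n + β - 1)) (𝓝 z) (𝓝 0) := by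
    have h1 : ContinuousAt (fun w => ‖a w‖ * ‖b w‖ * ‖F w‖ ^ (m + n + β - 1)) z :=
      (ha.norm.mul hb.norm).mul (hF.continuousAt.norm.rpow_const (Or.inr (by linarith)))
    have h2 := h1.tendsto
    rwa [h0, norm_zero, Real.zero_rpow (by linarith), mul_zero] at h2
  have h3 := ((Asymptotics.isLittleO_one_iff ℝ).2 ht).mul_isBigO hO.norm_left.norm_right
  have h4 : (homTerm F a b m n β) =O[𝓝 z]
      fun w => ‖a w‖ * ‖b w‖ * ‖F w‖ ^ (m + n + β - 1) * ‖F w‖ := by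
    refine Asymptotics.IsBigO.of_bound 1 (Eventually.of_forall fun w => ?_)
    rw [one_mul, Real.norm_of_nonneg (by positivity), mul_assoc, ← Real.rpow_add_one' (norm_nonneg _)
      (by linarith), sub_add_cancel]
    exact norm_homTerm_le (Or.inr hβ.ne')
  have h5 := h4.trans_isLittleO h3
  simp only [one_mul] at h5
  exact h5.of_norm_right

end homTerm

/-- A product `a F^m \overline{b F^n} |F|^α` with coefficients in an algebra of holomorphic functions
with bounded derivatives is of class `C^{m+n,α}`. -/
theorem isHolderOn_homTerm {U : Set ℂ} (hU : IsOpen U) (hconv : Convex ℝ U)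
    {A : Subalgebra ℂ (ℂ → ℂ)} (hbd : ∀ f ∈ A, ∃ C : ℝ, ∀ z ∈ U, ‖f z‖ ≤ C)
    (hder : ∀ f ∈ A, ∃ f' ∈ A, ∀ z ∈ U, HasDerivAt f (f' z) z) {F : ℂ → ℂ} (hF : F ∈ A) {α : ℝ}
    (h0 : 0 < α) (h1 : α ≤ 1) (k : ℕ) :
    ∀ a ∈ A, ∀ b ∈ A, ∀ m n : ℤ, m + n = k → IsHolderOn U k α (homTerm F a b m n α) := by
  have hlip : ∀ f ∈ A, ∃ C : ℝ, 0 ≤ C ∧ ∀ z ∈ U, ∀ w ∈ U, ‖f z - f w‖ ≤ C * ‖z - w‖ := by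
    intro f hf
    obtain ⟨f', hf', hd⟩ := hder f hf
    obtain ⟨C, hC⟩ := hbd f' hf'
    refine ⟨max C 0, le_max_right _ _, fun z hz w hw => ?_⟩
    exact Convex.norm_image_sub_le_of_norm_hasDerivWithin_le
      (fun x hx => (hd x hx).hasDerivWithinAt) (fun x hx => (hC x hx).trans (le_max_left _ _))
      hconv hw hz
  have hbd' : ∀ f ∈ A, ∃ C : ℝ, 0 ≤ C ∧ ∀ z ∈ U, ‖f z‖ ≤ C := fun f hf => by
    obtain ⟨C, hC⟩ := hbd f hf
    exact ⟨max C 0, le_max_right _ _, fun z hz => (hC z hz).trans (le_max_left _ _)⟩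
  have hterm : ∀ a ∈ A, ∀ b ∈ A, ∀ (m n : ℤ) (k : ℕ), m + n = k →
      ∃ C : ℝ, ∀ z ∈ U, ‖homTerm F a b m n α z‖ ≤ C := by
    intro a ha b hb m n k hmn
    obtain ⟨Ca, ha0, hCa⟩ := hbd' a ha
    obtain ⟨Cb, hb0, hCb⟩ := hbd' b hb
    obtain ⟨CF, hF0, hCF⟩ := hbd' F hF
    refine ⟨Ca * Cb * CF ^ (m + n + α), fun z hz => (norm_homTerm_le (Or.inr h0.ne')).trans ?_⟩
    have : (0 : ℝ) ≤ m + n + α := by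
      have : (m + n : ℝ) = k := by exact_mod_cast hmn
      rw [this]; positivity
    gcongr
    · exact hCa z hz
    · exact hCb z hz
    · exact hCF z hz
  induction k with
  | zero =>
    intro a ha b hb m n hmn
    obtain ⟨B, hB⟩ := hterm a ha b hb m n 0 hmn
    obtain rfl : n = -m := by push_cast at hmn; omega
    obtain ⟨Ca, ha0, hCa⟩ := hbd' a ha
    obtain ⟨Cb, hb0, hCb⟩ := hbd' b hb
    obtain ⟨CF, hF0, hCF⟩ := hbd' F hF
    obtain ⟨La, la0, hLa⟩ := hlip a ha
    obtain ⟨Lb, lb0, hLb⟩ := hlip b hb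
    obtain ⟨LF, lF0, hLF⟩ := hlip F hF
    obtain ⟨H, hH0, hH⟩ := exists_holder_homogeneous h0 h1 m
    -- In total degree α the product is a b̄ times the homogeneous model composed with F. F is
    -- Lipschitz by the mean value inequality on the convex set U, so the composite is α-Hölder.
    let θ : ℂ → ℂ := fun w => w ^ m * conj (w ^ (-m)) * ((‖w‖ ^ α : ℝ) : ℂ)
    have hθ : ∀ w, ‖θ w‖ ≤ H * ‖w‖ ^ α := fun w => by
      have := hH w 0
      rw [norm_zero, Real.zero_rpow h0.ne', Complex.ofReal_zero, mul_zero, sub_zero, sub_zero] at this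
      exact this
    have hθF : ∀ z ∈ U, ‖θ (F z)‖ ≤ H * CF ^ α := fun z hz => (hθ _).trans (by
      gcongr; exact hCF z hz)
    have hab : ∀ z ∈ U, ∀ w ∈ U, ‖a z * conj (b z) - a w * conj (b w)‖
        ≤ (2 * (Ca * Cb) + (Ca * Lb + La * Cb)) * ‖z - w‖ ^ α := by
      intro z hz w hw
      refine le_mul_rpow_of_le_of_le h0 h1 (norm_nonneg _) (by positivity) (by positivity) ?_ ?_
      · refine (norm_sub_le _ _).trans ?_
        rw [norm_mul, norm_mul, RCLike.norm_conj, RCLike.norm_conj]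
        have := mul_le_mul (hCa z hz) (hCb z hz) (norm_nonneg _) ha0
        have := mul_le_mul (hCa w hw) (hCb w hw) (norm_nonneg _) ha0
        linarith
      · have e : a z * conj (b z) - a w * conj (b w)
            = a z * conj (b z - b w) + (a z - a w) * conj (b w) := by rw [map_sub]; ring
        rw [e]
        refine (norm_add_le _ _).trans ?_
        rw [norm_mul, norm_mul, RCLike.norm_conj, RCLike.norm_conj]
        have := mul_le_mul (hCa z hz) (hLb z hz w hw) (norm_nonneg _) ha0
        have := mul_le_mul (hLa z hz w hw) (hCb w hw) (norm_nonneg _) (by positivity)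
        linarith
    have hFF : ∀ z ∈ U, ∀ w ∈ U, ‖θ (F z) - θ (F w)‖ ≤ H * LF ^ α * ‖z - w‖ ^ α := by
      intro z hz w hw
      refine (hH _ _).trans ?_
      rw [mul_assoc, ← Real.mul_rpow lF0 (norm_nonneg _)]
      gcongr
      exact hLF z hz w hw
    refine IsHolderOn.of_norm_le h0 hB (C := Ca * Cb * (H * LF ^ α)
      + (2 * (Ca * Cb) + (Ca * Lb + La * Cb)) * (H * CF ^ α)) fun z hz w hw => ?_
    have e : ∀ z, homTerm F a b m (-m) α z = a z * conj (b z) * θ (F z) := fun z => by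
      simp only [homTerm, θ, map_mul]; ring
    have e2 : a z * conj (b z) * θ (F z) - a w * conj (b w) * θ (F w)
        = a z * conj (b z) * (θ (F z) - θ (F w))
          + (a z * conj (b z) - a w * conj (b w)) * θ (F w) := by ring
    rw [e, e, e2]
    refine (norm_add_le _ _).trans ?_
    rw [norm_mul, norm_mul _ (θ (F w)), norm_mul, RCLike.norm_conj]
    have t1 := mul_le_mul (mul_le_mul (hCa z hz) (hCb z hz) (norm_nonneg _) ha0) (hFF z hz w hw)
      (norm_nonneg _) (by positivity)
    have t2 := mul_le_mul (hab z hz w hw) (hθF w hw) (norm_nonneg _) (by positivity)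
    linarith
  | succ k ih =>
    intro a ha b hb m n hmn
    obtain ⟨B, hB⟩ := hterm a ha b hb m n (k + 1) hmn
    obtain ⟨a', ha', hda⟩ := hder a ha
    obtain ⟨b', hb', hdb⟩ := hder b hb
    obtain ⟨F', hF', hdF⟩ := hder F hF
    -- The new coefficients produced by ∂ and ∂̄ stay in the algebra, so the induction hypothesis
    -- covers both derivatives, whose integer degree is k.
    have hc : ∀ (c : ℂ) (f f' : ℂ → ℂ), f ∈ A → f' ∈ A →
        (fun w => f' w * F w + c * f w * F' w) ∈ A := fun c f f' hf hf' => by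
      have := A.add_mem (A.mul_mem hf' hF) (A.smul_mem (A.mul_mem hf hF') c)
      convert! this using 1
      funext w
      simp [mul_assoc]
    have i1 := ih _ (hc (m + α / 2) a a' ha ha') b hb (m - 1) n (by push_cast at hmn ⊢; omega)
    have i2 := ih a ha _ (hc (n + α / 2) b b' hb hb') m (n - 1) (by push_cast at hmn ⊢; omega)
    let L1 : ℂ →L[ℝ] (ℂ →L[ℝ] ℂ) := ContinuousLinearMap.mul ℝ ℂ
    let L2 : ℂ →L[ℝ] (ℂ →L[ℝ] ℂ) :=
      ((ContinuousLinearMap.compL ℝ ℂ ℂ ℂ).flip (Complex.conjCLE : ℂ →L[ℝ] ℂ)).comp L1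
    refine IsHolderOn.succ_of_hasFDerivAt hU hB (fun z hz => ?_)
      ((i1.clm_comp hU L1).add (i2.clm_comp hU L2) hU)
    have hW : HasWirtingerAt (homTerm F a b m n α)
      (homTerm F (fun w => a' w * F w + (m + α / 2) * a w * F' w) b (m - 1) n α z)
      (homTerm F a (fun w => b' w * F w + (n + α / 2) * b w * F' w) m (n - 1) α z) z := by
      -- At a zero of F both candidate derivatives take the value 0, which is the true differential
      -- because the degree k+1+α exceeds 1.
      by_cases hz0 : F z = 0
      · rw [homTerm_eq_zero hz0 h0.ne', homTerm_eq_zero hz0 h0.ne']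
        refine hasWirtingerAt_homTerm_of_zero (hdF z hz) (hda z hz).continuousAt
          (hdb z hz).continuousAt hz0 h0 ?_
        have : (m + n : ℝ) = k + 1 := by exact_mod_cast hmn
        rw [this]
        have : (0 : ℝ) ≤ k := by positivity
        linarith
      · exact hasWirtingerAt_homTerm (hdF z hz) (hda z hz) (hdb z hz) hz0
    refine HasFDerivAt.congr_fderiv hW ?_
    ext w
    simp [L1, L2]

/-! ### The flat holomorphic function and its zeros -/

/-- The logarithm `-log (1 - z)`, which maps the disc into a half strip. -/
noncomputable def cuspLog (z : ℂ) : ℂ := -Complex.log (1 - z)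

/-- A holomorphic function that is flat at the boundary point `1` of the disc and has simple
zeros accumulating there. -/
noncomputable def flatSine (z : ℂ) : ℂ :=
  Complex.exp (-(cuspLog z) ^ 2) * Complex.sin (Real.pi * cuspLog z)

/-- The zeros of `flatSine` in the disc. -/
noncomputable def cuspPoint (k : ℕ) : ℂ := 1 - Complex.exp (-k)

/-- The generators of an algebra of holomorphic functions with bounded derivatives. -/
noncomputable def flatMonomial (c : ℂ) (m : ℕ) (z : ℂ) : ℂ :=
  Complex.exp (-(cuspLog z) ^ 2 + c * cuspLog z) * cuspLog z ^ m

section cuspLog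

variable {z : ℂ}

theorem one_sub_mem_slitPlane (hz : z.re < 1) : 1 - z ∈ Complex.slitPlane :=
  Or.inl (by simpa using hz)

theorem one_sub_ne_zero_of_re_lt (hz : z.re < 1) : 1 - z ≠ 0 :=
  Complex.slitPlane_ne_zero (one_sub_mem_slitPlane hz)

theorem exp_cuspLog (hz : z ≠ 1) : Complex.exp (cuspLog z) = (1 - z)⁻¹ := by
  rw [cuspLog, Complex.exp_neg, Complex.exp_log (sub_ne_zero.2 hz.symm)]

theorem exp_neg_cuspLog (hz : z ≠ 1) : Complex.exp (-cuspLog z) = 1 - z := by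
  rw [cuspLog, neg_neg, Complex.exp_log (sub_ne_zero.2 hz.symm)]

theorem cuspLog_re : (cuspLog z).re = -Real.log ‖1 - z‖ := by
  rw [cuspLog, Complex.neg_re, Complex.log_re]

theorem abs_cuspLog_im_le (hz : z.re ≤ 1) : |(cuspLog z).im| ≤ Real.pi / 2 := by
  rw [cuspLog, Complex.neg_im, abs_neg, Complex.log_im, Complex.abs_arg_le_pi_div_two_iff]
  simpa using hz

theorem hasDerivAt_cuspLog (hz : z.re < 1) : HasDerivAt cuspLog (Complex.exp (cuspLog z)) z := by
  have h1 : HasDerivAt (fun w : ℂ => 1 - w) (-1) z := (hasDerivAt_id z).const_sub 1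
  have := (h1.clog (one_sub_mem_slitPlane hz)).neg
  rw [exp_cuspLog (by rintro rfl; simp at hz)]
  refine this.congr_deriv ?_
  rw [neg_div, neg_neg, one_div]

theorem norm_cuspLog_le (hz : z.re ≤ 1) : ‖cuspLog z‖ ≤ |(cuspLog z).re| + 2 := by
  have := abs_cuspLog_im_le hz
  have := Complex.norm_le_abs_re_add_abs_im (cuspLog z)
  linarith [Real.pi_le_four]

/-- On Re z ≤ 1 the imaginary part y of L = `cuspLog z` is bounded, so |exp(-L²)| = exp(-x² + y²)
with x = Re L is Gaussian in x and dominates every exponential and power of L. -/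
theorem exists_norm_flatMonomial_le (c : ℂ) (m : ℕ) :
    ∃ C : ℝ, ∀ z : ℂ, z.re ≤ 1 → ‖flatMonomial c m z‖ ≤ C := by
  -- The factorial comes from |L|^m ≤ m! e^{|L|}; the square comes from maximizing -x² + (‖c‖+1)|x|;
  -- the remaining terms come from |y| ≤ 2.
  refine ⟨m.factorial * Real.exp ((‖c‖ + 1) ^ 2 / 4 + 2 * (‖c‖ + 1) + 4), fun z hz => ?_⟩
  set l := cuspLog z with hl
  have him : |l.im| ≤ 2 := (abs_cuspLog_im_le hz).trans (by linarith [Real.pi_le_four])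
  have hn : ‖l‖ ≤ |l.re| + 2 := norm_cuspLog_le hz
  have h1 : ‖l‖ ^ m ≤ m.factorial * Real.exp ‖l‖ := by
    have := Real.pow_div_factorial_le_exp ‖l‖ (norm_nonneg _) m
    rwa [div_le_iff₀' (by positivity)] at this
  have h2 : (-l ^ 2 + c * l).re ≤ -l.re ^ 2 + 4 + ‖c‖ * (|l.re| + 2) := by
    have e1 : (-l ^ 2).re = -l.re ^ 2 + l.im ^ 2 := by
      rw [pow_two, Complex.neg_re, Complex.mul_re]; ring
    have e2 : (c * l).re ≤ ‖c‖ * (|l.re| + 2) :=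
      (Complex.re_le_norm _).trans (by rw [norm_mul]; gcongr)
    have e3 : l.im ^ 2 ≤ 4 := by
      rw [← sq_abs]; nlinarith [abs_nonneg l.im]
    rw [Complex.add_re, e1]; linarith
  rw [flatMonomial, ← hl, norm_mul, Complex.norm_exp, norm_pow]
  calc Real.exp (-l ^ 2 + c * l).re * ‖l‖ ^ m
      ≤ Real.exp (-l ^ 2 + c * l).re * (m.factorial * Real.exp ‖l‖) := by gcongr
    _ = m.factorial * Real.exp ((-l ^ 2 + c * l).re + ‖l‖) := by rw [Real.exp_add]; ring
    _ ≤ _ := by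
      refine mul_le_mul_of_nonneg_left (Real.exp_le_exp.2 ?_) (by positivity)
      nlinarith [sq_nonneg (|l.re| - (‖c‖ + 1) / 2), sq_abs l.re]

/-- The derivative of `cuspLog` is its own exponential, hence the shift from c to c + 1. For m = 0
the truncated exponent m - 1 is harmless, its coefficient being 0. -/
theorem hasDerivAt_flatMonomial (c : ℂ) (m : ℕ) (hz : z.re < 1) :
    HasDerivAt (flatMonomial c m) (c * flatMonomial (c + 1) m z
      - 2 * flatMonomial (c + 1) (m + 1) z + m * flatMonomial (c + 1) (m - 1) z) z := by
  have h := hasDerivAt_cuspLog hz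
  have h1 := (((h.pow 2).neg.add (h.const_mul c)).cexp).mul (h.pow m)
  refine h1.congr_deriv ?_
  have e : Complex.exp (-cuspLog z ^ 2 + (c + 1) * cuspLog z)
      = Complex.exp (-cuspLog z ^ 2 + c * cuspLog z) * Complex.exp (cuspLog z) := by
    rw [← Complex.exp_add]; ring_nf
  simp only [flatMonomial, e, Pi.add_apply, Pi.neg_apply, Pi.pow_apply]
  push_cast
  ring

/-- The algebra generated by the functions `flatMonomial c m`. -/
noncomputable def flatAlgebra : Subalgebra ℂ (ℂ → ℂ) :=
  Algebra.adjoin ℂ (range fun p : ℂ × ℕ => flatMonomial p.1 p.2)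

theorem flatMonomial_mem (c : ℂ) (m : ℕ) : flatMonomial c m ∈ flatAlgebra :=
  Algebra.subset_adjoin ⟨(c, m), rfl⟩

theorem flatAlgebra_bounded {f : ℂ → ℂ} (hf : f ∈ flatAlgebra) :
    ∃ C : ℝ, ∀ z : ℂ, z.re ≤ 1 → ‖f z‖ ≤ C := by
  induction hf using Algebra.adjoin_induction with
  | mem f hf =>
    obtain ⟨p, rfl⟩ := hf
    exact exists_norm_flatMonomial_le _ _
  | algebraMap r => exact ⟨‖r‖, fun z _ => by simp⟩
  | add f g _ _ hf hg =>
    obtain ⟨A, hA⟩ := hf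
    obtain ⟨B, hB⟩ := hg
    exact ⟨A + B, fun z hz => (norm_add_le _ _).trans (add_le_add (hA z hz) (hB z hz))⟩
  | mul f g _ _ hf hg =>
    obtain ⟨A, hA⟩ := hf
    obtain ⟨B, hB⟩ := hg
    refine ⟨A * B, fun z hz => ?_⟩
    rw [Pi.mul_apply, norm_mul]
    exact mul_le_mul (hA z hz) (hB z hz) (norm_nonneg _) ((norm_nonneg _).trans (hA z hz))

theorem flatAlgebra_hasDerivAt {f : ℂ → ℂ} (hf : f ∈ flatAlgebra) :
    ∃ f' ∈ flatAlgebra, ∀ z : ℂ, z.re < 1 → HasDerivAt f (f' z) z := by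
  induction hf using Algebra.adjoin_induction with
  | mem f hf =>
    obtain ⟨⟨c, m⟩, rfl⟩ := hf
    refine ⟨c • flatMonomial (c + 1) m - (2 : ℂ) • flatMonomial (c + 1) (m + 1)
      + (m : ℂ) • flatMonomial (c + 1) (m - 1), ?_, fun z hz => hasDerivAt_flatMonomial c m hz⟩
    exact add_mem (sub_mem (flatAlgebra.smul_mem (flatMonomial_mem _ _) _)
      (flatAlgebra.smul_mem (flatMonomial_mem _ _) _)) (flatAlgebra.smul_mem (flatMonomial_mem _ _) _)
  | algebraMap r => exact ⟨0, zero_mem _, fun z _ => hasDerivAt_const z r⟩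
  | add f g _ _ hf hg =>
    obtain ⟨f', hf', hA⟩ := hf
    obtain ⟨g', hg', hB⟩ := hg
    exact ⟨f' + g', add_mem hf' hg', fun z hz => (hA z hz).add (hB z hz)⟩
  | mul f g hf₀ hg₀ hf hg =>
    obtain ⟨f', hf', hA⟩ := hf
    obtain ⟨g', hg', hB⟩ := hg
    exact ⟨f' * g + f * g', add_mem (mul_mem hf' hg₀) (mul_mem hf₀ hg'),
      fun z hz => (hA z hz).mul (hB z hz)⟩

theorem flatSine_eq : flatSine = (Complex.I / 2) • flatMonomial (-(Real.pi * Complex.I)) 0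
    - (Complex.I / 2) • flatMonomial (Real.pi * Complex.I) 0 := by
  funext z
  simp only [flatSine, Complex.sin, flatMonomial, Pi.sub_apply, Pi.smul_apply, smul_eq_mul, pow_zero,
    mul_one, Complex.exp_add]
  ring_nf

theorem flatSine_mem : flatSine ∈ flatAlgebra := by
  rw [flatSine_eq]
  exact sub_mem (flatAlgebra.smul_mem (flatMonomial_mem _ _) _)
    (flatAlgebra.smul_mem (flatMonomial_mem _ _) _)

/-- Since 1 - z = e^{-L}, a factor (1 - z)^N can be split off by raising c by N, and the remaining
factor is bounded. -/
theorem exists_norm_flatSine_le (N : ℕ) :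
    ∃ C : ℝ, 0 ≤ C ∧ ∀ z : ℂ, z.re < 1 → ‖flatSine z‖ ≤ C * ‖1 - z‖ ^ N := by
  obtain ⟨A, hA⟩ := exists_norm_flatMonomial_le (-(Real.pi * Complex.I) + N) 0
  obtain ⟨B, hB⟩ := exists_norm_flatMonomial_le (Real.pi * Complex.I + N) 0
  have e : ∀ (c z : ℂ), z.re < 1 → flatMonomial c 0 z = flatMonomial (c + N) 0 z * (1 - z) ^ N := by
    intro c z hz
    have hz1 : z ≠ 1 := by rintro rfl; simp at hz
    rw [← exp_neg_cuspLog hz1, ← Complex.exp_nat_mul]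
    simp only [flatMonomial, pow_zero, mul_one]
    rw [← Complex.exp_add]; ring_nf
  have hA0 : 0 ≤ A := (norm_nonneg _).trans (hA 0 (by simp))
  have hB0 : 0 ≤ B := (norm_nonneg _).trans (hB 0 (by simp))
  refine ⟨A + B, by positivity, fun z hz => ?_⟩
  have hI : ‖Complex.I / 2‖ ≤ 1 := by simp; norm_num
  rw [flatSine_eq, Pi.sub_apply, Pi.smul_apply, Pi.smul_apply, e (-(Real.pi * Complex.I)) z hz,
    e (Real.pi * Complex.I) z hz, add_mul]
  refine (norm_sub_le _ _).trans (add_le_add ?_ ?_)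
  · rw [norm_smul, norm_mul, norm_pow]
    calc _ ≤ 1 * (A * ‖1 - z‖ ^ N) := by gcongr; exact hA z hz.le
      _ = _ := one_mul _
  · rw [norm_smul, norm_mul, norm_pow]
    calc _ ≤ 1 * (B * ‖1 - z‖ ^ N) := by gcongr; exact hB z hz.le
      _ = _ := one_mul _

/-- The derivative of `flatSine` on the half plane `Re z < 1`. -/
noncomputable def flatSineDeriv (z : ℂ) : ℂ :=
  Complex.exp (-(cuspLog z) ^ 2) * Complex.exp (cuspLog z) *
    (Real.pi * Complex.cos (Real.pi * cuspLog z) - 2 * cuspLog z * Complex.sin (Real.pi * cuspLog z))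

theorem hasDerivAt_flatSine (hz : z.re < 1) : HasDerivAt flatSine (flatSineDeriv z) z := by
  have h := hasDerivAt_cuspLog hz
  have h1 := ((h.pow 2).neg.cexp).mul ((h.const_mul (Real.pi : ℂ)).csin)
  refine h1.congr_deriv ?_
  simp only [flatSineDeriv, Pi.neg_apply, Pi.pow_apply]
  push_cast
  ring

theorem isOpen_re_lt_one : IsOpen {z : ℂ | z.re < 1} := isOpen_lt Complex.continuous_re continuous_const

theorem differentiableOn_flatSine : DifferentiableOn ℂ flatSine {z | z.re < 1} := fun _ hz =>
  (hasDerivAt_flatSine hz).differentiableAt.differentiableWithinAt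

theorem re_lt_one_of_mem_closedBall (hz : z ∈ Metric.closedBall (0 : ℂ) 1) (h1 : z ≠ 1) :
    z.re < 1 := by
  rw [mem_closedBall_zero_iff] at hz
  refine lt_of_le_of_ne ((Complex.re_le_norm z).trans hz) fun h => h1 ?_
  have h2 := Complex.sq_norm z
  rw [Complex.normSq_apply, h] at h2
  have h3 : z.im = 0 := by nlinarith [norm_nonneg z, mul_self_nonneg z.im]
  exact Complex.ext h h3

theorem re_lt_one_of_mem_unitDisc (hz : z ∈ unitDisc) : z.re < 1 :=
  (Complex.re_le_norm z).trans_lt (mem_ball_zero_iff.1 hz)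

/-- The convention log 0 = 0 gives `cuspLog 1 = 0`, so the value at the boundary point agrees with
the limit 0. -/
theorem flatSine_one : flatSine 1 = 0 := by simp [flatSine, cuspLog]

theorem cuspPoint_eq_ofReal (k : ℕ) : cuspPoint k = ((1 - Real.exp (-k) : ℝ) : ℂ) := by
  simp [cuspPoint]

theorem cuspPoint_mem (k : ℕ) : cuspPoint k ∈ unitDisc := by
  refine mem_ball_zero_iff.2 ?_
  rw [cuspPoint_eq_ofReal, Complex.norm_real, Real.norm_eq_abs, abs_lt]
  have h1 := Real.exp_pos (-k)
  have h2 : Real.exp (-k) ≤ 1 := Real.exp_le_one_iff.2 (by simp)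
  constructor <;> linarith

theorem cuspPoint_injective : Function.Injective cuspPoint := fun k l h => by
  rw [cuspPoint_eq_ofReal, cuspPoint_eq_ofReal, Complex.ofReal_inj] at h
  have : Real.exp (-k) = Real.exp (-l) := by linarith
  exact_mod_cast neg_injective (Real.exp_injective this)

theorem tendsto_cuspPoint : Tendsto cuspPoint atTop (𝓝 1) := by
  have h1 : Tendsto (fun k : ℕ => 1 - Real.exp (-k)) atTop (𝓝 (1 - 0)) :=
    (Real.tendsto_exp_neg_atTop_nhds_zero.comp tendsto_natCast_atTop_atTop).const_sub 1
  have := (Complex.continuous_ofReal.tendsto _).comp h1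
  simp only [sub_zero, Complex.ofReal_one] at this
  exact this.congr fun k => (cuspPoint_eq_ofReal k).symm

theorem cuspLog_cuspPoint (k : ℕ) : cuspLog (cuspPoint k) = k := by
  rw [cuspLog, cuspPoint, sub_sub_cancel, show (-(k : ℂ)) = ((-k : ℝ) : ℂ) by simp,
    ← Complex.ofReal_exp, ← Complex.ofReal_log (Real.exp_pos _).le, Real.log_exp]
  simp

theorem flatSine_cuspPoint (k : ℕ) : flatSine (cuspPoint k) = 0 := by
  rw [flatSine, cuspLog_cuspPoint, mul_comm (Real.pi : ℂ), Complex.sin_nat_mul_pi, mul_zero]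

theorem sin_eq_zero_of_flatSine_eq_zero (h : flatSine z = 0) :
    Complex.sin (Real.pi * cuspLog z) = 0 :=
  (mul_eq_zero.1 h).resolve_left (Complex.exp_ne_zero _)

/-- A zero forces L to be an integer k with |1 - z| = e^{-k}. As |1 - z| ≤ 2 < e on the closed disc,
negative k are excluded. -/
theorem exists_eq_cuspPoint (hz : z ∈ Metric.closedBall (0 : ℂ) 1) (h1 : z ≠ 1)
    (h : flatSine z = 0) : ∃ k, cuspPoint k = z := by
  obtain ⟨k, hk⟩ := Complex.sin_eq_zero_iff.1 (sin_eq_zero_of_flatSine_eq_zero h)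
  have hpi : (Real.pi : ℂ) ≠ 0 := by exact_mod_cast Real.pi_ne_zero
  have hl : cuspLog z = k := by
    rw [mul_comm] at hk; exact mul_right_cancel₀ hpi hk
  have he := exp_neg_cuspLog h1
  rw [hl] at he
  have hk0 : 0 ≤ k := by
    by_contra hneg
    have hk1 : (1 : ℝ) ≤ -k := by
      have : k ≤ -1 := by omega
      have : (k : ℝ) ≤ -1 := by exact_mod_cast this
      linarith
    have h2 : ‖1 - z‖ ≤ 2 := (norm_sub_le _ _).trans (by
      rw [mem_closedBall_zero_iff] at hz; rw [norm_one]; linarith)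
    rw [← he, Complex.norm_exp] at h2
    have h3 : (-(k : ℂ)).re = -k := by simp
    rw [h3] at h2
    have := Real.add_one_lt_exp (by norm_num : (1 : ℝ) ≠ 0)
    have := Real.exp_le_exp.2 hk1
    linarith
  obtain ⟨n, rfl⟩ := Int.eq_ofNat_of_zero_le hk0
  refine ⟨n, ?_⟩
  rw [cuspPoint, sub_eq_iff_eq_add, ← sub_eq_iff_eq_add']
  simpa using he.symm

theorem flatSine_eq_zero_iff (hz : z ∈ unitDisc) : flatSine z = 0 ↔ z ∈ range cuspPoint := by
  refine ⟨fun h => exists_eq_cuspPoint (Metric.ball_subset_closedBall hz) ?_ h, ?_⟩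
  · rintro rfl
    have := re_lt_one_of_mem_unitDisc hz
    simp at this
  · rintro ⟨k, rfl⟩
    exact flatSine_cuspPoint k

theorem flatSineDeriv_cuspPoint_ne_zero (k : ℕ) : flatSineDeriv (cuspPoint k) ≠ 0 := by
  have hs := sin_eq_zero_of_flatSine_eq_zero (flatSine_cuspPoint k)
  have hc : Complex.cos (Real.pi * cuspLog (cuspPoint k)) ≠ 0 := fun h => by
    have := Complex.sin_sq_add_cos_sq (Real.pi * cuspLog (cuspPoint k))
    rw [hs, h] at this; simp at this
  have hpi : (Real.pi : ℂ) ≠ 0 := by exact_mod_cast Real.pi_ne_zero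
  rw [flatSineDeriv, hs, mul_zero, sub_zero]
  exact mul_ne_zero (mul_ne_zero (Complex.exp_ne_zero _) (Complex.exp_ne_zero _))
    (mul_ne_zero hpi hc)

theorem continuousOn_flatSine : ContinuousOn flatSine (Metric.closedBall 0 1) := by
  intro z hz
  by_cases h1 : z = 1
  · subst h1
    obtain ⟨C, _, hC⟩ := exists_norm_flatSine_le 1
    rw [ContinuousWithinAt, flatSine_one, tendsto_zero_iff_norm_tendsto_zero]
    have ht : Tendsto (fun z : ℂ => C * ‖1 - z‖ ^ 1) (𝓝[Metric.closedBall 0 1] 1) (𝓝 0) := by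
      have : Continuous fun z : ℂ => C * ‖1 - z‖ ^ 1 := by fun_prop
      simpa using (this.tendsto 1).mono_left nhdsWithin_le_nhds
    refine squeeze_zero' (Eventually.of_forall fun _ => norm_nonneg _) ?_ ht
    filter_upwards [self_mem_nhdsWithin] with w hw
    by_cases hw1 : w = 1
    · simp [hw1, flatSine_one]
    · exact hC w (re_lt_one_of_mem_closedBall hw hw1)
  · exact (hasDerivAt_flatSine
      (re_lt_one_of_mem_closedBall hz h1)).continuousAt.continuousWithinAt

/-- The identity theorem on the half plane Re z < 1: one nonzero value excludes an accumulation of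
zeros. -/
theorem eventually_ne_zero_of_mem_unitDisc {f : ℂ → ℂ} (hf : DifferentiableOn ℂ f {z | z.re < 1})
    {w : ℂ} (hw : w.re < 1) (hfw : f w ≠ 0) (hz : z ∈ unitDisc) : ∀ᶠ v in 𝓝[≠] z, f v ≠ 0 := by
  have hA := hf.analyticOnNhd isOpen_re_lt_one
  have hpre : IsPreconnected {z : ℂ | z.re < 1} := (convex_halfSpace_re_lt 1).isPreconnected
  by_contra hcon
  have hfr : ∃ᶠ v in 𝓝[≠] z, f v = 0 := (not_eventually.1 hcon).mono fun v hv => not_not.1 hv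
  exact hfw (hA.eqOn_zero_of_preconnected_of_frequently_eq_zero hpre
    (re_lt_one_of_mem_unitDisc hz) hfr hw)

theorem cuspLog_half : cuspLog (1 - Complex.exp (-(1 / 2))) = 1 / 2 := by
  rw [cuspLog, sub_sub_cancel, show (-(1 / 2 : ℂ)) = ((-(1 / 2) : ℝ) : ℂ) by simp,
    ← Complex.ofReal_exp, ← Complex.ofReal_log (Real.exp_pos _).le, Real.log_exp]
  simp

/-- F F' is not identically zero, as seen at the point with L = 1/2. The zeros of ∇u lie among the
zeros of this product, so isolation of both the singular points and the critical points follows. -/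
theorem eventually_flatSine_mul_deriv_ne_zero (hz : z ∈ unitDisc) :
    ∀ᶠ v in 𝓝[≠] z, flatSine v * flatSineDeriv v ≠ 0 := by
  have hd : DifferentiableOn ℂ flatSineDeriv {z | z.re < 1} := fun w hw => by
    have h := (hasDerivAt_cuspLog hw).differentiableAt
    have hs := (h.const_mul (Real.pi : ℂ)).csin
    have hc := (h.const_mul (Real.pi : ℂ)).ccos
    exact (((h.pow 2).neg.cexp.mul h.cexp).mul
      ((hc.const_mul _).sub ((h.const_mul 2).mul hs))).differentiableWithinAt
  have hs : Complex.sin (Real.pi * (1 / 2)) = 1 := by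
    rw [mul_one_div, Complex.sin_pi_div_two]
  have hc : Complex.cos (Real.pi * (1 / 2)) = 0 := by
    rw [mul_one_div, Complex.cos_pi_div_two]
  refine eventually_ne_zero_of_mem_unitDisc (differentiableOn_flatSine.mul hd)
    (w := 1 - Complex.exp (-(1 / 2))) ?_ ?_ hz
  · rw [show (-(1 / 2 : ℂ)) = ((-(1 / 2) : ℝ) : ℂ) by simp, ← Complex.ofReal_exp]
    rw [Complex.sub_re, Complex.one_re, Complex.ofReal_re]
    linarith [Real.exp_pos (-(1 / 2))]
  · rw [flatSine, flatSineDeriv, cuspLog_half, hs, hc]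
    simp [Complex.exp_ne_zero]

theorem isolatedIn_range_cuspPoint : IsolatedIn unitDisc (range cuspPoint) := fun z hz => by
  filter_upwards [eventually_flatSine_mul_deriv_ne_zero hz] with w hw
  rintro ⟨k, rfl⟩
  exact hw (by rw [flatSine_cuspPoint, zero_mul])

end cuspLog

/-! ### Integrability of the logarithmic derivative -/

/-- The logarithmic derivative of `flatSine`. -/
noncomputable def flatLogDeriv (z : ℂ) : ℂ := flatSineDeriv z / flatSine z

theorem sq_norm_sin (w : ℂ) :
    ‖Complex.sin w‖ ^ 2 = Real.sin w.re ^ 2 + Real.sinh w.im ^ 2 := by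
  rw [Complex.sq_norm, Complex.sin_eq, ← Complex.ofReal_sin, ← Complex.ofReal_cos,
    ← Complex.ofReal_sinh, ← Complex.ofReal_cosh, ← Complex.ofReal_mul, ← Complex.ofReal_mul,
    Complex.normSq_add_mul_I]
  have h1 := Real.sin_sq_add_cos_sq w.re
  have h2 := Real.cosh_sq w.im
  linear_combination Real.sin w.re ^ 2 * h2 + Real.sinh w.im ^ 2 * h1

/-- Use |sin(πw)|² = sin²(πx) + sinh²(πy), w = x + iy, with Jordan's inequality |sin(πx)| ≥ 2|x| for
|x| ≤ 1/2 and |sinh(πy)| ≥ π|y|. -/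
theorem two_mul_norm_le_norm_sin {w : ℂ} (hw : |w.re| ≤ 1 / 2) :
    2 * ‖w‖ ≤ ‖Complex.sin (Real.pi * w)‖ := by
  have hpi := Real.pi_pos
  have h1 : (2 * w.re) ^ 2 ≤ Real.sin (Real.pi * w.re) ^ 2 := by
    rw [sq_le_sq]
    have := Real.mul_le_sin (x := Real.pi * |w.re|) (by positivity) (by nlinarith)
    have e : 2 / Real.pi * (Real.pi * |w.re|) = |2 * w.re| := by
      rw [abs_mul, abs_two]; field_simp
    rw [e] at this
    refine this.trans ?_
    rcases abs_cases w.re with ⟨h, _⟩ | ⟨h, _⟩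
    · rw [h]; exact le_abs_self _
    · rw [h, mul_neg, Real.sin_neg]; exact neg_le_abs _
  have h2 : (2 * w.im) ^ 2 ≤ Real.sinh (Real.pi * w.im) ^ 2 := by
    rw [sq_le_sq, abs_mul, abs_two, Real.abs_sinh, abs_mul, abs_of_pos hpi]
    have h3 : Real.pi * |w.im| ≤ Real.sinh (Real.pi * |w.im|) :=
      Real.self_le_sinh_iff.2 (by positivity)
    nlinarith [Real.pi_gt_three, abs_nonneg w.im]
  refine le_of_sq_le_sq ?_ (norm_nonneg _)
  rw [sq_norm_sin, Complex.re_ofReal_mul, Complex.im_ofReal_mul, mul_pow, Complex.sq_norm,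
    Complex.normSq_apply]
  nlinarith

theorem norm_cos_le (w : ℂ) : ‖Complex.cos w‖ ≤ Real.exp |w.im| := by
  rw [Complex.cos, norm_div]
  have h1 : ‖Complex.exp (w * Complex.I)‖ ≤ Real.exp |w.im| := by
    rw [Complex.norm_exp]; simp [neg_le_abs]
  have h2 : ‖Complex.exp (-w * Complex.I)‖ ≤ Real.exp |w.im| := by
    rw [Complex.norm_exp]; simp [le_abs_self]
  have := norm_add_le (Complex.exp (w * Complex.I)) (Complex.exp (-w * Complex.I))
  rw [show ‖(2 : ℂ)‖ = 2 by simp]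
  linarith

/-- The constant in the pointwise bound for `flatLogDeriv`. -/
noncomputable def flatConst : ℝ := Real.pi * Real.exp (2 * Real.pi) * Real.exp 4

theorem exp_four_le_flatConst : Real.exp 4 ≤ flatConst := by
  have h1 : 1 ≤ Real.pi * Real.exp (2 * Real.pi) := by
    have := Real.one_le_exp (by positivity : 0 ≤ 2 * Real.pi)
    nlinarith [Real.pi_gt_three]
  have := Real.exp_pos 4
  unfold flatConst
  nlinarith

theorem flatConst_pos : 0 < flatConst := (Real.exp_pos 4).trans_le exp_four_le_flatConst

theorem flatLogDeriv_eq (z : ℂ) (h : flatSine z ≠ 0) : flatLogDeriv z = Complex.exp (cuspLog z) *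
    (Real.pi * (Complex.cos (Real.pi * cuspLog z) / Complex.sin (Real.pi * cuspLog z))
      - 2 * cuspLog z) := by
  have hs : Complex.sin (Real.pi * cuspLog z) ≠ 0 := (mul_ne_zero_iff.1 h).2
  have he := Complex.exp_ne_zero (-cuspLog z ^ 2)
  rw [flatLogDeriv, flatSine, flatSineDeriv]
  generalize Complex.sin (Real.pi * cuspLog z) = s at *
  field_simp

/-- Let n - 1 be the integer nearest to Re L and l = L - (n - 1). Then |cot πL| ≤ C/|l|, while e^L
has size e^{n-1} and |z - p| ≤ C e^{1-n}|l| for the centre p = 1 - e^{1-n}. The exponentials cancel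
and leave C/|z - p|. The other two bounds localize z: near p for summing over n, and away from 1 for
leaving finitely many n on compact sets. -/
theorem exists_norm_flatLogDeriv_le {z : ℂ} (hz : z ∈ unitDisc) :
    ∃ n : ℕ, ‖flatLogDeriv z‖ ≤ flatConst / ‖z - (1 - Complex.exp (1 - n))‖
        + 2 * ‖cuspLog z‖ / ‖1 - z‖ ∧
      ‖z - (1 - Complex.exp (1 - n))‖ ≤ flatConst * Real.exp (1 - n) ∧
      ‖1 - z‖ / 2 ≤ Real.exp (1 - n) := by
  have hre := re_lt_one_of_mem_unitDisc hz
  have hz1 : z ≠ 1 := by rintro rfl; simp at hre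
  have hpos : 0 < ‖1 - z‖ := norm_pos_iff.2 (sub_ne_zero.2 hz1.symm)
  have hn2 : ‖1 - z‖ < 2 := (norm_sub_le _ _).trans_lt (by
    have := mem_ball_zero_iff.1 hz; rw [norm_one]; linarith)
  set x := (cuspLog z).re with hx
  have hex : Real.exp (-x) = ‖1 - z‖ := by rw [hx, cuspLog_re, neg_neg, Real.exp_log hpos]
  have hxlow : -1 < x := by
    by_contra hcon
    push Not at hcon
    have h1 : Real.exp 1 ≤ Real.exp (-x) := Real.exp_le_exp.2 (by linarith)
    have := Real.add_one_lt_exp (by norm_num : (1 : ℝ) ≠ 0)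
    linarith
  have hround := abs_sub_round x
  -- Re L > -1 only, so the nearest integer may be -1; the shift by one keeps n natural. The extra
  -- centre 1 - e, for n = 0, lies outside the disc.
  obtain ⟨n, hn⟩ : ∃ n : ℕ, round x = n - 1 := by
    have : -1 ≤ round x := by
      have h1 : (-2 : ℝ) < round x := by
        have := (abs_le.1 hround).2; linarith
      have h2 : (-2 : ℤ) < round x := by exact_mod_cast h1
      omega
    exact ⟨(round x + 1).toNat, by omega⟩
  have hnr : ((round x : ℤ) : ℝ) = n - 1 := by rw [hn]; push_cast; ring
  rw [hnr] at hround
  set l : ℂ := cuspLog z - (n - 1) with hl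
  have hlre : l.re = x - (n - 1) := by simp [hl, hx]
  have hlim : l.im = (cuspLog z).im := by simp [hl]
  have him2 : |l.im| ≤ 2 := by
    rw [hlim]; exact (abs_cuspLog_im_le hre.le).trans (by linarith [Real.pi_le_four])
  have hlre' : |l.re| ≤ 1 / 2 := by rw [hlre]; exact hround
  have hln : ‖l‖ ≤ 5 / 2 := (Complex.norm_le_abs_re_add_abs_im l).trans (by linarith)
  have hcl : cuspLog z = l + (n - 1) := by rw [hl]; ring
  have hsin : ‖Complex.sin (Real.pi * cuspLog z)‖ = ‖Complex.sin (Real.pi * l)‖ := by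
    have : Real.pi * cuspLog z = Real.pi * l + ((n - 1 : ℤ) : ℂ) * Real.pi := by
      rw [hcl]; push_cast; ring
    rw [this, Complex.sin_antiperiodic.add_int_mul_eq]; simp
  have hcos : ‖Complex.cos (Real.pi * cuspLog z)‖ ≤ Real.exp (2 * Real.pi) := by
    refine (norm_cos_le _).trans (Real.exp_le_exp.2 ?_)
    rw [Complex.im_ofReal_mul, ← hlim, abs_mul, abs_of_pos Real.pi_pos]
    nlinarith [Real.pi_pos]
  have hdiff : z - (1 - Complex.exp (1 - n)) = Complex.exp (1 - n) * (1 - Complex.exp (-l)) := by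
    have h1 := exp_neg_cuspLog hz1
    have h2 : Complex.exp (1 - n) * Complex.exp (-l) = 1 - z := by
      rw [← h1, ← Complex.exp_add, hcl]; ring_nf
    rw [mul_sub, h2]; ring
  have hen : ‖Complex.exp (1 - n)‖ = Real.exp (1 - n) := by rw [Complex.norm_exp]; simp
  have hexp : ‖1 - Complex.exp (-l)‖ ≤ ‖l‖ * Real.exp (5 / 2) := by
    have := Complex.norm_exp_sub_sum_le_norm_mul_exp (-l) 1
    simp only [Finset.sum_range_one, pow_zero, Nat.factorial_zero, Nat.cast_one, div_one, pow_one,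
      norm_neg] at this
    rw [norm_sub_rev]
    refine this.trans ?_
    gcongr
  have hdist : ‖z - (1 - Complex.exp (1 - n))‖ ≤ Real.exp (1 - n) * (‖l‖ * Real.exp (5 / 2)) := by
    rw [hdiff, norm_mul, hen]; gcongr
  refine ⟨n, ?_, ?_, ?_⟩
  · by_cases h0 : flatSine z = 0
    · rw [flatLogDeriv, h0, div_zero, norm_zero]
      have := flatConst_pos
      positivity
    have hs : Complex.sin (Real.pi * cuspLog z) ≠ 0 := (mul_ne_zero_iff.1 h0).2
    have hl0 : 0 < ‖l‖ := by
      rw [norm_pos_iff]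
      rintro h
      rw [h, mul_zero, Complex.sin_zero, norm_zero, norm_eq_zero] at hsin
      exact hs hsin
    have hd0 : 0 < ‖z - (1 - Complex.exp (1 - n))‖ := by
      rw [norm_pos_iff]
      intro h
      have h1 : 1 - z = ((Real.exp (1 - n) : ℝ) : ℂ) := by
        push_cast; linear_combination -h
      have h2 : cuspLog z = n - 1 := by
        rw [cuspLog, h1, ← Complex.ofReal_log (Real.exp_pos _).le, Real.log_exp]; push_cast; ring
      rw [hl, h2, sub_self, norm_zero] at hl0
      exact hl0.false
    have hexL : ‖Complex.exp (cuspLog z)‖ = ‖1 - z‖⁻¹ := by rw [exp_cuspLog hz1, norm_inv]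
    have hcot : ‖Complex.cos (Real.pi * cuspLog z) / Complex.sin (Real.pi * cuspLog z)‖
        ≤ Real.exp (2 * Real.pi) / (2 * ‖l‖) := by
      rw [norm_div]
      gcongr
      rw [hsin]
      exact two_mul_norm_le_norm_sin hlre'
    have hkey : ‖1 - z‖⁻¹ * (Real.pi * (Real.exp (2 * Real.pi) / (2 * ‖l‖)))
        ≤ flatConst / ‖z - (1 - Complex.exp (1 - n))‖ := by
      rw [le_div_iff₀ hd0]
      calc ‖1 - z‖⁻¹ * (Real.pi * (Real.exp (2 * Real.pi) / (2 * ‖l‖)))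
            * ‖z - (1 - Complex.exp (1 - n))‖
          ≤ ‖1 - z‖⁻¹ * (Real.pi * (Real.exp (2 * Real.pi) / (2 * ‖l‖)))
            * (Real.exp (1 - n) * (‖l‖ * Real.exp (5 / 2))) := by
              have := Real.pi_pos
              gcongr
        _ = Real.pi * Real.exp (2 * Real.pi) / 2
            * Real.exp (x + (1 - n) + 5 / 2) := by
              rw [← hex, Real.exp_neg, inv_inv, Real.exp_add, Real.exp_add]
              field_simp
        _ ≤ Real.pi * Real.exp (2 * Real.pi) * Real.exp 4 := by
              have h1 : Real.exp (x + (1 - n) + 5 / 2) ≤ Real.exp 4 := by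
                refine Real.exp_le_exp.2 ?_
                have := (abs_le.1 hround).2
                linarith
              have h2 : 0 < Real.pi * Real.exp (2 * Real.pi) := by positivity
              gcongr
              linarith
    rw [flatLogDeriv_eq z h0, norm_mul, hexL]
    have h3 := norm_sub_le
      (Real.pi * (Complex.cos (Real.pi * cuspLog z) / Complex.sin (Real.pi * cuspLog z)))
      (2 * cuspLog z)
    rw [norm_mul (Real.pi : ℂ), norm_mul (2 : ℂ), Complex.norm_real,
      Real.norm_of_nonneg Real.pi_pos.le, show ‖(2 : ℂ)‖ = 2 by simp] at h3
    calc ‖1 - z‖⁻¹ * _ ≤ ‖1 - z‖⁻¹ * (Real.pi * (Real.exp (2 * Real.pi) / (2 * ‖l‖))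
          + 2 * ‖cuspLog z‖) := by
            refine mul_le_mul_of_nonneg_left (h3.trans ?_) (by positivity)
            have := mul_le_mul_of_nonneg_left hcot Real.pi_pos.le
            linarith
      _ = ‖1 - z‖⁻¹ * (Real.pi * (Real.exp (2 * Real.pi) / (2 * ‖l‖)))
          + 2 * ‖cuspLog z‖ / ‖1 - z‖ := by ring
      _ ≤ _ := by linarith
  · refine hdist.trans ?_
    have h1 : ‖l‖ * Real.exp (5 / 2) ≤ Real.exp 4 := by
      have h2 : (5 / 2 : ℝ) ≤ Real.exp (3 / 2) := by
        have := Real.add_one_le_exp (3 / 2 : ℝ); linarith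
      calc ‖l‖ * Real.exp (5 / 2) ≤ Real.exp (3 / 2) * Real.exp (5 / 2) := by
            gcongr; exact hln.trans h2
        _ = Real.exp 4 := by rw [← Real.exp_add]; norm_num
    rw [mul_comm]
    have := exp_four_le_flatConst
    gcongr
    linarith
  · rw [← hex]
    have h1 : Real.exp (-x) ≤ Real.exp (1 / 2) * Real.exp (1 - n) := by
      rw [← Real.exp_add]
      refine Real.exp_le_exp.2 ?_
      have := (abs_le.1 hround).1
      linarith
    have h2 : Real.exp (1 / 2) ≤ 2 := by
      have h3 : Real.exp (1 / 2) ^ 2 = Real.exp 1 := by rw [← Real.exp_nat_mul]; norm_num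
      have := Real.exp_one_lt_d9
      nlinarith [Real.exp_pos (1 / 2)]
    nlinarith [Real.exp_pos (1 - n : ℝ)]

theorem setLIntegral_ball_norm_sub_rpow (p : ℂ) (s R : ℝ) :
    ∫⁻ z in Metric.ball p R, ENNReal.ofReal (‖z - p‖ ^ (-s))
      = ∫⁻ z in Metric.ball (0 : ℂ) R, ENNReal.ofReal (‖z‖ ^ (-s)) := by
  have hpre : (fun z : ℂ => z - p) ⁻¹' Metric.ball 0 R = Metric.ball p R := by
    ext z; simp [dist_eq_norm]
  have := (measurePreserving_sub_right (volume : Measure ℂ) p).setLIntegral_comp_preimage_emb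
    (MeasurableEquiv.subRight p).measurableEmbedding (fun z => ENNReal.ofReal (‖z‖ ^ (-s)))
    (Metric.ball 0 R)
  rw [hpre] at this
  exact this

theorem setLIntegral_ball_norm_rpow_lt_top {s : ℝ} (hs : s < 2) (R : ℝ) :
    ∫⁻ z in Metric.ball (0 : ℂ) R, ENNReal.ofReal (‖z‖ ^ (-s)) < (⊤ : ℝ≥0∞) :=
  (integrableOn_norm_rpow_neg hs R).lintegral_lt_top

theorem measurable_cuspLog : Measurable cuspLog :=
  (Complex.measurable_log.comp (measurable_const.sub measurable_id)).neg

theorem measurable_flatSine : Measurable flatSine := by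
  have h := measurable_cuspLog
  unfold flatSine
  fun_prop

theorem measurable_flatLogDeriv : Measurable flatLogDeriv := by
  have h := measurable_cuspLog
  refine Measurable.div ?_ measurable_flatSine
  unfold flatSineDeriv
  fun_prop

/-- The real part of L is a logarithm of |1 - z|, which any negative power dominates. Since |1 - z|
≤ 2, the factor 2^δ makes 2^δ |1 - z|^{-δ} at least 1, absorbing the additive constants. -/
theorem norm_cuspLog_le_rpow {δ : ℝ} (hδ : 0 < δ) {z : ℂ} (hz : z ∈ unitDisc) :
    ‖cuspLog z‖ ≤ (1 / δ + 3) * 2 ^ δ * ‖1 - z‖ ^ (-δ) := by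
  have hre := re_lt_one_of_mem_unitDisc hz
  have hpos : 0 < ‖1 - z‖ := norm_pos_iff.2 (one_sub_ne_zero_of_re_lt hre)
  have hn2 : ‖1 - z‖ ≤ 2 := (norm_sub_le _ _).trans (by
    have := mem_ball_zero_iff.1 hz; rw [norm_one]; linarith)
  have h1 := norm_cuspLog_le hre.le
  rw [cuspLog_re, abs_neg] at h1
  set t := ‖1 - z‖ with ht
  have h2 : 1 ≤ 2 ^ δ * t ^ (-δ) := by
    rw [Real.rpow_neg hpos.le, ← div_eq_mul_inv, one_le_div (by positivity)]
    exact Real.rpow_le_rpow hpos.le hn2 hδ.le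
  have h3 : |Real.log t| ≤ (1 / δ + 1) * (2 ^ δ * t ^ (-δ)) := by
    rcases le_total t 1 with h | h
    · have h4 := (Real.abs_log_mul_self_rpow_lt t δ hpos h hδ).le
      rw [abs_mul, abs_of_pos (by positivity : 0 < t ^ δ)] at h4
      have h5 : |Real.log t| ≤ 1 / δ * t ^ (-δ) := by
        rw [Real.rpow_neg hpos.le, ← div_eq_mul_inv, le_div_iff₀ (by positivity)]
        exact h4
      have h6 : (1 : ℝ) ≤ 2 ^ δ := Real.one_le_rpow one_le_two hδ.le
      have h7 : 0 < t ^ (-δ) := by positivity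
      have h8 : 0 < 1 / δ := by positivity
      have h9 : 1 / δ * t ^ (-δ) ≤ 1 / δ * (2 ^ δ * t ^ (-δ)) := by
        gcongr; nlinarith
      nlinarith
    · rw [abs_of_nonneg (Real.log_nonneg h)]
      have h4 := Real.log_le_sub_one_of_pos hpos
      have h8 : 0 < 1 / δ := by positivity
      nlinarith
  nlinarith

/-- The r-th power is dominated by a sum of |z - c_n|^{-r} over balls whose radii ρ_n decay
geometrically, plus one power of |1 - z|. The integral over the n-th ball is O(ρ_n^δ), which is
summable. -/
theorem memLp_flatLogDeriv_of_lt {r : ℝ} (h1 : 1 ≤ r) (h2 : r < 2) :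
    MemLp flatLogDeriv (ENNReal.ofReal r) (volume.restrict unitDisc) := by
  refine ⟨measurable_flatLogDeriv.aestronglyMeasurable, ?_⟩
  have hr0 : 0 < r := by linarith
  rw [eLpNorm_lt_top_iff_lintegral_rpow_enorm_lt_top (by simpa using hr0) ENNReal.ofReal_ne_top,
    ENNReal.toReal_ofReal hr0.le]
  -- A margin for which both (1 + δ) r < 2 and r + δ < 2.
  set δ : ℝ := (2 - r) / 4 with hδ
  have hδ0 : 0 < δ := by rw [hδ]; linarith
  have hs : (1 + δ) * r < 2 := by rw [hδ]; nlinarith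
  have hC := flatConst_pos
  set ρ : ℕ → ℝ := fun n => 2 * flatConst * Real.exp (1 - n) with hρ
  have hρ0 : ∀ n, 0 < ρ n := fun n => by rw [hρ]; positivity
  set c : ℕ → ℂ := fun n => 1 - Complex.exp (1 - n) with hc
  set K : ℝ := 2 ^ r * flatConst ^ r with hK
  set M : ℝ := 2 ^ r * (2 * ((1 / δ + 3) * 2 ^ δ)) ^ r with hM
  have hpt : ∀ z ∈ unitDisc, ‖flatLogDeriv z‖ₑ ^ r
      ≤ (∑' n, (Metric.ball (c n) (ρ n)).indicator
          (fun z => ENNReal.ofReal (K * ‖z - c n‖ ^ (-r))) z)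
        + ENNReal.ofReal (M * ‖1 - z‖ ^ (-((1 + δ) * r))) := by
    intro z hz
    obtain ⟨n, ha, hb, -⟩ := exists_norm_flatLogDeriv_le hz
    have hpos : 0 < ‖1 - z‖ := norm_pos_iff.2
      (one_sub_ne_zero_of_re_lt (re_lt_one_of_mem_unitDisc hz))
    have hmem : z ∈ Metric.ball (c n) (ρ n) := by
      rw [mem_ball_iff_norm]
      refine hb.trans_lt ?_
      rw [hρ]
      have : 0 < flatConst * Real.exp (1 - n) := by positivity
      dsimp only
      linarith
    have hlog : 2 * ‖cuspLog z‖ / ‖1 - z‖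
        ≤ 2 * ((1 / δ + 3) * 2 ^ δ) * ‖1 - z‖ ^ (-(1 + δ)) := by
      have e : ‖1 - z‖ ^ (-(1 + δ)) = ‖1 - z‖ ^ (-δ) / ‖1 - z‖ := by
        rw [neg_add, Real.rpow_add hpos, Real.rpow_neg_one, mul_comm, div_eq_mul_inv]
      rw [e, mul_div_assoc', mul_assoc]
      gcongr
      exact norm_cuspLog_le_rpow hδ0 hz
    have hle : ‖flatLogDeriv z‖ ^ r ≤ K * ‖z - c n‖ ^ (-r) + M * ‖1 - z‖ ^ (-((1 + δ) * r)) := by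
      have hA : 0 ≤ flatConst / ‖z - c n‖ := by positivity
      have hB : 0 ≤ 2 * ((1 / δ + 3) * 2 ^ δ) * ‖1 - z‖ ^ (-(1 + δ)) := by positivity
      have e1 : (2 * (flatConst / ‖z - c n‖)) ^ r = K * ‖z - c n‖ ^ (-r) := by
        rw [Real.mul_rpow zero_le_two hA, Real.div_rpow hC.le (norm_nonneg _),
          Real.rpow_neg (norm_nonneg _), hK]
        ring
      have e2 : (2 * (2 * ((1 / δ + 3) * 2 ^ δ) * ‖1 - z‖ ^ (-(1 + δ)))) ^ r
          = M * ‖1 - z‖ ^ (-((1 + δ) * r)) := by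
        rw [Real.mul_rpow zero_le_two hB, Real.mul_rpow (by positivity) (by positivity),
          ← Real.rpow_mul hpos.le, hM]
        ring_nf
      rw [← e1, ← e2]
      have hsum := ha.trans (add_le_add_right hlog _)
      set A := flatConst / ‖z - c n‖
      set B := 2 * ((1 / δ + 3) * 2 ^ δ) * ‖1 - z‖ ^ (-(1 + δ))
      have hA' : 0 ≤ (2 * A) ^ r := by positivity
      have hB' : 0 ≤ (2 * B) ^ r := by positivity
      rcases le_total A B with hAB | hAB
      · have := Real.rpow_le_rpow (norm_nonneg _) (hsum.trans (by linarith : A + B ≤ 2 * B)) hr0.le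
        linarith
      · have := Real.rpow_le_rpow (norm_nonneg _) (hsum.trans (by linarith : A + B ≤ 2 * A)) hr0.le
        linarith
    rw [← ofReal_norm, ENNReal.ofReal_rpow_of_nonneg (norm_nonneg _) hr0.le]
    refine (ENNReal.ofReal_le_ofReal hle).trans (ENNReal.ofReal_add_le.trans ?_)
    gcongr
    refine le_trans ?_ (ENNReal.le_tsum n)
    rw [indicator_of_mem hmem]
  have hmeas : ∀ (p : ℂ) (k s : ℝ), Measurable fun z : ℂ => ENNReal.ofReal (k * ‖z - p‖ ^ s) :=
    fun p k s => by fun_prop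
  have hterm : ∀ n, ∫⁻ z, (Metric.ball (c n) (ρ n)).indicator
      (fun z => ENNReal.ofReal (K * ‖z - c n‖ ^ (-r))) z
      ≤ ENNReal.ofReal (K * ρ 0 ^ δ) * (∫⁻ z in Metric.ball (0 : ℂ) (ρ 0),
        ENNReal.ofReal (‖z‖ ^ (-(r + δ)))) * ENNReal.ofReal (Real.exp (-δ)) ^ n := by
    intro n
    have hK0 : 0 ≤ K := by positivity
    have hρn : ρ n ^ δ = ρ 0 ^ δ * Real.exp (-δ) ^ n := by
      have : ρ n = ρ 0 * Real.exp (-n) := by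
        simp only [hρ]; rw [mul_assoc _ _ (Real.exp (-n)), ← Real.exp_add]; congr 2; simp; ring
      rw [this, Real.mul_rpow (hρ0 0).le (Real.exp_pos _).le, ← Real.exp_mul, ← Real.exp_nat_mul]
      ring_nf
    have hsub : Metric.ball (0 : ℂ) (ρ n) ⊆ Metric.ball 0 (ρ 0) := by
      refine Metric.ball_subset_ball ?_
      simp only [hρ]
      gcongr
      simp
    rw [lintegral_indicator measurableSet_ball]
    clear_value K
    simp only [ENNReal.ofReal_mul hK0]
    rw [lintegral_const_mul' _ _ ENNReal.ofReal_ne_top, setLIntegral_ball_norm_sub_rpow]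
    -- On the ball |z|^{-r} ≤ ρ_n^δ |z|^{-(r+δ)}: part of the spare integrability is traded for a
    -- factor that is geometric in n.
    have hstep : ∫⁻ z in Metric.ball (0 : ℂ) (ρ n), ENNReal.ofReal (‖z‖ ^ (-r))
        ≤ ENNReal.ofReal (ρ n ^ δ) * ∫⁻ z in Metric.ball (0 : ℂ) (ρ 0),
          ENNReal.ofReal (‖z‖ ^ (-(r + δ))) := by
      rw [← lintegral_const_mul' _ _ ENNReal.ofReal_ne_top]
      refine le_trans (setLIntegral_mono' measurableSet_ball fun z hz => ?_)
        (lintegral_mono_set hsub)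
      rw [← ENNReal.ofReal_mul (by have := hρ0 n; positivity)]
      refine ENNReal.ofReal_le_ofReal ?_
      rcases (norm_nonneg z).eq_or_lt with h0 | h0
      · rw [← h0, Real.zero_rpow (by linarith)]
        have := hρ0 n
        positivity
      · have e : ‖z‖ ^ (-(r + δ)) = ‖z‖ ^ (-r) / ‖z‖ ^ δ := by
          rw [neg_add, Real.rpow_add h0, Real.rpow_neg h0.le δ, div_eq_mul_inv]
        rw [e, mul_div_assoc', le_div_iff₀ (by positivity), mul_comm]
        gcongr
        exact (mem_ball_zero_iff.1 hz).le
    calc _ ≤ ENNReal.ofReal K * (ENNReal.ofReal (ρ n ^ δ) * ∫⁻ z in Metric.ball (0 : ℂ) (ρ 0),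
          ENNReal.ofReal (‖z‖ ^ (-(r + δ)))) := by gcongr
      _ = _ := by
        rw [hρn, ENNReal.ofReal_mul (p := ρ 0 ^ δ) (by have := hρ0 0; positivity),
          ENNReal.ofReal_pow (Real.exp_pos _).le]
        ring
  have hball : (unitDisc : Set ℂ) ⊆ Metric.ball 1 2 := fun z hz => by
    rw [mem_ball_iff_norm]
    refine (norm_sub_le _ _).trans_lt ?_
    have := mem_ball_zero_iff.1 hz
    rw [norm_one]; linarith
  calc ∫⁻ z in (unitDisc : Set ℂ), ‖flatLogDeriv z‖ₑ ^ r
      ≤ ∫⁻ z in (unitDisc : Set ℂ), ((∑' n, (Metric.ball (c n) (ρ n)).indicator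
          (fun z => ENNReal.ofReal (K * ‖z - c n‖ ^ (-r))) z)
        + ENNReal.ofReal (M * ‖1 - z‖ ^ (-((1 + δ) * r)))) :=
        setLIntegral_mono' unitDisc.isOpen.measurableSet hpt
    _ = (∫⁻ z in (unitDisc : Set ℂ), (∑' n, (Metric.ball (c n) (ρ n)).indicator
          (fun z => ENNReal.ofReal (K * ‖z - c n‖ ^ (-r))) z))
        + ∫⁻ z in (unitDisc : Set ℂ), ENNReal.ofReal (M * ‖1 - z‖ ^ (-((1 + δ) * r))) := by
        refine lintegral_add_right _ ?_
        simp only [norm_sub_rev (1 : ℂ)]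
        exact hmeas 1 M _
    _ < (⊤ : ℝ≥0∞) := by
      refine ENNReal.add_lt_top.2 ⟨?_, ?_⟩
      · refine (setLIntegral_le_lintegral _ _).trans_lt ?_
        rw [lintegral_tsum fun n => ((hmeas _ _ _).indicator measurableSet_ball).aemeasurable]
        refine (ENNReal.tsum_le_tsum hterm).trans_lt ?_
        rw [ENNReal.tsum_mul_left, ENNReal.tsum_geometric]
        refine ENNReal.mul_lt_top (ENNReal.mul_lt_top ENNReal.ofReal_lt_top
          (setLIntegral_ball_norm_rpow_lt_top (by rw [hδ]; linarith) _)) ?_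
        rw [ENNReal.inv_lt_top, tsub_pos_iff_lt, ENNReal.ofReal_lt_one]
        exact Real.exp_lt_one_iff.2 (by linarith)
      · refine (lintegral_mono_set hball).trans_lt ?_
        have hM0 : 0 ≤ M := by positivity
        clear_value M
        simp only [norm_sub_rev (1 : ℂ), ENNReal.ofReal_mul hM0]
        rw [lintegral_const_mul' _ _ ENNReal.ofReal_ne_top, setLIntegral_ball_norm_sub_rpow]
        exact ENNReal.mul_lt_top ENNReal.ofReal_lt_top (setLIntegral_ball_norm_rpow_lt_top hs _)

theorem unitDisc_eq_ball : (unitDisc : Set ℂ) = Metric.ball 0 1 := rfl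

instance isFiniteMeasure_restrict_unitDisc : IsFiniteMeasure (volume.restrict (unitDisc : Set ℂ)) :=
  isFiniteMeasure_restrict.2 (by rw [unitDisc_eq_ball]; exact measure_ball_lt_top.ne)

theorem memLp_flatLogDeriv {p : ℝ≥0∞} (hp : p < 2) :
    MemLp flatLogDeriv p (volume.restrict unitDisc) := by
  -- Exponents below 1 are reduced to 1, the disc having finite measure.
  have h1 : max p 1 < 2 := max_lt hp (by norm_num)
  have h2 : max p 1 ≠ (⊤ : ℝ≥0∞) := (h1.trans (by norm_num)).ne
  have h3 : 1 ≤ (max p 1).toReal := by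
    rw [← ENNReal.toReal_one]; exact ENNReal.toReal_mono h2 (le_max_right _ _)
  have h4 : (max p 1).toReal < 2 := by
    have := (ENNReal.toReal_lt_toReal h2 (by norm_num)).2 h1
    simpa using this
  have := memLp_flatLogDeriv_of_lt h3 h4
  rw [ENNReal.ofReal_toReal h2] at this
  exact this.mono_exponent (le_max_left _ _)

/-- On a compact set the logarithmic term is at most some M and only N centres occur. If t ≥ 2M, the
set where |F'/F| > t lies in N balls of radius 2C/t, with C = `flatConst`. If t < 2M, the area of
the disc is already at most (2M/t)² π. -/
theorem exists_volume_flatLogDeriv_le {K : Set ℂ} (hK : IsCompact K) (hKU : K ⊆ unitDisc) :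
    ∃ C : ℝ, ∀ t : ℝ, 0 < t →
      volume {z ∈ K | t < ‖flatLogDeriv z‖} ≤ ENNReal.ofReal (C / t ^ 2) := by
  obtain ⟨ρ, hρ1, hρ⟩ : ∃ ρ < 1, K ⊆ Metric.closedBall 0 ρ := by
    rcases K.eq_empty_or_nonempty with rfl | hne
    · exact ⟨0, zero_lt_one, empty_subset _⟩
    obtain ⟨z, hz, hmax⟩ := hK.exists_isMaxOn hne continuous_norm.continuousOn
    exact ⟨‖z‖, mem_ball_zero_iff.1 (hKU hz), fun w hw => mem_closedBall_zero_iff.2 (hmax hw)⟩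
  have hd : 0 < 1 - ρ := by linarith
  have hlow : ∀ z ∈ K, 1 - ρ ≤ ‖1 - z‖ := fun z hz => by
    have h1 := norm_sub_norm_le (1 : ℂ) z
    have h2 := mem_closedBall_zero_iff.1 (hρ hz)
    rw [norm_one] at h1; linarith
  obtain ⟨M, hM0, hM⟩ : ∃ M : ℝ, 0 ≤ M ∧ ∀ z ∈ K, 2 * ‖cuspLog z‖ / ‖1 - z‖ ≤ M := by
    refine ⟨2 * ((1 / 1 + 3) * 2 ^ (1 : ℝ) * (1 - ρ) ^ (-1 : ℝ)) / (1 - ρ), by positivity,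
      fun z hz => ?_⟩
    have h1 := norm_cuspLog_le_rpow one_pos (hKU hz)
    have h2 := hlow z hz
    have h3 : ‖1 - z‖ ^ (-1 : ℝ) ≤ (1 - ρ) ^ (-1 : ℝ) :=
      Real.rpow_le_rpow_of_nonpos hd h2 (by norm_num)
    gcongr
    exact h1.trans (by gcongr)
  -- A centre of index n is used only if e^{1-n} ≥ |1 - z|/2, which is bounded below on K.
  obtain ⟨N, hN⟩ : ∃ N : ℕ, ∀ n : ℕ, (1 - ρ) / 2 ≤ Real.exp (1 - n) → n < N := by
    have ht : Tendsto (fun n : ℕ => Real.exp (1 - n)) atTop (𝓝 0) :=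
      Real.tendsto_exp_atBot.comp
        (tendsto_atBot_add_const_left _ 1 (tendsto_neg_atTop_atBot.comp tendsto_natCast_atTop_atTop))
    obtain ⟨N, hN⟩ := eventually_atTop.1 (ht.eventually (gt_mem_nhds (by linarith : 0 < (1 - ρ) / 2)))
    exact ⟨N, fun n hn => by by_contra h; exact absurd (hN n (not_lt.1 h)) (not_lt.2 hn)⟩
  have hC := flatConst_pos
  refine ⟨4 * M ^ 2 * Real.pi + N * (4 * flatConst ^ 2 * Real.pi), fun t ht => ?_⟩
  have hvol : ∀ (p : ℂ) (R : ℝ), 0 ≤ R →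
      volume (Metric.ball p R) = ENNReal.ofReal (R ^ 2 * Real.pi) := fun p R hR => by
    rw [Complex.volume_ball, ENNReal.ofReal_mul (by positivity), ENNReal.ofReal_pow hR]
    congr 1
    rw [ENNReal.ofReal, Real.toNNReal_of_nonneg Real.pi_pos.le]
    rfl
  have hsub : {z ∈ K | t < ‖flatLogDeriv z‖} ⊆ {z ∈ K | t < 2 * M} ∪
      ⋃ n ∈ Finset.range N, Metric.ball (1 - Complex.exp (1 - n)) (2 * flatConst / t) := by
    rintro z ⟨hzK, hzt⟩
    obtain ⟨n, ha, -, hb⟩ := exists_norm_flatLogDeriv_le (hKU hzK)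
    by_cases hlt : t < 2 * M
    · exact Or.inl ⟨hzK, hlt⟩
    refine Or.inr (mem_biUnion (x := n) ?_ ?_)
    · have := hlow z hzK
      exact Finset.mem_coe.2 (Finset.mem_range.2 (hN n (by linarith)))
    · rw [mem_ball_iff_norm]
      have h1 := hM z hzK
      have h2 : t / 2 < flatConst / ‖z - (1 - Complex.exp (1 - n))‖ := by linarith
      have h3 : 0 < ‖z - (1 - Complex.exp (1 - n))‖ := by
        rcases (norm_nonneg (z - (1 - Complex.exp (1 - n)))).eq_or_lt with h | h
        · rw [← h, div_zero] at h2; linarith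
        · exact h
      rw [lt_div_iff₀ h3] at h2
      rw [lt_div_iff₀ ht]
      linarith
  refine (measure_mono hsub).trans ((measure_union_le _ _).trans ?_)
  have e : (4 * M ^ 2 * Real.pi + N * (4 * flatConst ^ 2 * Real.pi)) / t ^ 2
      = (2 * M / t) ^ 2 * Real.pi + N * ((2 * flatConst / t) ^ 2 * Real.pi) := by
    field_simp
    ring
  rw [e, ENNReal.ofReal_add (by positivity) (by positivity)]
  refine add_le_add ?_ ?_
  · by_cases hlt : t < 2 * M
    · calc volume {z ∈ K | t < 2 * M} ≤ volume (Metric.ball (0 : ℂ) 1) :=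
            measure_mono fun z hz => hKU hz.1
        _ = ENNReal.ofReal (1 ^ 2 * Real.pi) := hvol 0 1 zero_le_one
        _ ≤ _ := by
          refine ENNReal.ofReal_le_ofReal ?_
          have : 1 ≤ 2 * M / t := (one_le_div ht).2 hlt.le
          gcongr
    · simp [hlt]
  · refine (measure_biUnion_finset_le _ _).trans ?_
    simp only [hvol _ _ (by positivity : 0 ≤ 2 * flatConst / t)]
    rw [Finset.sum_const, Finset.card_range, ENNReal.ofReal_mul (p := (N : ℝ)) (by positivity),
      ENNReal.ofReal_natCast, nsmul_eq_mul]

/-! ### The vortex map and its weak gradient -/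

/-- Integration by parts of a field, differentiable off a countable set, against a test function. -/
theorem setIntegral_field_mul_fderiv {U S : Set ℂ} (hU : IsOpen U) (hS : S.Countable)
    {ψ V₁ V₂ D : ℂ → ℂ} (hψ : ContDiff ℝ 1 ψ) (cψ : HasCompactSupport ψ) (sψ : tsupport ψ ⊆ U)
    (h₁ : ContinuousOn V₁ U) (h₂ : ContinuousOn V₂ U)
    (d₁ : ∀ z ∈ U, z ∉ S → DifferentiableAt ℝ V₁ z) (d₂ : ∀ z ∈ U, z ∉ S → DifferentiableAt ℝ V₂ z)
    (hD : ∀ z ∈ U, z ∉ S → fderiv ℝ V₁ z 1 + fderiv ℝ V₂ z Complex.I = D z)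
    (hi : IntegrableOn (fun z => D z * ψ z) U) :
    ∫ z in U, (V₁ z * fderiv ℝ ψ z 1 + V₂ z * fderiv ℝ ψ z Complex.I)
      = -∫ z in U, D z * ψ z := by
  have hψd : ∀ z, DifferentiableAt ℝ ψ z := fun z => (hψ.differentiable one_ne_zero) z
  have hψc : Continuous (fderiv ℝ ψ) := hψ.continuous_fderiv one_ne_zero
  have supp : ∀ V : ℂ → ℂ, tsupport (fun z => V z * ψ z) ⊆ tsupport ψ := fun V =>
    closure_mono fun z hz h0 => hz (by simp only [h0, mul_zero])
  have csupp : ∀ V : ℂ → ℂ, HasCompactSupport fun z => V z * ψ z := fun V => cψ.mul_left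
  have cont : ∀ {V : ℂ → ℂ}, ContinuousOn V U → Continuous fun z => V z * ψ z := fun hV =>
    (hV.mul hψ.continuous.continuousOn).continuous_of_tsupport_subset hU ((supp _).trans sψ)
  have hprod : ∀ {V : ℂ → ℂ} {z : ℂ} (v : ℂ), DifferentiableAt ℝ V z →
      fderiv ℝ (fun w => V w * ψ w) z v = V z * fderiv ℝ ψ z v + fderiv ℝ V z v * ψ z := by
    intro V z v hV
    rw [(hV.hasFDerivAt.fun_mul (hψd z).hasFDerivAt).fderiv]
    simp; ring
  have hout : ∀ {V : ℂ → ℂ} {z : ℂ}, z ∉ U →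
      HasFDerivAt (𝕜 := ℝ) (fun w => V w * ψ w) 0 z := by
    intro V z hz
    have h0 : (fun w => V w * ψ w) =ᶠ[𝓝 z] fun _ => 0 :=
      notMem_tsupport_iff_eventuallyEq.1 fun h => hz (sψ (supp V h))
    exact (hasFDerivAt_const (0 : ℂ) z).congr_of_eventuallyEq h0
  have hdiff : ∀ {V : ℂ → ℂ}, (∀ z ∈ U, z ∉ S → DifferentiableAt ℝ V z) → ∀ z, z ∉ S →
      HasFDerivAt (fun w => V w * ψ w) (fderiv ℝ (fun w => V w * ψ w) z) z := by
    intro V hV z hz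
    by_cases hzU : z ∈ U
    · exact ((hV z hzU hz).fun_mul (hψd z)).hasFDerivAt
    · exact (hout hzU).differentiableAt.hasFDerivAt
  have i1 : IntegrableOn (fun z => V₁ z * fderiv ℝ ψ z 1 + V₂ z * fderiv ℝ ψ z Complex.I) U := by
    have aux : ∀ {V : ℂ → ℂ} (v : ℂ), ContinuousOn V U →
        Integrable fun z => V z * fderiv ℝ ψ z v := fun {V} v hV => by
      have hcs : tsupport (fun z => V z * fderiv ℝ ψ z v) ⊆ tsupport ψ := by
        refine (closure_mono ?_).trans (closure_minimal (support_fderiv_subset ℝ)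
          (isClosed_tsupport ψ))
        intro z hz h0
        exact hz (by simp [h0])
      have hc : Continuous fun z => V z * fderiv ℝ ψ z v := by
        refine ContinuousOn.continuous_of_tsupport_subset (s := U) ?_ hU (hcs.trans sψ)
        exact hV.mul (by fun_prop : Continuous fun z => fderiv ℝ ψ z v).continuousOn
      exact hc.integrable_of_hasCompactSupport
        (cψ.isCompact.of_isClosed_subset (isClosed_tsupport _) hcs)
    exact ((aux 1 h₁).add (aux Complex.I h₂)).integrableOn
  have hsum : ∀ z ∈ U, z ∉ S → fderiv ℝ (fun w => V₁ w * ψ w) z 1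
      + fderiv ℝ (fun w => V₂ w * ψ w) z Complex.I
      = V₁ z * fderiv ℝ ψ z 1 + V₂ z * fderiv ℝ ψ z Complex.I + D z * ψ z := by
    intro z hz hzS
    rw [hprod _ (d₁ z hz hzS), hprod _ (d₂ z hz hzS), ← hD z hz hzS]; ring
  have hae : ∀ᵐ z ∂(volume.restrict U), fderiv ℝ (fun w => V₁ w * ψ w) z 1
      + fderiv ℝ (fun w => V₂ w * ψ w) z Complex.I
      = V₁ z * fderiv ℝ ψ z 1 + V₂ z * fderiv ℝ ψ z Complex.I + D z * ψ z := by
    filter_upwards [ae_restrict_mem hU.measurableSet, ae_restrict_of_ae (hS.ae_notMem volume)]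
      with z hz hzS using hsum z hz hzS
  have hzero : ∀ z, z ∉ U → fderiv ℝ (fun w => V₁ w * ψ w) z 1
      + fderiv ℝ (fun w => V₂ w * ψ w) z Complex.I = 0 := fun z hz => by
    rw [(hout hz).fderiv, (hout hz).fderiv]; simp
  have iU : IntegrableOn (fun z => fderiv ℝ (fun w => V₁ w * ψ w) z 1
      + fderiv ℝ (fun w => V₂ w * ψ w) z Complex.I) U :=
    (i1.add hi).congr (hae.mono fun z hz => hz.symm)
  have key := integral_div_eq_zero hS (cont h₁) (cont h₂) (csupp V₁) (csupp V₂) (hdiff d₁) (hdiff d₂)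
    ((integrableOn_iff_integrable_of_support_subset fun z hz => by
      by_contra h; exact hz (hzero z h)).1 iU)
  rw [← setIntegral_eq_integral_of_forall_compl_eq_zero hzero, integral_congr_ae hae,
    integral_add i1 hi] at key
  linear_combination key

/-- The vortex map `F / |F|` with `F = flatSine`, extended by `1` at the zeros. -/
noncomputable def vortex (z : ℂ) : ℂ :=
  if flatSine z = 0 then 1 else flatSine z / (‖flatSine z‖ : ℂ)

/-- The gradient of `vortex`. -/
noncomputable def vortexGrad (z : ℂ) : ℂ × ℂ :=
  (Complex.I * vortex z * (flatLogDeriv z).im, Complex.I * vortex z * (flatLogDeriv z).re)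

theorem norm_vortex (z : ℂ) : ‖vortex z‖ = 1 := by
  unfold vortex
  split_ifs with h
  · simp
  · simp [h]

theorem conj_vortex_mul (z : ℂ) : conj (vortex z) * vortex z = 1 := by
  rw [← Complex.normSq_eq_conj_mul_self, Complex.normSq_eq_norm_sq, norm_vortex]; simp

theorem continuousAt_vortex {z : ℂ} (hz : z.re < 1) (h0 : flatSine z ≠ 0) :
    ContinuousAt vortex z := by
  have hc := (hasDerivAt_flatSine hz).continuousAt
  have h1 : vortex =ᶠ[𝓝 z] fun w => flatSine w / (‖flatSine w‖ : ℂ) := by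
    filter_upwards [hc.eventually_ne h0] with w hw
    simp [vortex, hw]
  refine ContinuousAt.congr ?_ h1.symm
  exact hc.div (Complex.continuous_ofReal.continuousAt.comp hc.norm) (by simpa using h0)

theorem norm_vortexGrad_le (z : ℂ) : ‖vortexGrad z‖ ≤ ‖flatLogDeriv z‖ := by
  simp only [vortexGrad, Prod.norm_def, norm_mul, Complex.norm_I, norm_vortex, one_mul,
    Complex.norm_real, Real.norm_eq_abs, sup_le_iff]
  exact ⟨Complex.abs_im_le_norm _, Complex.abs_re_le_norm _⟩

theorem measurable_vortex : Measurable vortex := by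
  have h := measurable_flatSine
  refine Measurable.ite (h (measurableSet_singleton 0)) measurable_const ?_
  exact h.div (Complex.measurable_ofReal.comp h.norm)

theorem measurable_vortexGrad : Measurable vortexGrad := by
  have h := measurable_flatLogDeriv
  have hv := measurable_vortex
  unfold vortexGrad
  fun_prop

theorem memLp_vortexGrad {p : ℝ≥0∞} (hp : p < 2) :
    MemLp vortexGrad p (volume.restrict unitDisc) :=
  (memLp_flatLogDeriv hp).mono measurable_vortexGrad.aestronglyMeasurable
    (Eventually.of_forall norm_vortexGrad_le)

theorem memLp_vortex (p : ℝ≥0∞) : MemLp vortex p (volume.restrict unitDisc) :=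
  MemLp.of_bound measurable_vortex.aestronglyMeasurable 1
    (Eventually.of_forall fun z => (norm_vortex z).le)

theorem integrableOn_flatLogDeriv : IntegrableOn flatLogDeriv unitDisc :=
  memLp_one_iff_integrable.1 (memLp_flatLogDeriv (by norm_num))

theorem integrableOn_vortexGrad : IntegrableOn vortexGrad unitDisc :=
  memLp_one_iff_integrable.1 (memLp_vortexGrad (by norm_num))

/-- The continuous regularization `F |F|^(ε-1)` of `vortex`. -/
noncomputable def vortexReg (ε : ℝ) (z : ℂ) : ℂ :=
  flatSine z * ((‖flatSine z‖ ^ (ε - 1) : ℝ) : ℂ)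

theorem norm_vortexReg {ε : ℝ} (hε : 0 < ε) (z : ℂ) : ‖vortexReg ε z‖ = ‖flatSine z‖ ^ ε := by
  rw [vortexReg, norm_mul, Complex.norm_real, Real.norm_of_nonneg (by positivity), mul_comm,
    ← Real.rpow_add_one' (norm_nonneg _) (by simpa using hε.ne'), sub_add_cancel]

theorem continuousOn_vortexReg {ε : ℝ} (hε : 0 < ε) :
    ContinuousOn (vortexReg ε) {z | z.re < 1} := by
  intro z hz
  refine ContinuousAt.continuousWithinAt ?_
  have hc := (hasDerivAt_flatSine hz).continuousAt
  by_cases h0 : flatSine z = 0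
  · rw [ContinuousAt, show vortexReg ε z = 0 by simp [vortexReg, h0],
      tendsto_zero_iff_norm_tendsto_zero]
    simp only [norm_vortexReg hε]
    have := (hc.norm.rpow_const (Or.inr hε.le : ‖flatSine z‖ ≠ 0 ∨ 0 ≤ ε)).tendsto
    rwa [h0, norm_zero, Real.zero_rpow hε.ne'] at this
  · exact hc.mul (Complex.continuous_ofReal.continuousAt.comp
      (hc.norm.rpow_const (Or.inl (by simpa using h0))))

theorem hasWirtingerAt_vortexReg (ε : ℝ) {z : ℂ} (hz : z.re < 1) (h0 : flatSine z ≠ 0) :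
    HasWirtingerAt (vortexReg ε) ((1 + ε) / 2 * flatLogDeriv z * vortexReg ε z)
      (-((1 - ε) / 2) * conj (flatLogDeriv z) * vortexReg ε z) z := by
  have hd := hasDerivAt_flatSine hz
  have := (HasWirtingerAt.of_hasDerivAt hd).mul (hasWirtingerAt_norm_rpow hd h0 (ε - 1))
  refine HasWirtingerAt.congr this ?_ ?_
  · simp only [vortexReg, flatLogDeriv]
    push_cast
    field_simp
    ring
  · simp only [vortexReg, flatLogDeriv]
    push_cast
    ring

theorem tendsto_vortexReg {z : ℂ} (h0 : flatSine z ≠ 0) :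
    Tendsto (fun ε => vortexReg ε z) (𝓝[>] 0) (𝓝 (vortex z)) := by
  have hpos : 0 < ‖flatSine z‖ := norm_pos_iff.2 h0
  have h1 : Continuous fun ε : ℝ => vortexReg ε z := by
    unfold vortexReg
    refine continuous_const.mul (Complex.continuous_ofReal.comp ?_)
    exact Continuous.rpow continuous_const (by fun_prop) fun _ => Or.inl hpos.ne'
  have h2 := (h1.tendsto 0).mono_left (nhdsWithin_le_nhds (s := Ioi 0))
  have e : vortexReg 0 z = vortex z := by
    simp [vortexReg, vortex, h0, Real.rpow_neg_one, div_eq_mul_inv]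
  rwa [e] at h2

theorem countable_range_cuspPoint : (range cuspPoint).Countable := countable_range _

theorem flatSine_ne_zero {z : ℂ} (hz : z ∈ unitDisc) (h : z ∉ range cuspPoint) : flatSine z ≠ 0 :=
  fun h0 => h ((flatSine_eq_zero_iff hz).1 h0)

/-- The map F|F|^(ε-1) is continuous across the zeros, so integration by parts off this countable
set yields no extra term. As ε → 0 both sides converge by dominated convergence with the integrable
majorant |F'/F|, up to constants. -/
theorem hasWeakGrad_vortex : HasWeakGrad unitDisc vortex vortexGrad := by
  have hvi : IntegrableOn vortex unitDisc := memLp_one_iff_integrable.1 (memLp_vortex 1)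
  refine ⟨hvi.locallyIntegrableOn,
    integrableOn_vortexGrad.locallyIntegrableOn, fun ψ => ?_⟩
  have hψ : ContDiff ℝ 1 ψ := ψ.contDiff.of_le (by exact_mod_cast le_top)
  have hψc : Continuous (fderiv ℝ ψ) := hψ.continuous_fderiv one_ne_zero
  obtain ⟨B, hB0, hB⟩ : ∃ B : ℝ, 1 ≤ B ∧ ∀ z ∈ unitDisc, ‖flatSine z‖ ≤ B := by
    obtain ⟨C, hC⟩ := flatAlgebra_bounded flatSine_mem
    exact ⟨max C 1, le_max_right _ _, fun z hz =>
      (hC z (re_lt_one_of_mem_unitDisc hz).le).trans (le_max_left _ _)⟩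
  have hreg : ∀ ε ∈ Ioo (0 : ℝ) 1, ∀ z ∈ unitDisc, ‖vortexReg ε z‖ ≤ B := by
    intro ε hε z hz
    rw [norm_vortexReg hε.1]
    calc ‖flatSine z‖ ^ ε ≤ B ^ ε := Real.rpow_le_rpow (norm_nonneg _) (hB z hz) hε.1.le
      _ ≤ B ^ (1 : ℝ) := Real.rpow_le_rpow_of_exponent_le hB0 hε.2.le
      _ = B := Real.rpow_one B
  have hIoo : Ioo (0 : ℝ) 1 ∈ 𝓝[>] (0 : ℝ) := Ioo_mem_nhdsGT one_pos
  have hmeasD : MeasurableSet (unitDisc : Set ℂ) := unitDisc.isOpen.measurableSet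
  have hmeasReg : ∀ ε, Measurable (vortexReg ε) := fun ε => by
    have := measurable_flatSine
    unfold vortexReg
    fun_prop
  have hsub : (unitDisc : Set ℂ) ⊆ {z | z.re < 1} := fun z hz => re_lt_one_of_mem_unitDisc hz
  obtain ⟨Mψ, hMψ⟩ := ψ.continuous.bounded_above_of_compact_support ψ.hasCompactSupport
  have lim1 : ∀ v : ℂ, Tendsto (fun ε => ∫ z in unitDisc, vortexReg ε z * fderiv ℝ ψ z v) (𝓝[>] 0)
      (𝓝 (∫ z in unitDisc, vortex z * fderiv ℝ ψ z v)) := by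
    intro v
    have hcv : Continuous fun z => fderiv ℝ ψ z v := by fun_prop
    have hcs : HasCompactSupport fun z => fderiv ℝ ψ z v :=
      (ψ.hasCompactSupport.fderiv ℝ).mono fun z hz h0 => hz (by simp [h0])
    refine tendsto_integral_filter_of_dominated_convergence (fun z => B * ‖fderiv ℝ ψ z v‖)
      (Eventually.of_forall fun ε =>
        ((hmeasReg ε).mul hcv.measurable).aestronglyMeasurable) ?_
      ((hcv.integrable_of_hasCompactSupport hcs).norm.const_mul B).integrableOn ?_
    · filter_upwards [hIoo] with ε hε
      filter_upwards [ae_restrict_mem hmeasD] with z hz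
      rw [norm_mul]
      gcongr
      exact hreg ε hε z hz
    · filter_upwards [ae_restrict_mem hmeasD,
        ae_restrict_of_ae (countable_range_cuspPoint.ae_notMem volume)] with z hz hzS
      exact (tendsto_vortexReg (flatSine_ne_zero hz hzS)).mul_const _
  -- Each directional derivative of the regularization is the regularization times a factor Dε. With
  -- h = F'/F, the factors are i Im h + ε Re h and i(Re h + iε Im h), both at most 2|h|.
  have lim2 : ∀ (Dε : ℝ → ℂ → ℂ) (d : ℂ → ℂ), (∀ ε, Measurable (Dε ε)) →
      (∀ ε ∈ Ioo (0 : ℝ) 1, ∀ z ∈ unitDisc, ‖Dε ε z‖ ≤ 2 * ‖flatLogDeriv z‖) →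
      (∀ z, Tendsto (fun ε => Dε ε z) (𝓝[>] 0) (𝓝 (d z))) →
      (∀ ε ∈ Ioo (0 : ℝ) 1, IntegrableOn (fun z => Dε ε z * vortexReg ε z * ψ z) unitDisc) ∧
      Tendsto (fun ε => ∫ z in unitDisc, Dε ε z * vortexReg ε z * ψ z) (𝓝[>] 0)
        (𝓝 (∫ z in unitDisc, d z * vortex z * ψ z)) := by
    intro Dε d hm hb ht
    have hbound : ∀ ε ∈ Ioo (0 : ℝ) 1, ∀ z ∈ unitDisc,
        ‖Dε ε z * vortexReg ε z * ψ z‖ ≤ 2 * ‖flatLogDeriv z‖ * (B * Mψ) := by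
      intro ε hε z hz
      rw [norm_mul, norm_mul, mul_assoc]
      gcongr
      · exact hb ε hε z hz
      · exact hreg ε hε z hz
      · exact hMψ z
    have hbi : IntegrableOn (fun z => 2 * ‖flatLogDeriv z‖ * (B * Mψ)) unitDisc :=
      (integrableOn_flatLogDeriv.norm.const_mul 2).mul_const _
    have hms : ∀ ε, AEStronglyMeasurable (fun z => Dε ε z * vortexReg ε z * ψ z)
        (volume.restrict unitDisc) := fun ε =>
      (((hm ε).mul (hmeasReg ε)).mul ψ.continuous.measurable).aestronglyMeasurable
    refine ⟨fun ε hε => hbi.mono' (hms ε) ?_, ?_⟩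
    · filter_upwards [ae_restrict_mem hmeasD] with z hz using hbound ε hε z hz
    · refine tendsto_integral_filter_of_dominated_convergence _ (Eventually.of_forall hms) ?_ hbi ?_
      · filter_upwards [hIoo] with ε hε
        filter_upwards [ae_restrict_mem hmeasD] with z hz using hbound ε hε z hz
      · filter_upwards [ae_restrict_mem hmeasD,
          ae_restrict_of_ae (countable_range_cuspPoint.ae_notMem volume)] with z hz hzS
        exact ((ht z).mul (tendsto_vortexReg (flatSine_ne_zero hz hzS))).mul_const _
  have hcε : Tendsto (fun ε : ℝ => (ε : ℂ)) (𝓝[>] 0) (𝓝 0) := by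
    have := (Complex.continuous_ofReal.tendsto 0).mono_left (nhdsWithin_le_nhds (s := Ioi 0))
    simpa using this
  have hmL := measurable_flatLogDeriv
  have hW := fun (ε : ℝ) (z : ℂ) (hz : z ∈ (unitDisc : Set ℂ)) (hzS : z ∉ range cuspPoint) =>
    hasWirtingerAt_vortexReg ε (hsub hz) (flatSine_ne_zero hz hzS)
  have hab : ∀ ε ∈ Ioo (0 : ℝ) 1, ∀ z : ℂ, ‖(ε : ℂ) * z.re‖ ≤ ‖z‖ ∧ ‖(ε : ℂ) * z.im‖ ≤ ‖z‖ := by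
    intro ε hε z
    rw [norm_mul, norm_mul, Complex.norm_real, Complex.norm_real, Complex.norm_real,
      Real.norm_of_nonneg hε.1.le]
    have h1 := Complex.abs_re_le_norm z
    have h2 := Complex.abs_im_le_norm z
    constructor
    · calc ε * ‖z.re‖ ≤ 1 * ‖z.re‖ := by gcongr; exact hε.2.le
        _ ≤ ‖z‖ := by rw [one_mul]; exact h1
    · calc ε * ‖z.im‖ ≤ 1 * ‖z.im‖ := by gcongr; exact hε.2.le
        _ ≤ ‖z‖ := by rw [one_mul]; exact h2
  have hri : ∀ z : ℂ, z = z.re + z.im * Complex.I ∧ conj z = z.re - z.im * Complex.I := fun z =>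
    ⟨(Complex.re_add_im z).symm, by apply Complex.ext <;> simp⟩
  constructor
  · obtain ⟨hInt, hlim⟩ := lim2
      (fun ε z => Complex.I * (flatLogDeriv z).im + ε * (flatLogDeriv z).re)
      (fun z => Complex.I * (flatLogDeriv z).im) (fun ε => by fun_prop) (fun ε hε z _ => by
        refine (norm_add_le _ _).trans ?_
        have h1 := (hab ε hε (flatLogDeriv z)).1
        have h2 : ‖Complex.I * ((flatLogDeriv z).im : ℂ)‖ ≤ ‖flatLogDeriv z‖ := by
          rw [norm_mul, Complex.norm_I, one_mul, Complex.norm_real]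
          exact Complex.abs_im_le_norm _
        linarith) (fun z => by
        simpa using (hcε.mul_const ((flatLogDeriv z).re : ℂ)).const_add
          (Complex.I * ((flatLogDeriv z).im : ℂ)))
    refine tendsto_nhds_unique (lim1 1) ?_
    have e : ∀ z, (vortexGrad z).1 * ψ z = Complex.I * (flatLogDeriv z).im * vortex z * ψ z :=
      fun z => by simp only [vortexGrad]; ring
    simp only [e]
    refine hlim.neg.congr' ?_
    filter_upwards [hIoo] with ε hε
    have := setIntegral_field_mul_fderiv unitDisc.isOpen countable_range_cuspPoint hψ
      ψ.hasCompactSupport ψ.tsupport_subset ((continuousOn_vortexReg hε.1).mono hsub)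
      (V₂ := fun _ => 0) continuousOn_const (fun z hz hzS => (hW ε z hz hzS).differentiableAt)
      (fun _ _ _ => differentiableAt_const _) (fun z hz hzS => ?_) (hInt ε hε)
    · rw [← this]; simp
    · rw [(hW ε z hz hzS).fderiv_one]
      obtain ⟨h1, h2⟩ := hri (flatLogDeriv z)
      rw [h2]
      simp only [hasFDerivAt_const (0 : ℂ) z |>.fderiv, zero_apply, add_zero]
      linear_combination (1 + (ε : ℂ)) / 2 * vortexReg ε z * h1
  · obtain ⟨hInt, hlim⟩ := lim2
      (fun ε z => Complex.I * ((flatLogDeriv z).re + ε * (flatLogDeriv z).im * Complex.I))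
      (fun z => Complex.I * (flatLogDeriv z).re) (fun ε => by fun_prop) (fun ε hε z _ => by
        rw [norm_mul, Complex.norm_I, one_mul]
        refine (norm_add_le _ _).trans ?_
        have h1 := (hab ε hε (flatLogDeriv z)).2
        have h2 : ‖((flatLogDeriv z).re : ℂ)‖ ≤ ‖flatLogDeriv z‖ := by
          rw [Complex.norm_real]
          exact Complex.abs_re_le_norm _
        rw [norm_mul _ Complex.I, Complex.norm_I, mul_one]
        linarith) (fun z => by
        simpa using (((hcε.mul_const ((flatLogDeriv z).im : ℂ)).mul_const Complex.I).const_add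
          ((flatLogDeriv z).re : ℂ)).const_mul Complex.I)
    refine tendsto_nhds_unique (lim1 Complex.I) ?_
    have e : ∀ z, (vortexGrad z).2 * ψ z = Complex.I * (flatLogDeriv z).re * vortex z * ψ z :=
      fun z => by simp only [vortexGrad]; ring
    simp only [e]
    refine hlim.neg.congr' ?_
    filter_upwards [hIoo] with ε hε
    have := setIntegral_field_mul_fderiv unitDisc.isOpen countable_range_cuspPoint hψ
      ψ.hasCompactSupport ψ.tsupport_subset (V₁ := fun _ => 0) continuousOn_const
      ((continuousOn_vortexReg hε.1).mono hsub) (fun _ _ _ => differentiableAt_const _)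
      (fun z hz hzS => (hW ε z hz hzS).differentiableAt) (fun z hz hzS => ?_) (hInt ε hε)
    · rw [← this]; simp
    · rw [(hW ε z hz hzS).fderiv_I]
      obtain ⟨h1, h2⟩ := hri (flatLogDeriv z)
      rw [h2]
      simp only [hasFDerivAt_const (0 : ℂ) z |>.fderiv, zero_apply, zero_add]
      linear_combination Complex.I * (1 + (ε : ℂ)) / 2 * vortexReg ε z * h1

theorem memW1p_vortex {p : ℝ≥0∞} (hp : p < 2) : MemW1p unitDisc p vortex vortexGrad :=
  ⟨hasWeakGrad_vortex, memLp_vortex p, memLp_vortexGrad hp⟩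

theorem memW1WeakL2Loc_vortex : MemW1WeakL2Loc unitDisc vortex vortexGrad := by
  refine ⟨hasWeakGrad_vortex, measurable_vortexGrad.aestronglyMeasurable, fun K hK hKU => ?_⟩
  obtain ⟨C, hC⟩ := exists_volume_flatLogDeriv_le hK hKU
  refine ⟨C, fun t ht => le_trans (measure_mono ?_) (hC t ht)⟩
  exact fun z hz => ⟨hz.1, hz.2.trans_le (norm_vortexGrad_le z)⟩

/-! ### The two divergence equations for the vortex map -/

/-- The zeros are divided out one at a time: the cofactor vanishes at the next zero because the
points are distinct, and its difference quotient is again holomorphic. -/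
theorem exists_flatSine_eq_prod_mul (N : ℕ) : ∃ G : ℂ → ℂ, DifferentiableOn ℂ G {z | z.re < 1} ∧
    ∀ z : ℂ, z.re < 1 → flatSine z = (∏ k ∈ Finset.range N, (z - cuspPoint k)) * G z := by
  induction N with
  | zero => exact ⟨flatSine, differentiableOn_flatSine, fun z _ => by simp⟩
  | succ N ih =>
    obtain ⟨G, hG, hF⟩ := ih
    have hN := re_lt_one_of_mem_unitDisc (cuspPoint_mem N)
    have hG0 : G (cuspPoint N) = 0 := by
      have h := hF _ hN
      rw [flatSine_cuspPoint] at h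
      refine (mul_eq_zero.1 h.symm).resolve_left ?_
      refine Finset.prod_ne_zero_iff.2 ?_
      intro k hk hk0
      have := cuspPoint_injective (sub_eq_zero.1 hk0)
      rw [Finset.mem_range] at hk
      omega
    refine ⟨dslope G (cuspPoint N),
      (Complex.differentiableOn_dslope (isOpen_re_lt_one.mem_nhds hN)).2 hG, fun z hz => ?_⟩
    have h1 := sub_smul_dslope G (cuspPoint N) z
    rw [hG0, sub_zero, smul_eq_mul] at h1
    rw [hF z hz, Finset.prod_range_succ, mul_assoc, h1]

theorem exists_forall_cuspPoint_notMem {K : Set ℂ} (hK : IsClosed K) (h1 : (1 : ℂ) ∉ K) :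
    ∃ N : ℕ, ∀ k, N ≤ k → cuspPoint k ∉ K :=
  eventually_atTop.1 (tendsto_cuspPoint.eventually (hK.isOpen_compl.mem_nhds h1))

theorem one_notMem_unitDisc : (1 : ℂ) ∉ unitDisc := fun h => by
  have := re_lt_one_of_mem_unitDisc h
  simp at this

/-- The logarithmic derivative of `flatSine` satisfies `∂̄ (F'/F) = π ∑ δ_{p_k}`. -/
theorem setIntegral_flatLogDeriv_mul_dbar {ψ : ℂ → ℂ} (hψ : ContDiff ℝ 1 ψ)
    (cψ : HasCompactSupport ψ) (sψ : tsupport ψ ⊆ unitDisc) :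
    ∫ z in unitDisc, flatLogDeriv z * (fderiv ℝ ψ z 1 + Complex.I * fderiv ℝ ψ z Complex.I)
      = -(2 * Real.pi) * ∑' k, ψ (cuspPoint k) := by
  obtain ⟨N, hN⟩ := exists_forall_cuspPoint_notMem (isClosed_tsupport ψ)
    fun h => one_notMem_unitDisc (sψ h)
  obtain ⟨G, hG, hFG⟩ := exists_flatSine_eq_prod_mul N
  set Q : ℂ → ℂ := fun z => ∏ k ∈ Finset.range N, (z - cuspPoint k) with hQ
  have hGd : ∀ z : ℂ, z.re < 1 → DifferentiableAt ℂ G z := fun z hz =>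
    hG.differentiableAt (isOpen_re_lt_one.mem_nhds hz)
  have hQd : Differentiable ℂ Q := by
    rw [hQ]
    exact Differentiable.fun_finsetProd fun k _ => differentiable_id.sub_const _
  have hFder : ∀ z : ℂ, z.re < 1 → flatSineDeriv z = deriv Q z * G z + Q z * deriv G z := by
    intro z hz
    have h1 := (hQd z).hasDerivAt.mul (hGd z hz).hasDerivAt
    have h2 : flatSine =ᶠ[𝓝 z] fun w => Q w * G w := by
      filter_upwards [isOpen_re_lt_one.mem_nhds hz] with w hw using hFG w hw
    exact (hasDerivAt_flatSine hz).unique (h1.congr_of_eventuallyEq h2)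
  -- A zero of G on the support would be a p_k with k < N, hence a double zero of F; but the zeros
  -- are simple.
  have hG0 : ∀ z ∈ tsupport ψ, G z ≠ 0 := by
    intro z hz h0
    have hzr := re_lt_one_of_mem_unitDisc (sψ hz)
    have hF0 : flatSine z = 0 := by rw [hFG z hzr, h0, mul_zero]
    obtain ⟨k, rfl⟩ := (flatSine_eq_zero_iff (sψ hz)).1 hF0
    have hkN : k < N := by
      by_contra h
      exact hN k (not_lt.1 h) hz
    have hQ0 : Q (cuspPoint k) = 0 := Finset.prod_eq_zero (Finset.mem_range.2 hkN) (sub_self _)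
    have := flatSineDeriv_cuspPoint_ne_zero k
    rw [hFder _ hzr, h0, hQ0] at this
    simp at this
  set U : Set ℂ := {z | z.re < 1} ∩ G ⁻¹' {0}ᶜ with hUdef
  have hU : IsOpen U :=
    hG.continuousOn.isOpen_inter_preimage isOpen_re_lt_one isOpen_compl_singleton
  have sU : tsupport ψ ⊆ U := fun z hz => ⟨re_lt_one_of_mem_unitDisc (sψ hz), hG0 z hz⟩
  set H : ℂ → ℂ := fun z => deriv G z / G z with hH
  have hHd : ∀ z ∈ U, DifferentiableAt ℂ H z := fun z hz =>
    ((hG.deriv isOpen_re_lt_one).differentiableAt (isOpen_re_lt_one.mem_nhds hz.1)).div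
      (hGd z hz.1) hz.2
  have hHW := fun z hz => HasWirtingerAt.of_hasDerivAt (hHd z hz).hasDerivAt
  have hHc : ContinuousOn H U := fun z hz => (hHd z hz).continuousAt.continuousWithinAt
  set D : ℂ → ℂ := fun z => fderiv ℝ ψ z 1 + Complex.I * fderiv ℝ ψ z Complex.I with hD
  have hψc : Continuous (fderiv ℝ ψ) := hψ.continuous_fderiv one_ne_zero
  have hDc : Continuous D := by fun_prop
  have hD0 : ∀ z, z ∉ tsupport ψ → D z = 0 := fun z hz => by
    have : fderiv ℝ ψ z = 0 := by
      by_contra h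
      exact hz ((closure_minimal (support_fderiv_subset ℝ) (isClosed_tsupport ψ))
        (subset_tsupport _ h))
    simp [hD, this]
  have hDs : tsupport D ⊆ tsupport ψ :=
    closure_minimal (fun z hz => by by_contra h; exact hz (hD0 z h)) (isClosed_tsupport ψ)
  have cD : HasCompactSupport D :=
    cψ.isCompact.of_isClosed_subset (isClosed_tsupport _) hDs
  have hHD : Continuous fun z => H z * D z := by
    refine (hHc.mul hDc.continuousOn).continuous_of_tsupport_subset hU ?_
    refine (closure_minimal (fun z hz => ?_) (isClosed_tsupport ψ)).trans sU
    by_contra h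
    exact hz (by simp [hD0 z h])
  have iH : Integrable fun z => H z * D z := hHD.integrable_of_hasCompactSupport cD.mul_left
  have iP : ∀ k : ℕ, Integrable fun z => (z - cuspPoint k)⁻¹ * D z := fun k =>
    (integrable_div_sub hDc cD (cuspPoint k)).mono'
      ((by fun_prop : Measurable fun z : ℂ => (z - cuspPoint k)⁻¹).mul
        hDc.measurable).aestronglyMeasurable
      (Eventually.of_forall fun z => by simp)
  -- G'/G is holomorphic near the support, so it pairs to zero with ∂̄ψ; only the poles 1/(z - p_k)
  -- contribute.
  have hH0 : ∫ z, H z * D z = 0 := by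
    have := setIntegral_field_mul_fderiv hU countable_empty hψ cψ sU hHc (V₂ := fun z => Complex.I * H z)
      (continuousOn_const.mul hHc) (fun z hz _ => (hHW z hz).differentiableAt)
      (fun z hz _ => ((hHW z hz).const_mul Complex.I).differentiableAt) (D := fun _ => 0)
      (fun z hz _ => by
        rw [(hHW z hz).fderiv_one, ((hHW z hz).const_mul Complex.I).fderiv_I]
        linear_combination (deriv H z) * Complex.I_mul_I) (by simp)
    simp only [zero_mul, integral_zero, neg_zero] at this
    rw [← setIntegral_eq_integral_of_forall_compl_eq_zero (s := U) fun z hz => by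
      rw [hD0 z fun h => hz (sU h), mul_zero], ← this]
    refine integral_congr_ae (Eventually.of_forall fun z => ?_)
    simp only [hD]; ring
  have hae : ∀ᵐ z : ℂ, flatLogDeriv z * D z
      = (∑ k ∈ Finset.range N, (z - cuspPoint k)⁻¹ * D z) + H z * D z := by
    filter_upwards [countable_range_cuspPoint.ae_notMem volume] with z hzS
    by_cases hz : z ∈ tsupport ψ
    · have hzr := re_lt_one_of_mem_unitDisc (sψ hz)
      have hne : ∀ k ∈ Finset.range N, z - cuspPoint k ≠ 0 := fun k _ h =>
        hzS ⟨k, (sub_eq_zero.1 h).symm⟩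
      have hQ0 : Q z ≠ 0 := Finset.prod_ne_zero_iff.2 hne
      have hlog : deriv Q z / Q z = ∑ k ∈ Finset.range N, (z - cuspPoint k)⁻¹ := by
        have := logDeriv_prod (𝕜 := ℂ) (f := fun k w => w - cuspPoint k) hne
          fun k _ => differentiableAt_id.sub_const _
        rw [logDeriv_apply] at this
        rw [this]
        refine Finset.sum_congr rfl fun k _ => ?_
        rw [logDeriv_apply, deriv_sub_const, deriv_id'', one_div]
      have : flatLogDeriv z = (∑ k ∈ Finset.range N, (z - cuspPoint k)⁻¹) + H z := by
        rw [← hlog, flatLogDeriv, hFder z hzr, hFG z hzr]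
        have := hG0 z hz
        change _ / (Q z * G z) = _ + deriv G z / G z
        field_simp
      rw [this, add_mul, Finset.sum_mul]
    · simp [hD0 z hz]
  have hN0 : ∀ k, k ∉ Finset.range N → ψ (cuspPoint k) = 0 := fun k hk =>
    image_eq_zero_of_notMem_tsupport (hN k (by simpa using hk))
  rw [setIntegral_eq_integral_of_forall_compl_eq_zero fun z hz => by
    change _ * D z = 0
    rw [hD0 z fun h => hz (sψ h), mul_zero]]
  change ∫ z, flatLogDeriv z * D z = _
  rw [integral_congr_ae hae, integral_add (integrable_finsetSum _ fun k _ => iP k) iH, hH0, add_zero,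
    integral_finsetSum _ fun k _ => iP k, tsum_eq_sum hN0, Finset.mul_sum]
  exact Finset.sum_congr rfl fun k _ => integral_inv_sub_mul_dbar hψ cψ (cuspPoint k)

/-- The conjugate of the preceding identity, applied to ψ̄. -/
theorem setIntegral_conj_flatLogDeriv_mul_d {ψ : ℂ → ℂ} (hψ : ContDiff ℝ 1 ψ)
    (cψ : HasCompactSupport ψ) (sψ : tsupport ψ ⊆ unitDisc) :
    ∫ z in unitDisc, conj (flatLogDeriv z) * (fderiv ℝ ψ z 1 - Complex.I * fderiv ℝ ψ z Complex.I)
      = -(2 * Real.pi) * ∑' k, ψ (cuspPoint k) := by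
  have hsup : Function.support (fun z => conj (ψ z)) ⊆ Function.support ψ := fun z hz h0 =>
    hz (by simp [h0])
  have h1 := setIntegral_flatLogDeriv_mul_dbar (ψ := fun z => conj (ψ z))
    (Complex.conjCLE.contDiff.comp hψ) (cψ.mono hsup) ((closure_mono hsup).trans sψ)
  have h2 := congrArg conj h1
  rw [← integral_conj, map_mul, Complex.conj_tsum] at h2
  simp only [map_mul, map_neg, Complex.conj_ofReal, Complex.conj_conj, map_ofNat] at h2
  rw [← h2]
  refine integral_congr_ae (Eventually.of_forall fun z => ?_)
  have hd : ∀ v, fderiv ℝ (fun z => conj (ψ z)) z v = conj (fderiv ℝ ψ z v) := fun v => by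
    have := (Complex.conjCLE : ℂ →L[ℝ] ℂ).hasFDerivAt.comp z
      ((hψ.differentiable one_ne_zero) z).hasFDerivAt
    rw [show (fun z => conj (ψ z)) = (Complex.conjCLE : ℂ →L[ℝ] ℂ) ∘ ψ from rfl, this.fderiv]
    rfl
  simp only [hd, map_add, map_mul, Complex.conj_conj, Complex.conj_I]
  ring

theorem integrableOn_flatLogDeriv_mul {φ : ℂ → ℂ} (hφ : Continuous φ) (cφ : HasCompactSupport φ) :
    IntegrableOn (fun z => flatLogDeriv z * φ z) unitDisc ∧
      IntegrableOn (fun z => conj (flatLogDeriv z) * φ z) unitDisc := by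
  obtain ⟨C, hC⟩ := hφ.bounded_above_of_compact_support cφ
  refine ⟨integrableOn_flatLogDeriv.mul_bdd (c := C) hφ.aestronglyMeasurable
    (Eventually.of_forall hC), ?_⟩
  have : IntegrableOn (fun z => conj (flatLogDeriv z)) unitDisc :=
    Complex.conjCLE.toContinuousLinearMap.integrable_comp integrableOn_flatLogDeriv
  exact this.mul_bdd (c := C) hφ.aestronglyMeasurable (Eventually.of_forall hC)

theorem smul_vortexGrad (z : ℂ) : (Complex.I * conj (vortex z)) • vortexGrad z
    = (-((flatLogDeriv z).im : ℂ), -((flatLogDeriv z).re : ℂ)) := by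
  have h := conj_vortex_mul z
  have := Complex.I_mul_I
  refine Prod.ext ?_ ?_
  · simp only [vortexGrad, Prod.smul_fst, smul_eq_mul]
    linear_combination (flatLogDeriv z).im * (Complex.I * Complex.I) * h + (flatLogDeriv z).im * this
  · simp only [vortexGrad, Prod.smul_snd, smul_eq_mul]
    linear_combination (flatLogDeriv z).re * (Complex.I * Complex.I) * h + (flatLogDeriv z).re * this

theorem smul_perp_vortexGrad (z : ℂ) : (Complex.I * conj (vortex z)) • perp (vortexGrad z)
    = (((flatLogDeriv z).re : ℂ), -((flatLogDeriv z).im : ℂ)) := by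
  have h := smul_vortexGrad z
  have h1 := congrArg Prod.fst h
  have h2 := congrArg Prod.snd h
  simp only [Prod.smul_fst, Prod.smul_snd, smul_eq_mul] at h1 h2
  refine Prod.ext ?_ ?_
  · simp only [perp, Prod.smul_fst, smul_eq_mul]; linear_combination -h2
  · simp only [perp, Prod.smul_snd, smul_eq_mul]; exact h1

/-- Both divergences of g are such combinations: a = i/2, b = -i/2 gives the equation without
source, and a = b = 1/2 gives 2π ∑ δ_{p_k}. -/
theorem integral_test_pair (ψ : 𝓓(unitDisc, ℂ)) (a b : ℂ) :
    ∫ z in unitDisc, (a * (flatLogDeriv z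
        * (fderiv ℝ ψ z 1 + Complex.I * fderiv ℝ ψ z Complex.I))
      + b * (conj (flatLogDeriv z) * (fderiv ℝ ψ z 1 - Complex.I * fderiv ℝ ψ z Complex.I)))
      = -(2 * Real.pi) * (a + b) * ∑' k, ψ (cuspPoint k) := by
  have hψ : ContDiff ℝ 1 ψ := ψ.contDiff.of_le (by exact_mod_cast le_top)
  have hψc : Continuous (fderiv ℝ ψ) := hψ.continuous_fderiv one_ne_zero
  have hc : ∀ c : ℂ, HasCompactSupport fun z => fderiv ℝ ψ z 1 + c * fderiv ℝ ψ z Complex.I :=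
    fun c => (ψ.hasCompactSupport.fderiv ℝ).mono fun z hz h0 => hz (by simp [h0])
  have i1 := (integrableOn_flatLogDeriv_mul
    (by fun_prop : Continuous fun z => fderiv ℝ ψ z 1 + Complex.I * fderiv ℝ ψ z Complex.I)
    (hc Complex.I)).1
  have i2 := (integrableOn_flatLogDeriv_mul
    (by fun_prop : Continuous fun z => fderiv ℝ ψ z 1 + -Complex.I * fderiv ℝ ψ z Complex.I)
    (hc (-Complex.I))).2
  simp only [neg_mul, ← sub_eq_add_neg] at i2
  rw [integral_add (i1.const_mul a) (i2.const_mul b), integral_const_mul, integral_const_mul,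
    setIntegral_flatLogDeriv_mul_dbar hψ ψ.hasCompactSupport ψ.tsupport_subset,
    setIntegral_conj_flatLogDeriv_mul_d hψ ψ.hasCompactSupport ψ.tsupport_subset]
  ring

theorem locallyIntegrableOn_of_norm_le_flatLogDeriv {X : ℂ → ℂ × ℂ} (hm : Measurable X)
    (hX : ∀ z, ‖X z‖ ≤ ‖flatLogDeriv z‖) : LocallyIntegrableOn X unitDisc volume :=
  IntegrableOn.locallyIntegrableOn
    (Integrable.mono integrableOn_flatLogDeriv hm.aestronglyMeasurable (Eventually.of_forall hX))

theorem hasDistribDiv_vortexGrad :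
    HasDistribDiv unitDisc (fun z => (Complex.I * conj (vortex z)) • vortexGrad z) (fun _ => 0) := by
  have hm := measurable_flatLogDeriv
  simp only [smul_vortexGrad]
  refine ⟨locallyIntegrableOn_of_norm_le_flatLogDeriv (by fun_prop) fun z => ?_, fun ψ => ?_⟩
  · simp only [Prod.norm_def, norm_neg, Complex.norm_real, Real.norm_eq_abs, sup_le_iff]
    exact ⟨Complex.abs_im_le_norm _, Complex.abs_re_le_norm _⟩
  · rw [neg_eq_zero]
    have h := integral_test_pair ψ (Complex.I / 2) (-Complex.I / 2)
    rw [show Complex.I / 2 + -Complex.I / 2 = 0 by ring, mul_zero, zero_mul] at h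
    rw [← h]
    refine integral_congr_ae (Eventually.of_forall fun z => ?_)
    have h1 : flatLogDeriv z = (flatLogDeriv z).re + (flatLogDeriv z).im * Complex.I :=
      (Complex.re_add_im _).symm
    have h2 : conj (flatLogDeriv z) = (flatLogDeriv z).re - (flatLogDeriv z).im * Complex.I := by
      apply Complex.ext <;> simp
    have h3 := Complex.I_mul_I
    simp only [dot, grad]
    rw [h2]
    generalize flatLogDeriv z = w at *
    generalize fderiv ℝ ψ z 1 = s
    generalize fderiv ℝ ψ z Complex.I = t
    linear_combination (-(w.im : ℂ) * s - w.re * t) * h3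
      - Complex.I / 2 * (s + Complex.I * t) * h1

theorem hasDistribDiv_perp_vortexGrad :
    HasDistribDiv unitDisc (fun z => (Complex.I * conj (vortex z)) • perp (vortexGrad z))
      (fun ψ => 2 * Real.pi * ∑' k, ψ (cuspPoint k)) := by
  have hm := measurable_flatLogDeriv
  simp only [smul_perp_vortexGrad]
  refine ⟨locallyIntegrableOn_of_norm_le_flatLogDeriv (by fun_prop) fun z => ?_, fun ψ => ?_⟩
  · simp only [Prod.norm_def, norm_neg, Complex.norm_real, Real.norm_eq_abs, sup_le_iff]
    exact ⟨Complex.abs_re_le_norm _, Complex.abs_im_le_norm _⟩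
  · have h := integral_test_pair ψ (1 / 2) (1 / 2)
    rw [show (1 / 2 + 1 / 2 : ℂ) = 1 by norm_num, mul_one, neg_mul] at h
    rw [← neg_eq_iff_eq_neg] at h
    refine Eq.trans ?_ h
    congr 1
    refine integral_congr_ae (Eventually.of_forall fun z => ?_)
    have h1 : flatLogDeriv z = (flatLogDeriv z).re + (flatLogDeriv z).im * Complex.I :=
      (Complex.re_add_im _).symm
    have h2 : conj (flatLogDeriv z) = (flatLogDeriv z).re - (flatLogDeriv z).im * Complex.I := by
      apply Complex.ext <;> simp
    have h3 := Complex.I_mul_I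
    simp only [dot, grad]
    rw [h2]
    generalize flatLogDeriv z = w at *
    generalize fderiv ℝ ψ z 1 = s
    generalize fderiv ℝ ψ z Complex.I = t
    linear_combination (-(w.im : ℂ) * t) * h3 - 1 / 2 * (s + Complex.I * t) * h1

/-! ### The solution u and its equation -/

theorem HasWirtingerAt.add {f g : ℂ → ℂ} {a b a₁ b₁ z : ℂ} (h : HasWirtingerAt f a b z)
    (h₁ : HasWirtingerAt g a₁ b₁ z) :
    HasWirtingerAt (fun w => f w + g w) (a + a₁) (b + b₁) z := by
  refine HasFDerivAt.congr_fderiv (HasFDerivAt.fun_add h h₁) ?_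
  ext; simp; ring

/-- The Hölder exponent `√(j² + j) - j`. -/
noncomputable def holderExponent (j : ℕ) : ℝ := Real.sqrt ((j : ℝ) ^ 2 + j) - j

/-- The solution `F^j |F|^α` with `F = flatSine` and `j + α = √(j² + j)`. -/
noncomputable def flatSolution (j : ℕ) : ℂ → ℂ :=
  homTerm flatSine 1 1 j 0 (holderExponent j)

section flatSolution

variable {j : ℕ}

theorem holderExponent_pos (hj : 1 ≤ j) : 0 < holderExponent j := by
  have h : (1 : ℝ) ≤ j := by exact_mod_cast hj
  rw [holderExponent, sub_pos]
  exact Real.lt_sqrt_of_sq_lt (by linarith)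

theorem holderExponent_lt_one (hj : 1 ≤ j) : holderExponent j < 1 := by
  have h : (1 : ℝ) ≤ j := by exact_mod_cast hj
  rw [holderExponent, sub_lt_iff_lt_add, Real.sqrt_lt' (by linarith)]
  nlinarith

theorem holderExponent_sq (j : ℕ) :
    (j + holderExponent j) ^ 2 = (j : ℝ) ^ 2 + j := by
  rw [holderExponent, add_sub_cancel, Real.sq_sqrt (by positivity)]

theorem floor_sqrt (hj : 1 ≤ j) : ⌊Real.sqrt ((j : ℝ) ^ 2 + j)⌋₊ = j := by
  have h1 := holderExponent_pos hj
  have h2 := holderExponent_lt_one hj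
  rw [holderExponent] at h1 h2
  rw [Nat.floor_eq_iff (Real.sqrt_nonneg _)]
  constructor <;> linarith

theorem flatSolution_apply (j : ℕ) (z : ℂ) :
    flatSolution j z = flatSine z ^ j * ((‖flatSine z‖ ^ holderExponent j : ℝ) : ℂ) := by
  simp [flatSolution, homTerm]

theorem isHolderOn_flatSolution (hj : 1 ≤ j) :
    IsHolderOn unitDisc j (holderExponent j) (flatSolution j) :=
  isHolderOn_homTerm unitDisc.isOpen (convex_ball 0 1)
    (fun _ hf => (flatAlgebra_bounded hf).imp fun _ hC z hz =>
      hC z (re_lt_one_of_mem_unitDisc hz).le)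
    (fun _ hf => (flatAlgebra_hasDerivAt hf).imp fun _ hC =>
      ⟨hC.1, fun z hz => hC.2 z (re_lt_one_of_mem_unitDisc hz)⟩)
    flatSine_mem (holderExponent_pos hj) (holderExponent_lt_one hj).le j 1 (one_mem _) 1 (one_mem _)
    j 0 (by simp)

theorem memHolderClass_flatSolution (hj : 1 ≤ j) :
    MemHolderClass unitDisc (Real.sqrt ((j : ℝ) ^ 2 + j)) (flatSolution j) := by
  unfold MemHolderClass
  rw [floor_sqrt hj]
  exact isHolderOn_flatSolution hj

theorem continuousOn_flatSolution (hj : 1 ≤ j) :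
    ContinuousOn (flatSolution j) (Metric.closedBall 0 1) := by
  simp only [funext (flatSolution_apply j)]
  have h := continuousOn_flatSine
  exact (h.pow j).mul (Complex.continuous_ofReal.comp_continuousOn
    (h.norm.rpow_const fun _ _ => Or.inr (holderExponent_pos hj).le))

theorem contDiffAt_flatSine {z : ℂ} (hz : z.re < 1) : ContDiffAt ℝ ∞ flatSine z :=
  (differentiableOn_flatSine.analyticAt (isOpen_re_lt_one.mem_nhds hz)).contDiffAt.restrict_scalars ℝ

theorem contDiffAt_flatSolution {z : ℂ} (hz : z.re < 1) (h0 : flatSine z ≠ 0) :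
    ContDiffAt ℝ ∞ (flatSolution j) z := by
  rw [funext (flatSolution_apply j)]
  have h := contDiffAt_flatSine hz
  exact (h.pow j).mul (Complex.ofRealCLM.contDiff.contDiffAt.comp z
    ((h.norm ℝ h0).rpow_const_of_ne (norm_ne_zero_iff.2 h0)))

theorem hasWirtingerAt_flatSolution (hj : 1 ≤ j) {F' : ℂ → ℂ}
    (hF' : ∀ z : ℂ, z.re < 1 → HasDerivAt flatSine (F' z) z) {z : ℂ} (hz : z.re < 1) :
    HasWirtingerAt (flatSolution j)
      (homTerm flatSine (fun w => (j + holderExponent j / 2) * F' w) 1 (j - 1) 0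
        (holderExponent j) z)
      (homTerm flatSine 1 (fun w => holderExponent j / 2 * F' w) j (-1) (holderExponent j) z) z := by
  have hα := holderExponent_pos hj
  by_cases h0 : flatSine z = 0
  · rw [homTerm_eq_zero h0 hα.ne', homTerm_eq_zero h0 hα.ne']
    refine hasWirtingerAt_homTerm_of_zero (hF' z hz) continuousAt_const continuousAt_const h0 hα ?_
    have : (1 : ℝ) ≤ j := by exact_mod_cast hj
    push_cast
    linarith
  · have h1 : ∀ w : ℂ, HasDerivAt (1 : ℂ → ℂ) ((0 : ℂ → ℂ) w) w := fun w => hasDerivAt_const w 1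
    refine (hasWirtingerAt_homTerm (hF' z hz) (h1 z) (h1 z) h0).congr ?_ ?_ <;>
    · simp only [homTerm]; simp

/-- A vanishing gradient forces ∂u = 0, while ∂u = (j + α/2) F' F^{j-1} |F|^α is nonzero wherever F
F' is. -/
theorem grad_flatSolution_ne_zero (hj : 1 ≤ j) {z : ℂ} (hz : z.re < 1)
    (h : flatSine z * flatSineDeriv z ≠ 0) : grad (flatSolution j) z ≠ 0 := by
  intro h0
  have hW := hasWirtingerAt_flatSolution hj (fun z hz => hasDerivAt_flatSine hz) hz
  have h1 := congrArg Prod.fst h0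
  have h2 := congrArg Prod.snd h0
  simp only [grad, Prod.fst_zero, Prod.snd_zero] at h1 h2
  rw [hW.fderiv_one] at h1
  rw [hW.fderiv_I] at h2
  have h3 := (mul_eq_zero.1 h2).resolve_left Complex.I_ne_zero
  have h4 : homTerm flatSine (fun w => (j + holderExponent j / 2) * flatSineDeriv w) 1 (j - 1) 0
      (holderExponent j) z = 0 := by linear_combination (h1 + h3) / 2
  rw [← norm_eq_zero, norm_homTerm (left_ne_zero_of_mul h)] at h4
  have hp : 0 < ‖flatSine z‖ := norm_pos_iff.2 (left_ne_zero_of_mul h)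
  have hs : ((j : ℂ) + holderExponent j / 2) ≠ 0 := by
    have := holderExponent_pos hj
    have : (0 : ℝ) < j + holderExponent j / 2 := by positivity
    exact_mod_cast this.ne'
  have : (0 : ℝ) < ‖flatSine z‖ ^ (((j - 1 : ℤ) : ℝ) + ((0 : ℤ) : ℝ) + holderExponent j) := by
    positivity
  simp only [Pi.one_apply, norm_one, mul_one, mul_eq_zero, this.ne', or_false, norm_eq_zero, hs,
    false_or] at h4
  exact right_ne_zero_of_mul h h4

theorem isolatedIn_grad_flatSolution (hj : 1 ≤ j) :
    IsolatedIn unitDisc {z | z ∈ unitDisc ∧ grad (flatSolution j) z = 0} := fun z hz => by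
  filter_upwards [eventually_flatSine_mul_deriv_ne_zero hz] with w hw h
  exact grad_flatSolution_ne_zero hj (re_lt_one_of_mem_unitDisc h.1) hw h.2

theorem vortex_mul_homTerm {z : ℂ} (h0 : flatSine z ≠ 0) (a b : ℂ → ℂ) (m n : ℤ) (β : ℝ) :
    vortex z * homTerm flatSine a b m n β z = homTerm flatSine a b (m + 1) n (β - 1) z := by
  have hp : 0 < ‖flatSine z‖ := norm_pos_iff.2 h0
  have hp' : (‖flatSine z‖ : ℂ) ≠ 0 := by exact_mod_cast hp.ne'
  simp only [vortex, h0, if_false, homTerm, zpow_add_one₀ h0, Real.rpow_sub_one hp.ne']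
  push_cast
  field_simp

/-- The map g may jump at the zeros of F, but there ∇u is continuous and vanishes, and |g| = 1. -/
theorem continuousOn_vortex_mul_fderiv (hj : 1 ≤ j) (v : ℂ) :
    ContinuousOn (fun z => vortex z * fderiv ℝ (flatSolution j) z v) unitDisc := by
  have hfd : ContinuousOn (fun z => fderiv ℝ (flatSolution j) z v) unitDisc :=
    ((isHolderOn_flatSolution hj).1.continuousOn_fderiv_of_isOpen unitDisc.isOpen
      (by exact_mod_cast hj)).clm_apply continuousOn_const
  intro z hz
  have hzr := re_lt_one_of_mem_unitDisc hz
  by_cases h0 : flatSine z = 0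
  · have hα := holderExponent_pos hj
    have hW := hasWirtingerAt_flatSolution hj (fun z hz => hasDerivAt_flatSine hz) hzr
    rw [homTerm_eq_zero h0 hα.ne', homTerm_eq_zero h0 hα.ne'] at hW
    have h1 : fderiv ℝ (flatSolution j) z v = 0 := by rw [HasFDerivAt.fderiv hW]; simp
    have h2 := (hfd z hz).tendsto.norm
    rw [h1, norm_zero] at h2
    rw [ContinuousWithinAt, h1, mul_zero, tendsto_zero_iff_norm_tendsto_zero]
    simpa only [norm_mul, norm_vortex, one_mul] using h2
  · exact (continuousAt_vortex hzr h0).continuousWithinAt.mul (hfd z hz)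

/-- With p = g ∂u and q = g ∂̄u the divergence is 2(∂̄p + ∂q). Here ∂̄p carries the factor (j +
α/2)(α - 1)/2 and ∂q the factor (α/2)(j + 1 + (α - 1)/2), times the same product; the doubled sum of
the two factors is 2jα + α² - j. -/
theorem div_vortex_mul_grad_flatSolution (hj : 1 ≤ j) {z : ℂ} (hz : z.re < 1)
    (h0 : flatSine z ≠ 0) :
    DifferentiableAt ℝ (fun z => vortex z * fderiv ℝ (flatSolution j) z 1) z ∧
    DifferentiableAt ℝ (fun z => vortex z * fderiv ℝ (flatSolution j) z Complex.I) z ∧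
    fderiv ℝ (fun z => vortex z * fderiv ℝ (flatSolution j) z 1) z 1
      + fderiv ℝ (fun z => vortex z * fderiv ℝ (flatSolution j) z Complex.I) z Complex.I = 0 := by
  obtain ⟨F', hF'A, hF'⟩ := flatAlgebra_hasDerivAt flatSine_mem
  obtain ⟨F'', -, hF''⟩ := flatAlgebra_hasDerivAt hF'A
  set α := holderExponent j with hα
  set p : ℂ → ℂ := homTerm flatSine (fun w => (j + α / 2) * F' w) 1 j 0 (α - 1) with hp
  set q : ℂ → ℂ := homTerm flatSine 1 (fun w => α / 2 * F' w) (j + 1) (-1) (α - 1) with hq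
  have hev : ∀ᶠ w in 𝓝 z, w.re < 1 ∧ flatSine w ≠ 0 :=
    (isOpen_re_lt_one.eventually_mem hz).and ((hF' z hz).continuousAt.eventually_ne h0)
  have hV : ∀ w : ℂ, w.re < 1 → flatSine w ≠ 0 →
      vortex w * fderiv ℝ (flatSolution j) w 1 = p w + q w ∧
      vortex w * fderiv ℝ (flatSolution j) w Complex.I = Complex.I * p w + -Complex.I * q w := by
    intro w hw hw0
    have hW := hasWirtingerAt_flatSolution hj hF' hw
    have e1 := vortex_mul_homTerm hw0 (fun w => (j + α / 2) * F' w) 1 (j - 1) 0 α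
    have e2 := vortex_mul_homTerm hw0 1 (fun w => α / 2 * F' w) j (-1) α
    rw [sub_add_cancel] at e1
    rw [hW.fderiv_one, hW.fderiv_I, hp, hq, ← e1, ← e2]
    constructor <;> ring
  have h1 : ∀ w : ℂ, HasDerivAt (1 : ℂ → ℂ) ((0 : ℂ → ℂ) w) w := fun w => hasDerivAt_const w 1
  have hpW := hasWirtingerAt_homTerm (m := j) (n := 0) (β := α - 1) (F' := F')
    (a' := fun w => (j + α / 2) * F'' w) (hF' z hz)
    ((hF'' z hz).const_mul ((j : ℂ) + α / 2)) (h1 z) h0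
  have hqW := hasWirtingerAt_homTerm (m := j + 1) (n := -1) (β := α - 1) (F' := F')
    (b' := fun w => α / 2 * F'' w) (hF' z hz) (h1 z) ((hF'' z hz).const_mul ((α : ℂ) / 2)) h0
  have W1 := (hpW.add hqW).congr_of_eventuallyEq
    (hev.mono fun w hw => (hV w hw.1 hw.2).1)
  have W2 := ((hpW.const_mul Complex.I).add (hqW.const_mul (-Complex.I))).congr_of_eventuallyEq
    (hev.mono fun w hw => (hV w hw.1 hw.2).2)
  refine ⟨W1.differentiableAt, W2.differentiableAt, ?_⟩
  rw [W1.fderiv_one, W2.fderiv_I]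
  have hI := Complex.I_mul_I
  have red : ∀ a b c d : ℂ, a + c + (b + d)
      + Complex.I * (Complex.I * a + -Complex.I * c - (Complex.I * b + -Complex.I * d))
      = 2 * (b + c) := fun a b c d => by linear_combination (a - c - b + d) * hI
  rw [red]
  -- The one place where the equation for u uses the value √(j² + j) of the degree.
  have hsq : (2 : ℂ) * j * α + α ^ 2 - j = 0 := by
    have h := holderExponent_sq j
    rw [← hα] at h
    have : (2 : ℝ) * j * α + α ^ 2 - j = 0 := by linarith
    exact_mod_cast this
  simp only [homTerm, Pi.one_apply, Pi.zero_apply, zero_mul, zero_add, mul_one, map_mul,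
    map_div₀, Complex.conj_ofReal, map_ofNat, Int.cast_zero, add_sub_cancel_right, zero_sub,
    Int.cast_add, Int.cast_natCast, Int.cast_one]
  push_cast
  linear_combination (F' z * flatSine z ^ (j : ℤ) * conj (F' z) * conj (flatSine z ^ (-1 : ℤ))
    * ((‖flatSine z‖ ^ (α - 1) : ℝ) : ℂ)) * hsq

theorem hasDistribDiv_vortex_smul_grad (hj : 1 ≤ j) :
    HasDistribDiv unitDisc (fun z => vortex z • grad (flatSolution j) z) (fun _ => 0) := by
  refine ⟨ContinuousOn.locallyIntegrableOn ?_ unitDisc.isOpen.measurableSet, fun ψ => ?_⟩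
  · exact (continuousOn_vortex_mul_fderiv hj 1).prodMk (continuousOn_vortex_mul_fderiv hj Complex.I)
  · have hψ : ContDiff ℝ 1 ψ := ψ.contDiff.of_le (by exact_mod_cast le_top)
    have hd := fun (z : ℂ) (hz : z ∈ (unitDisc : Set ℂ)) (hzS : z ∉ range cuspPoint) =>
      div_vortex_mul_grad_flatSolution hj (re_lt_one_of_mem_unitDisc hz) (flatSine_ne_zero hz hzS)
    have := setIntegral_field_mul_fderiv unitDisc.isOpen countable_range_cuspPoint hψ
      ψ.hasCompactSupport ψ.tsupport_subset (continuousOn_vortex_mul_fderiv hj 1)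
      (continuousOn_vortex_mul_fderiv hj Complex.I) (fun z hz hzS => (hd z hz hzS).1)
      (fun z hz hzS => (hd z hz hzS).2.1) (D := fun _ => 0) (fun z hz hzS => (hd z hz hzS).2.2)
      (by simp)
    simp only [zero_mul, integral_zero, neg_zero] at this
    rw [neg_eq_zero]
    exact this

end flatSolution

/-! ### Smoothness of the boundary trace -/

/-- The parametrization `θ ↦ e^{iθ}` of the unit circle. -/
noncomputable def circleParam (θ : ℝ) : ℂ := Complex.exp (θ * Complex.I)

section trace

variable {θ : ℝ} {j : ℕ}

theorem norm_circleParam (θ : ℝ) : ‖circleParam θ‖ = 1 := Complex.norm_exp_ofReal_mul_I θ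

theorem circleParam_mem (θ : ℝ) : circleParam θ ∈ Metric.closedBall (0 : ℂ) 1 :=
  mem_closedBall_zero_iff.2 (norm_circleParam θ).le

theorem circleParam_re_lt (h : circleParam θ ≠ 1) : (circleParam θ).re < 1 :=
  re_lt_one_of_mem_closedBall (circleParam_mem θ) h

theorem flatSine_circleParam_ne_zero (h : circleParam θ ≠ 1) : flatSine (circleParam θ) ≠ 0 := by
  intro h0
  obtain ⟨k, hk⟩ := exists_eq_cuspPoint (circleParam_mem θ) h h0
  have h1 := mem_ball_zero_iff.1 (cuspPoint_mem k)
  rw [hk, norm_circleParam] at h1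
  exact h1.false

theorem hasDerivAt_circleParam (θ : ℝ) :
    HasDerivAt circleParam (Complex.I * circleParam θ) θ := by
  have h1 : HasDerivAt (fun θ : ℝ => (θ : ℂ) * Complex.I) Complex.I θ := by
    simpa using (Complex.ofRealCLM.hasDerivAt (x := θ)).mul_const Complex.I
  exact h1.cexp.congr_deriv (mul_comm _ _)

/-- The cotangent of `π cuspLog`. -/
noncomputable def cuspCot (z : ℂ) : ℂ :=
  Complex.cos (Real.pi * cuspLog z) / Complex.sin (Real.pi * cuspLog z)

/-- Functions of slow growth on the circle, holomorphic part. -/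
noncomputable def slowHol : Subalgebra ℂ (ℝ → ℂ) :=
  Algebra.adjoin ℂ {circleParam, fun θ => cuspLog (circleParam θ), fun θ => (1 - circleParam θ)⁻¹,
    fun θ => cuspCot (circleParam θ)}

/-- Functions of slow growth on the circle. -/
noncomputable def slowAlgebra : Subalgebra ℂ (ℝ → ℂ) :=
  Algebra.adjoin ℂ ({f | f ∈ slowHol} ∪ {f | ∃ g ∈ slowHol, f = fun θ => conj (g θ)})

theorem slowHol_le {f : ℝ → ℂ} (hf : f ∈ slowHol) : f ∈ slowAlgebra :=
  Algebra.subset_adjoin (Or.inl hf)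

theorem conj_mem_slowAlgebra {f : ℝ → ℂ} (hf : f ∈ slowHol) :
    (fun θ => conj (f θ)) ∈ slowAlgebra :=
  Algebra.subset_adjoin (Or.inr ⟨f, hf, rfl⟩)

theorem circleParam_mem_slowHol : circleParam ∈ slowHol := Algebra.subset_adjoin (by simp)

theorem cuspLog_mem_slowHol : (fun θ => cuspLog (circleParam θ)) ∈ slowHol :=
  Algebra.subset_adjoin (by simp)

theorem inv_mem_slowHol : (fun θ => (1 - circleParam θ)⁻¹) ∈ slowHol :=
  Algebra.subset_adjoin (by simp)

theorem cuspCot_mem_slowHol : (fun θ => cuspCot (circleParam θ)) ∈ slowHol :=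
  Algebra.subset_adjoin (by simp)

theorem adjoin_hasDerivAt {s : Set (ℝ → ℂ)} {A : Subalgebra ℂ (ℝ → ℂ)} {T : Set ℝ}
    (hsA : Algebra.adjoin ℂ s ≤ A)
    (hs : ∀ f ∈ s, ∃ f' ∈ A, ∀ θ ∈ T, HasDerivAt f (f' θ) θ) {f : ℝ → ℂ}
    (hf : f ∈ Algebra.adjoin ℂ s) : ∃ f' ∈ A, ∀ θ ∈ T, HasDerivAt f (f' θ) θ := by
  induction hf using Algebra.adjoin_induction with
  | mem f hf => exact hs f hf
  | algebraMap r => exact ⟨0, zero_mem _, fun θ _ => hasDerivAt_const θ r⟩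
  | add f g _ _ hf hg =>
    obtain ⟨f', hf', hA⟩ := hf
    obtain ⟨g', hg', hB⟩ := hg
    exact ⟨f' + g', add_mem hf' hg', fun z hz => (hA z hz).add (hB z hz)⟩
  | mul f g hf₀ hg₀ hf hg =>
    obtain ⟨f', hf', hA⟩ := hf
    obtain ⟨g', hg', hB⟩ := hg
    exact ⟨f' * g + f * g', add_mem (mul_mem hf' (hsA hg₀)) (mul_mem (hsA hf₀) hg'),
      fun z hz => (hA z hz).mul (hB z hz)⟩

/-- The bound t ≤ 1 lets the weights be raised to a common power when adding; for products the
powers add. -/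
theorem adjoin_growth {s : Set (ℝ → ℂ)} {T : Set ℝ} {t : ℝ → ℝ} (ht0 : ∀ θ ∈ T, 0 ≤ t θ)
    (hs : ∀ f ∈ s, ∃ (N : ℕ) (C : ℝ), ∀ θ ∈ T, ‖f θ‖ * t θ ^ N ≤ C) (ht1 : ∀ θ ∈ T, t θ ≤ 1)
    {f : ℝ → ℂ} (hf : f ∈ Algebra.adjoin ℂ s) :
    ∃ (N : ℕ) (C : ℝ), ∀ θ ∈ T, ‖f θ‖ * t θ ^ N ≤ C := by
  induction hf using Algebra.adjoin_induction with
  | mem f hf => exact hs f hf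
  | algebraMap r => exact ⟨0, ‖r‖, fun θ _ => by simp⟩
  | add f g _ _ hf hg =>
    obtain ⟨N, C, hC⟩ := hf
    obtain ⟨M, D, hD⟩ := hg
    refine ⟨N + M, C + D, fun θ hθ => ?_⟩
    have h0 := ht0 θ hθ
    have h1 := ht1 θ hθ
    have e1 : ‖f θ‖ * t θ ^ (N + M) ≤ C :=
      (mul_le_mul_of_nonneg_left (pow_le_pow_of_le_one h0 h1 (Nat.le_add_right N M))
        (norm_nonneg _)).trans (hC θ hθ)
    have e2 : ‖g θ‖ * t θ ^ (N + M) ≤ D :=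
      (mul_le_mul_of_nonneg_left (pow_le_pow_of_le_one h0 h1 (Nat.le_add_left M N))
        (norm_nonneg _)).trans (hD θ hθ)
    calc ‖f θ + g θ‖ * t θ ^ (N + M) ≤ (‖f θ‖ + ‖g θ‖) * t θ ^ (N + M) := by
          gcongr; exact norm_add_le _ _
      _ ≤ C + D := by linarith
  | mul f g _ _ hf hg =>
    obtain ⟨N, C, hC⟩ := hf
    obtain ⟨M, D, hD⟩ := hg
    refine ⟨N + M, C * D, fun θ hθ => ?_⟩
    have h0 := ht0 θ hθ
    have h2 : 0 ≤ ‖f θ‖ * t θ ^ N := by positivity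
    rw [Pi.mul_apply, norm_mul, pow_add]
    calc ‖f θ‖ * ‖g θ‖ * (t θ ^ N * t θ ^ M) = (‖f θ‖ * t θ ^ N) * (‖g θ‖ * t θ ^ M) := by ring
      _ ≤ C * D := mul_le_mul (hC θ hθ) (hD θ hθ) (by positivity) (h2.trans (hC θ hθ))

theorem slowHol_hasDerivAt {f : ℝ → ℂ} (hf : f ∈ slowHol) :
    ∃ f' ∈ slowHol, ∀ θ ∈ {θ | circleParam θ ≠ 1}, HasDerivAt f (f' θ) θ := by
  have he := circleParam_mem_slowHol
  have hE := inv_mem_slowHol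
  have hIe : Complex.I • circleParam ∈ slowHol := slowHol.smul_mem he _
  have hlog : ∀ θ ∈ {θ | circleParam θ ≠ 1}, HasDerivAt (fun θ => cuspLog (circleParam θ))
      ((1 - circleParam θ)⁻¹ * (Complex.I * circleParam θ)) θ := fun θ hθ => by
    have := (hasDerivAt_cuspLog (circleParam_re_lt hθ)).scomp θ (hasDerivAt_circleParam θ)
    rw [exp_cuspLog hθ] at this
    exact this.congr_deriv (by simp [mul_comm])
  refine adjoin_hasDerivAt le_rfl (fun f hf => ?_) hf
  rcases hf with rfl | rfl | rfl | rfl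
  · exact ⟨_, hIe, fun θ _ => hasDerivAt_circleParam θ⟩
  · exact ⟨_, mul_mem hE hIe, hlog⟩
  · refine ⟨_, mul_mem (mul_mem hE hE) hIe, fun θ hθ => ?_⟩
    have hne : 1 - circleParam θ ≠ 0 := sub_ne_zero.2 (Ne.symm hθ)
    refine (((hasDerivAt_circleParam θ).const_sub 1).fun_inv hne).congr_deriv ?_
    simp only [Pi.mul_apply, Pi.smul_apply, smul_eq_mul]
    field_simp
  · refine ⟨_, mul_mem (mul_mem (slowHol.smul_mem (add_mem (one_mem _)
      (mul_mem cuspCot_mem_slowHol cuspCot_mem_slowHol)) (-Real.pi : ℂ)) hE) hIe, fun θ hθ => ?_⟩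
    have hs : Complex.sin (Real.pi * cuspLog (circleParam θ)) ≠ 0 :=
      (mul_ne_zero_iff.1 (flatSine_circleParam_ne_zero hθ)).2
    have hl := (hlog θ hθ).const_mul (Real.pi : ℂ)
    have hcos := (Complex.hasDerivAt_cos _).scomp θ hl
    have hsin := (Complex.hasDerivAt_sin _).scomp θ hl
    refine (hcos.div hsin hs).congr_deriv ?_
    simp only [Pi.mul_apply, Pi.smul_apply, smul_eq_mul, Pi.add_apply, Pi.one_apply, cuspCot,
      Function.comp_apply]
    have hne : 1 - circleParam θ ≠ 0 := sub_ne_zero.2 (Ne.symm hθ)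
    generalize Complex.sin (Real.pi * cuspLog (circleParam θ)) = s at *
    generalize Complex.cos (Real.pi * cuspLog (circleParam θ)) = c at *
    field_simp
    ring

theorem slowAlgebra_hasDerivAt {f : ℝ → ℂ} (hf : f ∈ slowAlgebra) :
    ∃ f' ∈ slowAlgebra, ∀ θ ∈ {θ | circleParam θ ≠ 1}, HasDerivAt f (f' θ) θ := by
  refine adjoin_hasDerivAt le_rfl (fun f hf => ?_) hf
  rcases hf with hf | ⟨g, hg, rfl⟩
  · obtain ⟨f', hf', h⟩ := slowHol_hasDerivAt hf
    exact ⟨f', slowHol_le hf', h⟩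
  · obtain ⟨g', hg', h⟩ := slowHol_hasDerivAt hg
    exact ⟨_, conj_mem_slowAlgebra hg', fun θ hθ =>
      (Complex.conjCLE : ℂ →L[ℝ] ℂ).hasFDerivAt.comp_hasDerivAt θ (h θ hθ)⟩

/-- The part of the circle close to `1`. -/
def nearOne : Set ℝ := {θ | circleParam θ ≠ 1 ∧ ‖1 - circleParam θ‖ < 1}

/-- On the circle Re(1 - z) = |1 - z|²/2, so cos arg(1 - z) = |1 - z|/2 < 1/2, and cos x ≥ 1 - x²/2
yields |arg(1 - z)| ≥ 1. Thus L stays away from the real axis, where the zeros of the sine lie. -/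
theorem one_le_abs_cuspLog_im (hθ : θ ∈ nearOne) : 1 ≤ |(cuspLog (circleParam θ)).im| := by
  obtain ⟨h1, h2⟩ := hθ
  have hn := Complex.sq_norm (circleParam θ)
  rw [norm_circleParam, Complex.normSq_apply] at hn
  have hm := Complex.sq_norm (1 - circleParam θ)
  rw [Complex.normSq_apply] at hm
  simp only [Complex.sub_re, Complex.one_re, Complex.sub_im, Complex.one_im] at hm
  have hpos : 0 < ‖1 - circleParam θ‖ := norm_pos_iff.2 (sub_ne_zero.2 h1.symm)
  have hcos := Complex.cos_arg (sub_ne_zero.2 h1.symm)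
  have hre : (1 - circleParam θ).re = ‖1 - circleParam θ‖ ^ 2 / 2 := by
    rw [Complex.sub_re, Complex.one_re]; nlinarith
  rw [hre] at hcos
  have hlt : Real.cos (1 - circleParam θ).arg < 1 / 2 := by
    rw [hcos, div_lt_iff₀ hpos]; nlinarith
  have := Real.one_sub_sq_div_two_le_cos (x := (1 - circleParam θ).arg)
  rw [cuspLog, Complex.neg_im, abs_neg, Complex.log_im]
  rw [← one_le_sq_iff_one_le_abs]
  linarith

theorem slowHol_growth {f : ℝ → ℂ} (hf : f ∈ slowHol) :
    ∃ (N : ℕ) (C : ℝ), ∀ θ ∈ nearOne, ‖f θ‖ * ‖1 - circleParam θ‖ ^ N ≤ C := by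
  refine adjoin_growth (fun _ _ => norm_nonneg _) (fun f hf => ?_) (fun θ hθ => hθ.2.le) hf
  rcases hf with rfl | rfl | rfl | rfl
  · exact ⟨0, 1, fun θ _ => by simp [norm_circleParam]⟩
  · refine ⟨1, 3, fun θ hθ => ?_⟩
    have hpos : 0 < ‖1 - circleParam θ‖ := norm_pos_iff.2 (sub_ne_zero.2 hθ.1.symm)
    have h1 := norm_cuspLog_le (circleParam_re_lt hθ.1).le
    rw [cuspLog_re, abs_neg] at h1
    have h2 := Real.abs_log_mul_self_lt _ hpos hθ.2.le
    rw [abs_mul, abs_of_pos hpos] at h2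
    have h3 := hθ.2
    rw [pow_one]
    nlinarith
  · refine ⟨1, 1, fun θ hθ => ?_⟩
    have hpos : 0 < ‖1 - circleParam θ‖ := norm_pos_iff.2 (sub_ne_zero.2 hθ.1.symm)
    rw [norm_inv, pow_one, inv_mul_cancel₀ hpos.ne']
  · refine ⟨0, Real.exp (2 * Real.pi), fun θ hθ => ?_⟩
    have hpi := Real.pi_gt_three
    have hy := one_le_abs_cuspLog_im hθ
    have hy2 : |(cuspLog (circleParam θ)).im| ≤ 2 :=
      (abs_cuspLog_im_le (circleParam_re_lt hθ.1).le).trans (by linarith [Real.pi_le_four])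
    have him : |(Real.pi * cuspLog (circleParam θ)).im| = Real.pi * |(cuspLog (circleParam θ)).im| := by
      rw [Complex.im_ofReal_mul, abs_mul, abs_of_pos Real.pi_pos]
    have hc : ‖Complex.cos (Real.pi * cuspLog (circleParam θ))‖ ≤ Real.exp (2 * Real.pi) := by
      refine (norm_cos_le _).trans (Real.exp_le_exp.2 ?_)
      rw [him]; nlinarith
    have hs : 1 ≤ ‖Complex.sin (Real.pi * cuspLog (circleParam θ))‖ := by
      have h1 := sq_norm_sin (Real.pi * cuspLog (circleParam θ))
      have h2 : 1 ≤ |Real.sinh (Real.pi * cuspLog (circleParam θ)).im| := by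
        rw [Real.abs_sinh, him]
        have : Real.pi * |(cuspLog (circleParam θ)).im|
            ≤ Real.sinh (Real.pi * |(cuspLog (circleParam θ)).im|) :=
          Real.self_le_sinh_iff.2 (by positivity)
        nlinarith
      have h3 := (one_le_sq_iff_one_le_abs _).2 h2
      have h4 := sq_nonneg (Real.sin (Real.pi * cuspLog (circleParam θ)).re)
      by_contra hlt
      push Not at hlt
      have := norm_nonneg (Complex.sin (Real.pi * cuspLog (circleParam θ)))
      nlinarith
    change ‖cuspCot (circleParam θ)‖ * _ ≤ _
    rw [pow_zero, mul_one, cuspCot, norm_div, div_le_iff₀ (by linarith)]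
    nlinarith [Real.exp_pos (2 * Real.pi)]

theorem slowAlgebra_growth {f : ℝ → ℂ} (hf : f ∈ slowAlgebra) :
    ∃ (N : ℕ) (C : ℝ), ∀ θ ∈ nearOne, ‖f θ‖ * ‖1 - circleParam θ‖ ^ N ≤ C := by
  refine adjoin_growth (fun _ _ => norm_nonneg _) (fun f hf => ?_) (fun θ hθ => hθ.2.le) hf
  rcases hf with hf | ⟨g, hg, rfl⟩
  · exact slowHol_growth hf
  · simpa only [RCLike.norm_conj] using slowHol_growth hg

theorem flatSolution_one (hj : 1 ≤ j) : flatSolution j 1 = 0 := by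
  rw [flatSolution_apply, flatSine_one, zero_pow (by omega), zero_mul]

theorem exists_norm_flatSolution_le (hj : 1 ≤ j) (N : ℕ) :
    ∃ C : ℝ, ∀ z : ℂ, z.re < 1 → ‖flatSolution j z‖ ≤ C * ‖1 - z‖ ^ N := by
  obtain ⟨B, hB⟩ := flatAlgebra_bounded flatSine_mem
  obtain ⟨C, hC0, hC⟩ := exists_norm_flatSine_le N
  have hα := holderExponent_pos hj
  have hB0 : 0 ≤ B := (norm_nonneg _).trans (hB 0 (by simp))
  refine ⟨C * B ^ (j - 1) * B ^ holderExponent j, fun z hz => ?_⟩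
  have e : ‖flatSine z‖ ^ j = ‖flatSine z‖ * ‖flatSine z‖ ^ (j - 1) := by
    rw [← pow_succ']; congr 1; omega
  rw [flatSolution_apply, norm_mul, norm_pow, Complex.norm_real, Real.norm_of_nonneg (by positivity),
    e]
  have hBz := hB z hz.le
  calc ‖flatSine z‖ * ‖flatSine z‖ ^ (j - 1) * ‖flatSine z‖ ^ holderExponent j
      ≤ (C * ‖1 - z‖ ^ N) * B ^ (j - 1) * B ^ holderExponent j := by
        gcongr
        exact hC z hz
    _ = _ := by ring

/-- With η = (F'/F) · i e^{iθ}, the logarithmic derivative of F^j |F|^α along the circle is (j +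
α/2) η + (α/2) η̄, and η is a polynomial in the generators of `slowHol`. -/
theorem exists_trace_deriv (j : ℕ) : ∃ ρ ∈ slowAlgebra, ∀ θ ∈ {θ | circleParam θ ≠ 1},
    HasDerivAt (fun θ => flatSolution j (circleParam θ))
      (flatSolution j (circleParam θ) * ρ θ) θ := by
  set α := holderExponent j with hα
  set η : ℝ → ℂ := (fun θ => (1 - circleParam θ)⁻¹) *
    ((Real.pi : ℂ) • (fun θ => cuspCot (circleParam θ)) - (2 : ℂ) • fun θ => cuspLog (circleParam θ))
      * (Complex.I • circleParam) with hη
  have hηmem : η ∈ slowHol := mul_mem (mul_mem inv_mem_slowHol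
    (sub_mem (slowHol.smul_mem cuspCot_mem_slowHol _) (slowHol.smul_mem cuspLog_mem_slowHol _)))
    (slowHol.smul_mem circleParam_mem_slowHol _)
  refine ⟨((j : ℂ) + α / 2) • η + ((α : ℂ) / 2) • fun θ => conj (η θ),
    add_mem (slowAlgebra.smul_mem (slowHol_le hηmem) _)
      (slowAlgebra.smul_mem (conj_mem_slowAlgebra hηmem) _), fun θ hθ => ?_⟩
  have hre := circleParam_re_lt hθ
  have h0 := flatSine_circleParam_ne_zero hθ
  have hF := hasDerivAt_flatSine hre
  have hW := (HasWirtingerAt.of_hasDerivAt (hF.pow j)).mul (hasWirtingerAt_norm_rpow hF h0 α)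
  have hd := HasFDerivAt.comp_hasDerivAt θ hW (hasDerivAt_circleParam θ)
  have hη' : η θ = flatLogDeriv (circleParam θ) * (Complex.I * circleParam θ) := by
    rw [flatLogDeriv_eq _ h0, exp_cuspLog hθ]
    simp [hη, cuspCot]
    ring
  have hfun : (fun θ => flatSolution j (circleParam θ)) =
      (fun w => (flatSine ^ j) w * ((‖flatSine w‖ ^ α : ℝ) : ℂ)) ∘ circleParam := by
    funext θ; simp [flatSolution_apply, hα]
  rw [hfun]
  refine hd.congr_deriv ?_
  have hpow : (j : ℂ) * flatSine (circleParam θ) ^ (j - 1) * flatSine (circleParam θ)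
      = j * flatSine (circleParam θ) ^ j := by
    rcases Nat.eq_zero_or_pos j with rfl | hpos
    · simp
    · rw [mul_assoc, ← pow_succ, Nat.sub_add_cancel hpos]
  simp only [add_apply, smul_apply, one_apply_eq_self, ContinuousLinearEquiv.coe_coe,
    Complex.conjCLE_apply, smul_eq_mul, Pi.add_apply, Pi.smul_apply, hη', flatSolution_apply, ← hα,
    Pi.pow_apply, flatLogDeriv, zero_mul, zero_add, map_mul]
  generalize flatSine (circleParam θ) = F at *
  generalize flatSineDeriv (circleParam θ) = F' at *
  have e : (j : ℂ) * F ^ (j - 1) * F' = j * F ^ j * (F' / F) := by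
    rw [← hpow]; field_simp
  rw [e]
  ring

/-- Products of the trace of u with functions of slow growth are closed under differentiation, at
every θ including those over the point 1. There u = 0, so the value assigned to ρ is irrelevant and
the derivative is 0. -/
theorem hasDerivAt_trace_mul (hj : 1 ≤ j) {ρ : ℝ → ℂ} (hρ : ρ ∈ slowAlgebra) :
    ∃ ρ' ∈ slowAlgebra, ∀ θ, HasDerivAt (fun θ => flatSolution j (circleParam θ) * ρ θ)
      (flatSolution j (circleParam θ) * ρ' θ) θ := by
  obtain ⟨ρ₀, hρ₀, h₀⟩ := exists_trace_deriv j
  obtain ⟨ρ₁, hρ₁, h₁⟩ := slowAlgebra_hasDerivAt hρ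
  refine ⟨ρ₀ * ρ + ρ₁, add_mem (mul_mem hρ₀ hρ) hρ₁, fun θ => ?_⟩
  by_cases hθ : circleParam θ = 1
  · rw [hθ, flatSolution_one hj, zero_mul, hasDerivAt_iff_isLittleO]
    simp only [hθ, flatSolution_one hj, zero_mul, sub_zero, smul_zero]
    obtain ⟨N, C, hC⟩ := slowAlgebra_growth hρ
    -- N powers of |1 - z| absorb the growth of ρ; the two left over make the product O(|1 - z|²),
    -- hence o(x - θ).
    obtain ⟨D, hD⟩ := exists_norm_flatSolution_le hj (N + 2)
    have hsmall : ∀ᶠ x in 𝓝 θ, ‖1 - circleParam x‖ < 1 := by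
      have : ContinuousAt (fun x => ‖1 - circleParam x‖) θ :=
        (continuousAt_const.sub (hasDerivAt_circleParam θ).continuousAt).norm
      refine this.eventually_lt continuousAt_const ?_
      simp [hθ]
    have hO : (fun x => 1 - circleParam x) =O[𝓝 θ] fun x => x - θ := by
      have := (hasDerivAt_circleParam θ).hasFDerivAt.isBigO_sub
      rw [hθ] at this
      exact this.neg_left.congr_left fun x => by ring
    have h2 : (fun x => ‖1 - circleParam x‖ ^ 2) =o[𝓝 θ] fun x => x - θ := by
      have h3 : (fun x => ‖1 - circleParam x‖) =o[𝓝 θ] fun _ => (1 : ℝ) := by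
        rw [Asymptotics.isLittleO_one_iff]
        have : ContinuousAt (fun x => ‖1 - circleParam x‖) θ :=
          (continuousAt_const.sub (hasDerivAt_circleParam θ).continuousAt).norm
        simpa [ContinuousAt, hθ] using this
      exact (h3.mul_isBigO hO.norm_left).congr (fun x => by ring) fun x => by ring
    refine Asymptotics.IsBigO.trans_isLittleO (Asymptotics.IsBigO.of_bound (D * C) ?_) h2
    filter_upwards [hsmall] with x hx
    rw [Real.norm_of_nonneg (by positivity)]
    by_cases hx1 : circleParam x = 1
    · rw [hx1, flatSolution_one hj]; simp
    · have hpos : 0 < ‖1 - circleParam x‖ := norm_pos_iff.2 (sub_ne_zero.2 (Ne.symm hx1))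
      have e1 := hD _ (circleParam_re_lt hx1)
      have e2 := hC x ⟨hx1, hx⟩
      have hD0 : 0 ≤ D := by
        by_contra hneg
        push Not at hneg
        have : D * ‖1 - circleParam x‖ ^ (N + 2) < 0 := mul_neg_of_neg_of_pos hneg (by positivity)
        linarith [norm_nonneg (flatSolution j (circleParam x))]
      rw [norm_mul]
      calc ‖flatSolution j (circleParam x)‖ * ‖ρ x‖
          ≤ D * ‖1 - circleParam x‖ ^ (N + 2) * ‖ρ x‖ := by gcongr
        _ = D * (‖ρ x‖ * ‖1 - circleParam x‖ ^ N) * ‖1 - circleParam x‖ ^ 2 := by ring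
        _ ≤ D * C * ‖1 - circleParam x‖ ^ 2 := by gcongr
  · refine ((h₀ θ hθ).mul (h₁ θ hθ)).congr_deriv ?_
    simp only [Pi.add_apply, Pi.mul_apply]
    ring

theorem contDiff_trace_mul (hj : 1 ≤ j) (n : ℕ) : ∀ ρ ∈ slowAlgebra,
    ContDiff ℝ n fun θ => flatSolution j (circleParam θ) * ρ θ := by
  induction n with
  | zero =>
    intro ρ hρ
    obtain ⟨ρ', -, h⟩ := hasDerivAt_trace_mul hj hρ
    simpa using continuous_iff_continuousAt.2 fun θ => (h θ).continuousAt
  | succ n ih =>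
    intro ρ hρ
    obtain ⟨ρ', hρ', h⟩ := hasDerivAt_trace_mul hj hρ
    rw [Nat.cast_add, Nat.cast_one, contDiff_succ_iff_deriv]
    refine ⟨fun θ => (h θ).differentiableAt, by simp, ?_⟩
    rw [funext fun θ => (h θ).deriv]
    exact ih ρ' hρ'

theorem contDiff_trace (hj : 1 ≤ j) :
    ContDiff ℝ ∞ fun θ : ℝ => flatSolution j (Complex.exp (θ * Complex.I)) := by
  rw [contDiff_infty]
  intro n
  have h := contDiff_trace_mul hj n 1 (one_mem _)
  simp only [Pi.one_apply, mul_one] at h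
  exact h

end trace

/-! ### Assembly -/

theorem theorem2 (p : ℝ≥0∞) (hp : p < 2) (j : ℕ) (hj : 1 ≤ j) :
    ∃ (g : ℂ → ℂ) (Dg : ℂ → ℂ × ℂ) (P : ℕ → ℂ) (q : ℂ) (u : ℂ → ℂ),
      -- the singular points are infinitely many, in the disc, and isolated
      Function.Injective P ∧ (∀ k, P k ∈ unitDisc) ∧ IsolatedIn unitDisc (range P) ∧
      -- they accumulate at a single boundary point only
      ‖q‖ = 1 ∧ Tendsto P atTop (𝓝 q) ∧
      -- `g` has values in the circle, with the regularity claimed, and weak gradient `Dg`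
      (∀ z ∈ Metric.closedBall (0 : ℂ) 1, ‖g z‖ = 1) ∧
      ContinuousOn g (Metric.closedBall 0 1 \ insert q (range P)) ∧
      MemW1p unitDisc p g Dg ∧ MemW1WeakL2Loc unitDisc g Dg ∧
      -- the two equations for `g`
      HasDistribDiv unitDisc (fun z => (Complex.I * conj (g z)) • Dg z) (fun _ => 0) ∧
      HasDistribDiv unitDisc (fun z => (Complex.I * conj (g z)) • perp (Dg z))
        (fun ψ => 2 * Real.pi * ∑' k, ψ (P k)) ∧
      -- `u` and its equation
      MemHolderClass unitDisc (Real.sqrt ((j : ℝ) ^ 2 + j)) u ∧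
      HasDistribDiv unitDisc (fun z => g z • grad u z) (fun _ => 0) ∧
      -- further properties of `u`
      ContDiffOn ℝ ∞ u (unitDisc \ range P) ∧
      IsolatedIn unitDisc {z | z ∈ unitDisc ∧ grad u z = 0} ∧
      ContinuousOn u (Metric.closedBall 0 1) ∧
      ContDiff ℝ ∞ (fun θ : ℝ => u (Complex.exp (θ * Complex.I))) := by
  refine ⟨vortex, vortexGrad, cuspPoint, 1, flatSolution j, cuspPoint_injective, cuspPoint_mem,
    isolatedIn_range_cuspPoint, norm_one, tendsto_cuspPoint, fun z _ => norm_vortex z,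
    fun z hz => ?_, memW1p_vortex hp, memW1WeakL2Loc_vortex, hasDistribDiv_vortexGrad,
    hasDistribDiv_perp_vortexGrad, memHolderClass_flatSolution hj,
    hasDistribDiv_vortex_smul_grad hj, fun z hz => ?_, isolatedIn_grad_flatSolution hj,
    continuousOn_flatSolution hj, contDiff_trace hj⟩
  · obtain ⟨hz, hzP⟩ := hz
    rw [mem_insert_iff, not_or] at hzP
    exact (continuousAt_vortex (re_lt_one_of_mem_closedBall hz hzP.1) fun h0 =>
      hzP.2 (exists_eq_cuspPoint hz hzP.1 h0)).continuousWithinAt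
  · exact (contDiffAt_flatSolution (re_lt_one_of_mem_unitDisc hz.1)
      (flatSine_ne_zero hz.1 hz.2)).contDiffWithinAt
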